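/- Let $L>0$, and let $g\in C[0,\infty)\cap C^2(0,\infty)$ satisfy $g(0)=0$; suppose there is $\sigma>0$ with $(\sigma-u)g(u)>0$ for all $u>0$, $u\neq\sigma$, and $g''(u)<0$ on $(0,\sigma)$. For $\lambda,\mu>0$ consider positive solutions of $$-\left(\frac{u'}{\sqrt{1-u'^2}}\right)'=\lambda g(u)-\mu\ \text{ in }(-L,L),\qquad u(-L)=u(L)=0, \tag{1.1}$$ that is, functions $u\in C^2(-L,L)\cap C[-L,L]$ with $|u'|<1$ and $u>0$ on $(-L,L)$ that satisfy (1.1). The limit $g'(0^+)=\lim_{u\to0^+}g'(u)$ exists in $(0,\infty]$; put $\kappa=\pi^2/(4g'(0^+)L^2)$ if $g'(0^+)<\infty$ and $\kappa=0$ if $g'(0^+)=\infty$. For every $\mu>0$ the bifurcation curve $$S_\mu=\{(\lambda,\|u\|_\infty):\lambda>0,\ u\text{ is a positive solution of (1.1)}\}$$ is a continuous $\subset$-shaped curve: it is the graph $\{(\Lambda_\mu(\alpha),\alpha):\theta\le\alpha<m\}$ of a continuous function $\Lambda_\mu$ that is strictly decreasing on $[\theta,\alpha^*]$ and strictly increasing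 on $[\alpha^*,m)$, for some $\theta<\alpha^*<m$. Let $\bar\lambda(\mu)=\Lambda_\mu(\theta)$ be the $\lambda$-coordinate of its starting point, and $\lambda^*(\mu)=\Lambda_\mu(\alpha^*)$ that of its unique turning point. The function $f(u)=\bar\lambda(\mu)g(u)-\mu$ has exactly two zeros $\varsigma<\beta$ in $(0,\sigma)$, it is positive on $(\varsigma,\beta)$ and negative on $(0,\varsigma)\cup(\beta,\sigma)$, and $\theta\in(\varsigma,\beta)$ satisfies $\int_0^\theta f(u)\,du=0$. Then the following hold. (i) $\bar\lambda$ and $\lambda^*$ are strictly increasing and continuous on $(0,\infty)$, with $$\lim_{\mu\to0^+}\bar\lambda(\mu)=4\kappa,\quad \lim_{\mu\to\infty}\bar\lambda(\mu)=\infty,\quad \lim_{\mu\to0^+}\lambda^*(\mu)=\kappa,\quad \lim_{\mu\to\infty}\lambda^*(\mu)=\infty.$$ (ii) For $\mu>0$ and $\lambda>0$, problem (1.1) has no positive solution if $\lambda<\lambda^*(\mu)$; exactly one positive solution if $\lambda>\bar\lambda(\mu)$ or $\lambda=\lambda^*(\mu)$; and exactly two positive solutions if $\lambda^*(\mu)<\lambda<\bar\lambda(\mu)$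 or $\lambda=\bar\lambda(\mu)$. -/

import Mathlib

open Set Filter Topology

namespace MinkowskiHarvest

/-- Standing assumptions on the growth function `g` with carrying capacity `σ`:
`g ∈ C[0,∞) ∩ C²(0,∞)`, `g(0) = 0`, `(σ - u) g(u) > 0` for positive `u ≠ σ`, and `g'' < 0` on
`(0,σ)`. Values of `g` at negative arguments are irrelevant. -/
structure IsGrowth (g : ℝ → ℝ) (σ : ℝ) : Prop where
  sigma_pos : 0 < σ
  continuousOn : ContinuousOn g (Ici 0)
  contDiffOn : ContDiffOn ℝ 2 g (Ioi 0)
  map_zero : g 0 = 0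
  sign : ∀ u : ℝ, 0 < u → u ≠ σ → 0 < (σ - u) * g u
  concave : ∀ u ∈ Ioo (0 : ℝ) σ, deriv (deriv g) u < 0

/-- `g'(0⁺)`, the limit of `g'(u)` as `u → 0⁺`, in the extended reals. -/
noncomputable def rightDerivZero (g : ℝ → ℝ) : EReal :=
  limUnder (𝓝[>] (0 : ℝ)) (fun u : ℝ => ((deriv g u : ℝ) : EReal))

open Classical in
/-- `κ = π² / (4 g'(0⁺) L²)` if `g'(0⁺)` is finite, and `κ = 0` if `g'(0⁺) = ∞`. -/
noncomputable def kappa (g : ℝ → ℝ) (L : ℝ) : ℝ :=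
  if rightDerivZero g = ⊤ then 0
  else Real.pi ^ 2 / (4 * (rightDerivZero g).toReal * L ^ 2)

/-- `u ∈ C²(-L,L) ∩ C[-L,L]` is a positive solution of
`-(u' / √(1 - u'²))' = lam g(u) - μ` in `(-L,L)`, `u(-L) = u(L) = 0`. -/
structure IsPositiveSolution (g : ℝ → ℝ) (L μ lam : ℝ) (u : ℝ → ℝ) : Prop where
  continuousOn : ContinuousOn u (Icc (-L) L)
  contDiffOn : ContDiffOn ℝ 2 u (Ioo (-L) L)
  slope : ∀ x ∈ Ioo (-L) L, |deriv u x| < 1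
  equation : ∀ x ∈ Ioo (-L) L,
    -deriv (fun y => deriv u y / Real.sqrt (1 - (deriv u y) ^ 2)) x = lam * g (u x) - μ
  left : u (-L) = 0
  right : u L = 0
  pos : ∀ x ∈ Ioo (-L) L, 0 < u x

/-- The set of positive solutions, as functions on `[-L,L]`. -/
def positiveSolutions (g : ℝ → ℝ) (L μ lam : ℝ) : Set (Icc (-L) L → ℝ) :=
  (fun (u : ℝ → ℝ) (x : Icc (-L) L) => u x) '' {u | IsPositiveSolution g L μ lam u}

/-- `‖u‖_∞` on `[-L,L]`. -/
noncomputable def supNorm (L : ℝ) (u : ℝ → ℝ) : ℝ :=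
  sSup ((fun x => |u x|) '' Icc (-L) L)

/-- The bifurcation curve `S_μ` of positive solutions in the `(lam, ‖u‖_∞)`-plane. -/
def bifurcationCurve (g : ℝ → ℝ) (L μ : ℝ) : Set (ℝ × ℝ) :=
  {p | 0 < p.1 ∧ ∃ u : ℝ → ℝ, IsPositiveSolution g L μ p.1 u ∧ supNorm L u = p.2}

/-- `θ` is the number `θ_{μ,lam}`: with `f(u) = lam g(u) - μ` and `F(u) = ∫₀ᵘ f`, there are
`0 < ς < β < σ` such that `f < 0` on `(0,ς) ∪ (β,σ)`, `f(ς) = f(β) = 0`, `f > 0` on `(ς,β)`,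
and `θ ∈ (ς,β)` is the zero of `F` there. -/
def IsTheta (g : ℝ → ℝ) (σ μ lam θ : ℝ) : Prop :=
  ∃ ς β : ℝ, 0 < ς ∧ ς < β ∧ β < σ ∧
    (∀ u ∈ Ioo 0 ς ∪ Ioo β σ, lam * g u - μ < 0) ∧
    lam * g ς - μ = 0 ∧ lam * g β - μ = 0 ∧
    (∀ u ∈ Ioo ς β, 0 < lam * g u - μ) ∧
    θ ∈ Ioo ς β ∧ lam * (∫ t in (0 : ℝ)..θ, g t) - μ * θ = 0

/-- In the `(lam, α)`-plane, `S` is a continuous `⊂`-shaped curve which starts from the point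
`start` and has exactly one turning point `turn`: `S` is the graph `lam = Λ(α)` of a continuous
function over an interval `[start.2, m)`; from `start` the curve moves to the left with growing
`α` until it reaches `turn`, and to the right after that. -/
def IsSubsetShaped (S : Set (ℝ × ℝ)) (start turn : ℝ × ℝ) : Prop :=
  ∃ (m : ℝ) (Λ : ℝ → ℝ), start.2 < turn.2 ∧ turn.2 < m ∧
    ContinuousOn Λ (Ico start.2 m) ∧
    Λ start.2 = start.1 ∧ Λ turn.2 = turn.1 ∧
    StrictAntiOn Λ (Icc start.2 turn.2) ∧ StrictMonoOn Λ (Ico turn.2 m) ∧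
    S = (fun α => (Λ α, α)) '' Ico start.2 m

/-- The curve determines its starting point and its turning point. -/
theorem IsSubsetShaped.unique {S : Set (ℝ × ℝ)} {s t s' t' : ℝ × ℝ}
    (h : IsSubsetShaped S s t) (h' : IsSubsetShaped S s' t') : s = s' ∧ t = t' := by
  have key : ∀ {s t s' t' : ℝ × ℝ}, IsSubsetShaped S s t → IsSubsetShaped S s' t' →
      s'.2 ≤ s.2 ∧ s ∈ S ∧ t ∈ S ∧ (∀ p ∈ S, p.2 ≠ t.2 → t.1 < p.1) ∧
      (∀ p ∈ S, ∀ q ∈ S, p.2 = q.2 → p = q) := by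
    rintro s t s' t' ⟨m, Λ, h1, h2, -, h4, h5, h6, h7, h8⟩ ⟨m', Λ', -, -, -, -, -, -, -, h8'⟩
    have hs : s ∈ S := by
      rw [h8]; exact ⟨s.2, ⟨le_rfl, h1.trans h2⟩, by simp [h4]⟩
    refine ⟨?_, hs, ?_, ?_, ?_⟩
    · rw [h8'] at hs
      obtain ⟨α, hα, rfl⟩ := hs
      exact hα.1
    · rw [h8]; exact ⟨t.2, ⟨h1.le, h2⟩, by simp [h5]⟩
    · intro p hp hne
      rw [h8] at hp
      obtain ⟨α, hα, rfl⟩ := hp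
      simp only at hne ⊢
      rw [← h5]
      rcases lt_or_gt_of_ne hne with hlt | hgt
      · exact h6 ⟨hα.1, hlt.le⟩ ⟨h1.le, le_rfl⟩ hlt
      · exact h7 ⟨le_rfl, h2⟩ ⟨hgt.le, hα.2⟩ hgt
    · intro p hp q hq hpq
      rw [h8] at hp hq
      obtain ⟨α, -, rfl⟩ := hp
      obtain ⟨β, -, rfl⟩ := hq
      simp only at hpq
      rw [hpq]
  obtain ⟨a1, a2, a3, a4, a5⟩ := key h h'
  obtain ⟨b1, b2, b3, b4, -⟩ := key h' h
  refine ⟨a5 _ a2 _ b2 (le_antisymm b1 a1), a5 _ a3 _ b3 ?_⟩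
  by_contra hne
  exact lt_asymm (a4 _ b3 (Ne.symm hne)) (b4 _ a3 hne)

end MinkowskiHarvest

/-! Quadrature. Put f(u) = lam g(u) - μ and F(u) = lam G(u) - μ u, where G' = g and G(0) = 0.
Multiplying the equation by u' shows that 1/√(1 - u'²) + F(u) is constant. Normalized at the maximum
α, this says |u'| = 1 / `slowness` w with w = F(α) - F(u). A positive solution is therefore even,
decreasing on [0, L] and determined by α. It exists exactly when α is admissible (0 < α < σ, F(α) ≥
0, f(α) > 0) and the time map T(α) = ∫₀¹ α · `slowness` (F(α) - F(αs)) ds equals L. The bifurcation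
curve is thus the level set T = L (`bifurcationCurve_eq_timeCurve`).

Shape. T is strictly decreasing in lam, so the level set is a graph lam = Λ(α). For fixed lam, T is
strictly convex in τ = 1/α: the time density is `density` τ X with X = τ² (F(α) - F(αs)), its
logarithm is jointly convex (`log_density_hessian_pos`), it decreases in X, and X is concave in τ
because τ g(r/τ) is the perspective of a concave function while the μ-term is linear in τ
(`rescaled_concave`). Quasiconvexity survives the change from τ to α, and monotonicity in lam
carries it over to Λ: Λ(γ) < max(Λ(α), Λ(β)) for γ between α and β. As Λ tends to infinity at min(σ,
L) and first drops below its initial value, it has exactly one minimum.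

Starting point. There F(θ) = 0. On the zero-energy locus T increases strictly with the amplitude and
decreases with lam, and for fixed μ it takes values below and above L. At zero energy the density
has a singularity of order s^(-1/2) at s = 0, which positive energy removes. Just right of θ this
gain is of order √(α - θ), against a convexity loss of order α - θ, so the curve first turns left
(`IsStart.exists_timeMap_lt`).

Dependence on μ. Comparison of gaps makes both coordinates `lamBar` and `lamStar` increase with μ
while their quotients by μ do not increase; these two facts give continuity. The limits at 0 come
from comparing g with γu, for which the integrals of 1/√(1 - s²) and 1/√(s(1 - s)) produce π/2 and
π, hence κ and 4κ. -/

namespace MinkowskiHarvest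

/-! ### The reciprocal speed of a solution as a function of the energy gap -/

/-- The time per unit length `1 / |u'|` of a solution, as a function of the energy gap
`w = F(‖u‖) - F(u)`. -/
noncomputable def slowness (w : ℝ) : ℝ := (1 + w) / Real.sqrt (w * (w + 2))

theorem slowness_pos {w : ℝ} (hw : 0 < w) : 0 < slowness w := by
  unfold slowness; positivity

theorem slowness_sq {w : ℝ} (hw : 0 < w) : slowness w ^ 2 = 1 + 1 / (w * (w + 2)) := by
  unfold slowness
  rw [div_pow, Real.sq_sqrt (by positivity)]
  field_simp
  ring

theorem one_lt_slowness {w : ℝ} (hw : 0 < w) : 1 < slowness w := by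
  have h := slowness_sq hw
  have h2 : 0 < 1 / (w * (w + 2)) := by positivity
  nlinarith [slowness_pos hw]

theorem slowness_strictAntiOn : StrictAntiOn slowness (Ioi 0) := by
  intro a ha b hb hab
  simp only [mem_Ioi] at ha hb
  refine lt_of_pow_lt_pow_left₀ 2 (slowness_pos ha).le ?_
  rw [slowness_sq ha, slowness_sq hb]
  gcongr

theorem slowness_anti {a b : ℝ} (ha : 0 < a) (hab : a ≤ b) : slowness b ≤ slowness a :=
  slowness_strictAntiOn.antitoneOn ha (ha.trans_le hab : (0 : ℝ) < b) hab

theorem slowness_le {w : ℝ} (hw : 0 < w) : slowness w ≤ 1 + 1 / Real.sqrt (2 * w) := by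
  refine (sq_le_sq₀ (slowness_pos hw).le (by positivity)).1 ?_
  rw [slowness_sq hw]
  have h : (1 / Real.sqrt (2 * w)) ^ 2 = 1 / (2 * w) := by
    rw [div_pow, Real.sq_sqrt (by positivity)]; simp
  have h1 : 1 / (w * (w + 2)) ≤ 1 / (2 * w) := by
    apply one_div_le_one_div_of_le (by positivity); nlinarith
  have h2 : 0 < 1 / Real.sqrt (2 * w) := by positivity
  nlinarith

theorem le_slowness {w : ℝ} (hw : 0 < w) : 1 / Real.sqrt (w * (w + 2)) ≤ slowness w := by
  unfold slowness
  gcongr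
  linarith

theorem continuousOn_slowness : ContinuousOn slowness (Ioi 0) := by
  unfold slowness
  apply ContinuousOn.div (by fun_prop) (by fun_prop)
  intro w hw
  simp only [mem_Ioi] at hw
  positivity

theorem measurable_slowness : Measurable slowness := by
  unfold slowness; fun_prop

theorem mul_slowness_sq {a x : ℝ} (ha : 0 < a) (hx : 0 < x) :
    (a * slowness (a ^ 2 * x)) ^ 2 = a ^ 2 + 1 / (x * (a ^ 2 * x + 2)) := by
  rw [mul_pow, slowness_sq (by positivity)]
  field_simp

/-- The square of the density is a² + 1/(y(a²y + 2)). When a grows to b, the second term loses less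
than a quarter of what the first gains. This drives the monotonicity of the time along the
zero-energy locus. -/
theorem mul_slowness_scaled_lt {a b x y : ℝ} (ha : 0 < a) (hab : a < b) (hy : 0 < y)
    (hyx : y ≤ x) : a * slowness (a ^ 2 * x) < b * slowness (b ^ 2 * y) := by
  have hx : 0 < x := hy.trans_le hyx
  have hb : 0 < b := ha.trans hab
  calc a * slowness (a ^ 2 * x) ≤ a * slowness (a ^ 2 * y) := by
        gcongr
        exact slowness_anti (by positivity) (by gcongr)
    _ < b * slowness (b ^ 2 * y) := by
        refine lt_of_pow_lt_pow_left₀ 2 (by have := slowness_pos (w := b ^ 2 * y) (by positivity); positivity) ?_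
        rw [mul_slowness_sq ha hy, mul_slowness_sq hb hy]
        have hs : a ^ 2 < b ^ 2 := by gcongr
        rw [← sub_pos]
        have : b ^ 2 + 1 / (y * (b ^ 2 * y + 2)) - (a ^ 2 + 1 / (y * (a ^ 2 * y + 2)))
            = (b ^ 2 - a ^ 2) * (1 - 1 / ((a ^ 2 * y + 2) * (b ^ 2 * y + 2))) := by
          field_simp
          ring
        rw [this]
        apply mul_pos (by linarith)
        rw [sub_pos, div_lt_one (by positivity)]
        have h1 : 0 < a ^ 2 * y := by positivity
        have h2 : 0 < b ^ 2 * y := by positivity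
        nlinarith

/-- 1/√(2x) is the limit as a → 0, the density of the linear operator -u''. Together with the upper
bound a + 1/√(2x) below, it yields sharp constants in the limits μ → 0. -/
theorem lt_mul_slowness_scaled {a x : ℝ} (ha : 0 < a) (hx : 0 < x) :
    1 / Real.sqrt (2 * x) < a * slowness (a ^ 2 * x) := by
  refine lt_of_pow_lt_pow_left₀ 2
    (by have := slowness_pos (w := a ^ 2 * x) (by positivity); positivity) ?_
  rw [mul_slowness_sq ha hx, div_pow, Real.sq_sqrt (by positivity), ← sub_pos]
  have : a ^ 2 + 1 / (x * (a ^ 2 * x + 2)) - 1 ^ 2 / (2 * x)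
      = a ^ 2 * (1 - 1 / (2 * (a ^ 2 * x + 2))) := by
    field_simp
    ring
  rw [this]
  apply mul_pos (by positivity)
  rw [sub_pos, div_lt_one (by positivity)]
  have h1 : 0 < a ^ 2 * x := by positivity
  linarith

theorem mul_slowness_scaled_le {a x : ℝ} (ha : 0 < a) (hx : 0 < x) :
    a * slowness (a ^ 2 * x) ≤ a + 1 / Real.sqrt (2 * x) := by
  have h := slowness_le (w := a ^ 2 * x) (by positivity)
  have : Real.sqrt (2 * (a ^ 2 * x)) = a * Real.sqrt (2 * x) := by
    rw [show 2 * (a ^ 2 * x) = a ^ 2 * (2 * x) by ring, Real.sqrt_mul (by positivity),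
      Real.sqrt_sq ha.le]
  rw [this] at h
  calc a * slowness (a ^ 2 * x) ≤ a * (1 + 1 / (a * Real.sqrt (2 * x))) := by gcongr
    _ = a + 1 / Real.sqrt (2 * x) := by field_simp

/-! ### Joint convexity in the reciprocal amplitude and the rescaled gap -/

/-- `slowness (X / τ²) / τ`: the time density in terms of the reciprocal amplitude `τ` and the
rescaled energy gap `X`. -/
noncomputable def density (τ X : ℝ) : ℝ := slowness (X / τ ^ 2) / τ

theorem density_eq_exp {τ X : ℝ} (hτ : 0 < τ) (hX : 0 < X) :
    density τ X = Real.exp (Real.log (X + τ ^ 2) - Real.log τ - Real.log X / 2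
      - Real.log (X + 2 * τ ^ 2) / 2) := by
  rw [← Real.log_sqrt hX.le, ← Real.log_sqrt (by positivity), Real.exp_sub, Real.exp_sub,
    Real.exp_sub, Real.exp_log (by positivity), Real.exp_log hτ, Real.exp_log (by positivity),
    Real.exp_log (by positivity)]
  unfold density slowness
  have : X / τ ^ 2 * (X / τ ^ 2 + 2) = X * (X + 2 * τ ^ 2) / (τ ^ 2) ^ 2 := by
    field_simp
  rw [this, Real.sqrt_div (by positivity), Real.sqrt_sq (by positivity), Real.sqrt_mul hX.le]
  field_simp
  ring

/-- The expression is the Hessian of the logarithm in `density_eq_exp`, applied to the direction (a,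
b). Homogeneity removes τ through X = τ²e, a = τp, b = τ²q. Completing the square in q then leaves a
multiple of p² whose coefficient is a polynomial in e and e + 1 with positive coefficients. -/
theorem log_density_hessian_pos {τ X a b : ℝ} (hτ : 0 < τ) (hX : 0 < X) (hab : a ≠ 0 ∨ b ≠ 0) :
    0 < (2 * a ^ 2 * (X + τ ^ 2) - (b + 2 * τ * a) ^ 2) / (X + τ ^ 2) ^ 2 + a ^ 2 / τ ^ 2
      + b ^ 2 / (2 * X ^ 2)
      - (4 * a ^ 2 * (X + 2 * τ ^ 2) - (b + 4 * τ * a) ^ 2) / (2 * (X + 2 * τ ^ 2) ^ 2) := by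
  obtain ⟨e, he, rfl⟩ : ∃ e, 0 < e ∧ X = τ ^ 2 * e :=
    ⟨X / τ ^ 2, by positivity, by field_simp⟩
  obtain ⟨p, rfl⟩ : ∃ p, a = τ * p := ⟨a / τ, by field_simp⟩
  obtain ⟨q, rfl⟩ : ∃ q, b = τ ^ 2 * q := ⟨b / τ ^ 2, by field_simp⟩
  have key : (2 * (τ * p) ^ 2 * (τ ^ 2 * e + τ ^ 2) - (τ ^ 2 * q + 2 * τ * (τ * p)) ^ 2)
        / (τ ^ 2 * e + τ ^ 2) ^ 2 + (τ * p) ^ 2 / τ ^ 2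
      + (τ ^ 2 * q) ^ 2 / (2 * (τ ^ 2 * e) ^ 2)
      - (4 * (τ * p) ^ 2 * (τ ^ 2 * e + 2 * τ ^ 2) - (τ ^ 2 * q + 4 * τ * (τ * p)) ^ 2)
        / (2 * (τ ^ 2 * e + 2 * τ ^ 2) ^ 2)
      = (((3 * (e + 1) ^ 2 - 1) * q - 2 * (2 * e + 3) * e ^ 2 * p) ^ 2
          + e ^ 3 * (3 * (e + 1) ^ 5 + 9 * (e + 1) ^ 4 + 13 * (e + 1) ^ 3 + 9 * (e + 1) ^ 2
            + 2 * (e + 1)) * p ^ 2)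
        / ((3 * (e + 1) ^ 2 - 1) * ((e + 1) ^ 2 * e ^ 2 * (e + 2) ^ 2)) := by
    have h1 : τ ^ 2 * e + τ ^ 2 = τ ^ 2 * (e + 1) := by ring
    have h2 : τ ^ 2 * e + 2 * τ ^ 2 = τ ^ 2 * (e + 2) := by ring
    have h3 : 3 * (e + 1) ^ 2 - 1 = 3 * e ^ 2 + 6 * e + 2 := by ring
    rw [h1, h2, h3]
    field_simp
    ring
  rw [key]
  have h4 : 0 < 3 * (e + 1) ^ 2 - 1 := by nlinarith
  apply div_pos _ (by positivity)
  by_cases hp : p = 0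
  · subst hp
    have hq : q ≠ 0 := by
      rintro rfl; simp at hab
    have : 0 < q ^ 2 := by positivity
    have h5 : ((3 * (e + 1) ^ 2 - 1) * q) ^ 2 = (3 * (e + 1) ^ 2 - 1) ^ 2 * q ^ 2 := by ring
    simp only [mul_zero, sub_zero, h5]
    positivity
  · have : 0 < p ^ 2 := by positivity
    positivity

theorem log_density_strictConvexOn {τ X : ℝ → ℝ} {a b : ℝ} (dτ : ∀ r, HasDerivAt τ a r)
    (dX : ∀ r, HasDerivAt X b r) (ha : a ≠ 0) (pτ : ∀ r ∈ Icc (0 : ℝ) 1, 0 < τ r)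
    (pX : ∀ r ∈ Icc (0 : ℝ) 1, 0 < X r) :
    StrictConvexOn ℝ (Icc (0 : ℝ) 1) fun r => Real.log (X r + τ r ^ 2) - Real.log (τ r)
      - Real.log (X r) / 2 - Real.log (X r + 2 * τ r ^ 2) / 2 := by
  set ℓ : ℝ → ℝ := fun r => Real.log (X r + τ r ^ 2) - Real.log (τ r) - Real.log (X r) / 2
      - Real.log (X r + 2 * τ r ^ 2) / 2
  set ℓ' : ℝ → ℝ := fun r => (b + 2 * τ r * a) / (X r + τ r ^ 2) - a / τ r - b / X r / 2
      - (b + 2 * (2 * τ r * a)) / (X r + 2 * τ r ^ 2) / 2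
  have dsq : ∀ r, HasDerivAt (fun r => τ r ^ 2) (2 * τ r * a) r := fun r =>
    ((dτ r).pow 2).congr_deriv (by simp)
  have dp : ∀ r, HasDerivAt (fun r => X r + τ r ^ 2) (b + 2 * τ r * a) r := fun r =>
    (dX r).add (dsq r)
  have dq : ∀ r, HasDerivAt (fun r => X r + 2 * τ r ^ 2) (b + 2 * (2 * τ r * a)) r := fun r =>
    (dX r).add ((dsq r).const_mul 2)
  have d1 : ∀ r ∈ Icc (0 : ℝ) 1, HasDerivAt ℓ (ℓ' r) r := by
    intro r hr
    have h1 := pτ r hr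
    have h2 := pX r hr
    exact ((((dp r).log (by positivity)).sub ((dτ r).log h1.ne')).sub
      (((dX r).log h2.ne').div_const 2)).sub (((dq r).log (by positivity)).div_const 2)
  have d2 : ∀ r ∈ Icc (0 : ℝ) 1, 0 < deriv ℓ' r := by
    intro r hr
    have h1 := pτ r hr
    have h2 := pX r hr
    have n1 : HasDerivAt (fun r => b + 2 * τ r * a) (2 * a * a) r :=
      (((dτ r).const_mul 2).mul_const a).const_add b
    have n2 : HasDerivAt (fun r => b + 2 * (2 * τ r * a)) (2 * (2 * a * a)) r :=
      ((((dτ r).const_mul 2).mul_const a).const_mul 2).const_add b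
    have e : HasDerivAt ℓ' _ r := (((n1.div (dp r) (by positivity)).sub
      ((hasDerivAt_const r a).div (dτ r) h1.ne')).sub
      (((hasDerivAt_const r b).div (dX r) h2.ne').div_const 2)).sub
      ((n2.div (dq r) (by positivity)).div_const 2)
    rw [e.deriv]
    refine (log_density_hessian_pos (a := a) (b := b) h1 h2 (Or.inl ha)).trans_eq ?_
    generalize X r = x at h2
    generalize τ r = y at h1
    have hp : 0 < x + y ^ 2 := by positivity
    have hq : 0 < x + 2 * y ^ 2 := by positivity
    simp only [zero_mul, zero_sub]
    have t1 : (2 * a ^ 2 * (x + y ^ 2) - (b + 2 * y * a) ^ 2) / (x + y ^ 2) ^ 2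
      = (2 * a * a * (x + y ^ 2) - (b + 2 * y * a) * (b + 2 * y * a)) / (x + y ^ 2) ^ 2 := by ring
    rw [t1]
    have t2 : (4 * a ^ 2 * (x + 2 * y ^ 2) - (b + 4 * y * a) ^ 2) / (2 * (x + 2 * y ^ 2) ^ 2)
      = (2 * (2 * a * a) * (x + 2 * y ^ 2) - (b + 2 * (2 * y * a)) * (b + 2 * (2 * y * a)))
        / (x + 2 * y ^ 2) ^ 2 / 2 := by
      rw [div_div, mul_comm (2 : ℝ) ((x + 2 * y ^ 2) ^ 2)]; ring
    rw [t2]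
    ring
  apply strictConvexOn_of_deriv2_pos (convex_Icc 0 1)
    (fun r hr => (d1 r hr).continuousAt.continuousWithinAt)
  intro r hr
  rw [interior_Icc] at hr
  have : deriv ℓ =ᶠ[𝓝 r] ℓ' := by
    filter_upwards [Ioo_mem_nhds hr.1 hr.2] with y hy
    exact (d1 y (Ioo_subset_Icc_self hy)).deriv
  simp only [Function.iterate_succ, Function.iterate_zero, Function.comp_def, id]
  rw [this.deriv_eq]
  exact d2 r (Ioo_subset_Icc_self hr)

/-- Strictness comes from the logarithm, which is strictly convex along the segment; the exponential
only has to be monotone and convex. -/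
theorem density_lt_of_segment {τ₀ τ₁ X₀ X₁ t : ℝ} (hτ₀ : 0 < τ₀) (hτ₁ : 0 < τ₁) (hX₀ : 0 < X₀)
    (hX₁ : 0 < X₁) (hne : τ₀ ≠ τ₁) (ht : t ∈ Ioo (0 : ℝ) 1) :
    density ((1 - t) * τ₀ + t * τ₁) ((1 - t) * X₀ + t * X₁)
      < (1 - t) * density τ₀ X₀ + t * density τ₁ X₁ := by
  have pos : ∀ {x y : ℝ}, 0 < x → 0 < y → ∀ r ∈ Icc (0 : ℝ) 1, 0 < (1 - r) * x + r * y := by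
    intro x y hx hy r hr
    rcases hr.1.eq_or_lt with h | h
    · rw [← h]; linarith
    · have := mul_nonneg (sub_nonneg.2 hr.2) hx.le
      have := mul_pos h hy
      linarith
  have lin : ∀ x y r : ℝ, HasDerivAt (fun r => (1 - r) * x + r * y) (y - x) r := fun x y r =>
    ((((hasDerivAt_id r).const_sub 1).mul_const x).add
      ((hasDerivAt_id r).mul_const y)).congr_deriv (by ring)
  have pτ := pos hτ₀ hτ₁
  have pX := pos hX₀ hX₁
  have ht' := Ioo_subset_Icc_self ht
  have hlt := (log_density_strictConvexOn (lin τ₀ τ₁) (lin X₀ X₁) (sub_ne_zero.2 hne.symm)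
    pτ pX).2 (left_mem_Icc.2 zero_le_one) (right_mem_Icc.2 zero_le_one) zero_ne_one
    (sub_pos.2 ht.2) ht.1 (by ring)
  rw [density_eq_exp (pτ t ht') (pX t ht'), density_eq_exp hτ₀ hX₀, density_eq_exp hτ₁ hX₁]
  simp only [smul_eq_mul, mul_zero, mul_one, zero_add, sub_zero, one_mul, zero_mul, add_zero,
    sub_self] at hlt
  exact (Real.exp_lt_exp.2 hlt).trans_le
    (convexOn_exp.2 (mem_univ _) (mem_univ _) (sub_pos.2 ht.2).le ht.1.le (by ring))

theorem density_anti {τ X Y : ℝ} (hτ : 0 < τ) (hX : 0 < X) (hXY : X ≤ Y) :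
    density τ Y ≤ density τ X := by
  unfold density
  gcongr
  exact slowness_anti (by positivity) (by gcongr)

end MinkowskiHarvest

namespace MinkowskiHarvest

/-! ### Continuous concave growth functions and their potential -/

/-- A continuous function on the line which vanishes at `0` and `σ`, is positive and strictly
concave in between, and is not positive to the right of `σ`. -/
structure IsHump (g : ℝ → ℝ) (σ : ℝ) : Prop where
  continuous : Continuous g
  sigma_pos : 0 < σ
  map_zero : g 0 = 0
  map_sigma : g σ = 0
  pos : ∀ u ∈ Ioo 0 σ, 0 < g u
  nonpos : ∀ u, σ < u → g u ≤ 0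
  concave : StrictConcaveOn ℝ (Icc 0 σ) g

/-- The primitive `G(x) = ∫₀ˣ g`. -/
noncomputable def potential (g : ℝ → ℝ) (x : ℝ) : ℝ := ∫ t in (0 : ℝ)..x, g t

theorem potential_zero (g : ℝ → ℝ) : potential g 0 = 0 := by simp [potential]

theorem potential_eq_mul (g : ℝ → ℝ) (x : ℝ) :
    potential g x = x * ∫ t in (0 : ℝ)..1, g (x * t) := by
  rw [intervalIntegral.mul_integral_comp_mul_left]; simp [potential]

namespace IsHump

variable {g : ℝ → ℝ} {σ : ℝ}

theorem hasDerivAt_potential (hg : IsHump g σ) (x : ℝ) : HasDerivAt (potential g) (g x) x :=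
  intervalIntegral.integral_hasDerivAt_right (hg.continuous.intervalIntegrable _ _)
    (hg.continuous.stronglyMeasurableAtFilter _ _) hg.continuous.continuousAt

theorem continuous_potential (hg : IsHump g σ) : Continuous (potential g) :=
  continuous_iff_continuousAt.2 fun x => (hg.hasDerivAt_potential x).continuousAt

theorem potential_sub (hg : IsHump g σ) (x y : ℝ) :
    potential g y - potential g x = ∫ t in x..y, g t :=
  intervalIntegral.integral_interval_sub_left (hg.continuous.intervalIntegrable _ _)
    (hg.continuous.intervalIntegrable _ _)

theorem potential_strictMonoOn (hg : IsHump g σ) : StrictMonoOn (potential g) (Icc 0 σ) := by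
  apply strictMonoOn_of_deriv_pos (convex_Icc 0 σ) hg.continuous_potential.continuousOn
  intro x hx
  rw [interior_Icc] at hx
  rw [(hg.hasDerivAt_potential x).deriv]
  exact hg.pos x hx

theorem potential_pos (hg : IsHump g σ) {α : ℝ} (h0 : 0 < α) (h1 : α ≤ σ) :
    0 < potential g α := by
  have := hg.potential_strictMonoOn (left_mem_Icc.2 hg.sigma_pos.le) ⟨h0.le, h1⟩ h0
  rwa [potential_zero] at this

theorem potential_nonneg (hg : IsHump g σ) {α : ℝ} (h : α ∈ Icc 0 σ) : 0 ≤ potential g α := by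
  rcases h.1.eq_or_lt with h' | h'
  · rw [← h', potential_zero]
  · exact (hg.potential_pos h' h.2).le

theorem potential_sub_scaled_pos (hg : IsHump g σ) {α s : ℝ} (h0 : 0 < α) (h1 : α ≤ σ)
    (hs : s ∈ Ico (0 : ℝ) 1) : 0 < potential g α - potential g (α * s) := by
  have h2 : α * s < α := by nlinarith [hs.2]
  exact sub_pos.2 (hg.potential_strictMonoOn ⟨mul_nonneg h0.le hs.1, h2.le.trans h1⟩
    ⟨h0.le, h1⟩ h2)

theorem potential_sub_le (hg : IsHump g σ) {x y : ℝ} (hx : x ∈ Icc 0 σ) (hy : y ∈ Icc 0 σ) :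
    potential g x - potential g y ≤ potential g σ := by
  have h1 := hg.potential_strictMonoOn.monotoneOn hx (right_mem_Icc.2 hg.sigma_pos.le) hx.2
  have h2 := hg.potential_nonneg hy
  linarith

/-- The difference is α(1 - s) times the mean of g over [αs, α]. The map r ↦ s·α + (1 - s)·αr sends
[0, 1] onto this interval, so concavity bounds that mean below by s g(α) plus (1 - s) times the mean
over [0, α]. -/
theorem potential_sub_scaled_ge (hg : IsHump g σ) {α s : ℝ} (h0 : 0 ≤ α) (h1 : α ≤ σ)
    (hs : s ∈ Icc (0 : ℝ) 1) :
    (1 - s) * (s * (α * g α) + (1 - s) * potential g α)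
      ≤ potential g α - potential g (α * s) := by
  have e1 : potential g α - potential g (α * s)
      = α * (1 - s) * ∫ r in (0 : ℝ)..1, g (α * (1 - s) * r + α * s) := by
    rw [intervalIntegral.mul_integral_comp_mul_add, hg.potential_sub]
    congr 1 <;> ring
  have e2 : (s * g α + (1 - s) * ∫ r in (0 : ℝ)..1, g (α * r))
      = ∫ r in (0 : ℝ)..1, (s * g α + (1 - s) * g (α * r)) := by
    rw [intervalIntegral.integral_add (by simp), intervalIntegral.integral_const_mul]
    · simp
    · exact (hg.continuous.comp (by fun_prop)).const_mul _ |>.intervalIntegrable _ _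
  have hc := hg.continuous
  have e3 : (s * g α + (1 - s) * ∫ r in (0 : ℝ)..1, g (α * r))
      ≤ ∫ r in (0 : ℝ)..1, g (α * (1 - s) * r + α * s) := by
    rw [e2]
    apply intervalIntegral.integral_mono_on zero_le_one
    · exact Continuous.intervalIntegrable (by fun_prop) _ _
    · exact Continuous.intervalIntegrable (by fun_prop) _ _
    intro r hr
    have h2 : α * r ∈ Icc 0 σ := ⟨mul_nonneg h0 hr.1, by nlinarith [hr.1, hr.2]⟩
    have := hg.concave.concaveOn.2 (x := α) ⟨h0, h1⟩ h2 hs.1 (sub_nonneg.2 hs.2) (by ring)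
    simp only [smul_eq_mul] at this
    rwa [show s * α + (1 - s) * (α * r) = α * (1 - s) * r + α * s by ring] at this
  rw [e1, potential_eq_mul g α]
  have := mul_le_mul_of_nonneg_left e3 (mul_nonneg h0 (sub_nonneg.2 hs.2))
  refine le_trans (le_of_eq ?_) this
  ring

/-- Left of α a concave graph lies below the prolonged chord from (α, g(α)) to (σ, 0). No derivative
of g is needed. -/
theorem le_tangent (hg : IsHump g σ) {α u : ℝ} (h1 : α < σ) (hu : u ∈ Icc 0 α) :
    g u ≤ g α + g α / (σ - α) * (α - u) := by
  rcases hu.2.eq_or_lt with rfl | h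
  · simp
  have := hg.concave.concaveOn.slope_anti_adjacent (x := u) (y := α) (z := σ)
    ⟨hu.1, hu.2.trans h1.le⟩ (right_mem_Icc.2 hg.sigma_pos.le) h h1
  rw [hg.map_sigma, le_div_iff₀ (sub_pos.2 h)] at this
  have e : (0 - g α) / (σ - α) = -(g α / (σ - α)) := by ring
  rw [e] at this
  linarith

theorem potential_sub_scaled_le (hg : IsHump g σ) {α s : ℝ} (h0 : 0 < α) (h1 : α < σ)
    (hs : s ∈ Icc (0 : ℝ) 1) :
    potential g α - potential g (α * s)
      ≤ α * (1 - s) * (g α + g α / (σ - α) * (α * (1 - s))) := by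
  have h2 : α * s ≤ α := by nlinarith [hs.2]
  rw [hg.potential_sub]
  have hK : 0 ≤ g α / (σ - α) := div_nonneg (hg.pos α ⟨h0, h1⟩).le (sub_nonneg.2 h1.le)
  calc ∫ t in (α * s)..α, g t
      ≤ ∫ t in (α * s)..α, (g α + g α / (σ - α) * (α * (1 - s))) := by
        apply intervalIntegral.integral_mono_on h2 (hg.continuous.intervalIntegrable _ _) (by simp)
        intro t ht
        refine (hg.le_tangent h1 ⟨(mul_nonneg h0.le hs.1).trans ht.1, ht.2⟩).trans ?_
        gcongr
        linarith [ht.1]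
    _ = _ := by
        rw [intervalIntegral.integral_const, smul_eq_mul]; ring

/-! ### The amplitudes with `g(α)` above the mean of `g` -/

theorem potential_scaled_le (hg : IsHump g σ) {α s : ℝ} (h0 : 0 < α) (h1 : α ≤ σ)
    (h : potential g α ≤ α * g α) (hs : s ∈ Icc (0 : ℝ) 1) :
    potential g (α * s) ≤ s * potential g α := by
  have := hg.potential_sub_scaled_ge h0.le h1 hs
  have h2 : (1 - s) * (s * potential g α) ≤ (1 - s) * (s * (α * g α)) :=
    mul_le_mul_of_nonneg_left (mul_le_mul_of_nonneg_left h hs.1) (sub_nonneg.2 hs.2)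
  nlinarith

theorem potential_scaled_lt (hg : IsHump g σ) {α s : ℝ} (h0 : 0 < α) (h1 : α ≤ σ)
    (h : potential g α < α * g α) (hs : s ∈ Ioo (0 : ℝ) 1) :
    potential g (α * s) < s * potential g α := by
  have := hg.potential_sub_scaled_ge h0.le h1 (Ioo_subset_Icc_self hs)
  have h2 : (1 - s) * (s * potential g α) < (1 - s) * (s * (α * g α)) :=
    mul_lt_mul_of_pos_left (mul_lt_mul_of_pos_left h hs.1) (sub_pos.2 hs.2)
  nlinarith

/-- If g(u) did not exceed its mean on [0, u], then g would be larger than g(u) somewhere before u,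
because g(0) = 0 < g(u). Concavity would make g decrease from u on, and g(α) would lie below the
mean on [0, α]. -/
theorem potential_lt_mul_of_lt (hg : IsHump g σ) {α u : ℝ} (h1 : α ≤ σ)
    (h : potential g α ≤ α * g α) (hu : u ∈ Ioo 0 α) : potential g u < u * g u := by
  by_contra! hc
  have hus : u ∈ Ioo 0 σ := ⟨hu.1, hu.2.trans_le h1⟩
  obtain ⟨t, ht, hgt⟩ : ∃ t ∈ Ioo 0 u, g u < g t := by
    by_contra! hle
    have : ∫ t in (0 : ℝ)..u, g t < ∫ t in (0 : ℝ)..u, g u := by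
      apply intervalIntegral.integral_lt_integral_of_continuousOn_of_le_of_exists_lt hu.1
        hg.continuous.continuousOn continuousOn_const
      · intro x hx
        rcases hx.2.eq_or_lt with h' | h'
        · rw [h']
        · exact hle x ⟨hx.1, h'⟩
      · exact ⟨0, left_mem_Icc.2 hu.1.le, by rw [hg.map_zero]; exact hg.pos u hus⟩
    rw [intervalIntegral.integral_const, smul_eq_mul, sub_zero] at this
    exact absurd hc (not_le.2 this)
  have dec : ∀ v, u < v → v ≤ α → g v < g u := by
    intro v huv hv
    have := hg.concave.concaveOn.slope_anti_adjacent (x := t) (y := u) (z := v)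
      ⟨ht.1.le, (ht.2.trans hus.2).le⟩ ⟨(hu.1.trans huv).le, hv.trans h1⟩ ht.2 huv
    have h3 : (g u - g t) / (u - t) < 0 := div_neg_of_neg_of_pos (by linarith) (by linarith [ht.2])
    have h4 := this.trans_lt h3
    rw [div_lt_iff₀ (sub_pos.2 huv)] at h4
    linarith
  have dec' : ∀ v ∈ Icc u α, g α ≤ g v := by
    intro v hv
    rcases hv.2.eq_or_lt with h' | h'
    · rw [h']
    have := hg.concave.concaveOn.slope_anti_adjacent (x := t) (y := v) (z := α)
      ⟨ht.1.le, (ht.2.trans hus.2).le⟩ ⟨(hu.1.trans hu.2).le, h1⟩ (ht.2.trans_le hv.1) h'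
    have h2 : g v ≤ g u := by
      rcases hv.1.eq_or_lt with h'' | h''
      · rw [h'']
      · exact (dec v h'' hv.2).le
    have h3 : (g v - g t) / (v - t) < 0 :=
      div_neg_of_neg_of_pos (by linarith) (by linarith [ht.2, hv.1])
    have h4 := this.trans_lt h3
    rw [div_lt_iff₀ (sub_pos.2 h')] at h4
    linarith
  have h5 : (α - u) * g α ≤ potential g α - potential g u := by
    rw [hg.potential_sub]
    have : ∫ t in u..α, g α ≤ ∫ t in u..α, g t :=
      intervalIntegral.integral_mono_on hu.2.le (by simp)
        (hg.continuous.intervalIntegrable _ _) dec'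
    simpa using this
  have h6 := dec α hu.2 le_rfl
  nlinarith [hu.1]

theorem exists_potential_lt_mul (hg : IsHump g σ) : ∃ α ∈ Ioo 0 σ, potential g α < α * g α := by
  obtain ⟨a, ha, hmax⟩ := isCompact_Icc.exists_isMaxOn
    (nonempty_Icc.2 hg.sigma_pos.le) hg.continuous.continuousOn
  have hmid : 0 < g (σ / 2) := hg.pos _ ⟨by linarith [hg.sigma_pos], by linarith [hg.sigma_pos]⟩
  have hga : 0 < g a := hmid.trans_le
    (isMaxOn_iff.1 hmax (σ / 2) ⟨by linarith [hg.sigma_pos], by linarith [hg.sigma_pos]⟩)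
  have ha0 : 0 < a := ha.1.lt_of_ne (by rintro rfl; rw [hg.map_zero] at hga; exact hga.false)
  have ha1 : a < σ := ha.2.lt_of_ne (by rintro rfl; rw [hg.map_sigma] at hga; exact hga.false)
  refine ⟨a, ⟨ha0, ha1⟩, ?_⟩
  have : ∫ t in (0 : ℝ)..a, g t < ∫ t in (0 : ℝ)..a, g a := by
    apply intervalIntegral.integral_lt_integral_of_continuousOn_of_le_of_exists_lt ha0
      hg.continuous.continuousOn continuousOn_const
    · intro x hx
      exact hmax ⟨hx.1.le, hx.2.trans ha.2⟩
    · exact ⟨0, left_mem_Icc.2 ha0.le, by rw [hg.map_zero]; exact hga⟩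
  simpa [potential] using this

/-- At ω the value of g equals its mean, so zero energy and zero force coincide there. Starting
amplitudes are confined to (0, ω), and the time blows up as ω is approached along the zero-energy
locus. -/
theorem exists_potential_eq_mul (hg : IsHump g σ) :
    ∃ ω ∈ Ioo 0 σ, potential g ω = ω * g ω ∧
      ∀ α ∈ Ioo 0 σ, (potential g α < α * g α ↔ α < ω) := by
  obtain ⟨a, ha, hlt⟩ := hg.exists_potential_lt_mul
  have hc := hg.continuous
  have hG := hg.continuous_potential
  have hσ := hg.potential_pos hg.sigma_pos le_rfl
  obtain ⟨ω, hω, hz⟩ := intermediate_value_Icc' (f := fun x => x * g x - potential g x) ha.2.le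
    (by fun_prop) (show (0 : ℝ) ∈ Icc _ _ from ⟨by rw [hg.map_sigma]; linarith, by linarith⟩)
  have hz' : potential g ω = ω * g ω := by simp only at hz; linarith
  have h0 : 0 < ω := ha.1.trans_le hω.1
  have h1 : ω < σ := hω.2.lt_of_ne (by
    rintro rfl
    rw [hg.map_sigma] at hz'
    linarith)
  refine ⟨ω, ⟨h0, h1⟩, hz', fun α hα => ⟨fun h => ?_, fun h => ?_⟩⟩
  · by_contra! hle
    rcases hle.eq_or_lt with rfl | hlt'
    · exact absurd hz' h.ne
    · exact absurd hz' (hg.potential_lt_mul_of_lt hα.2.le h.le ⟨h0, hlt'⟩).ne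
  · exact hg.potential_lt_mul_of_lt h1.le hz'.le ⟨hα.1, h⟩

/-! ### Scaling in the amplitude -/

/-- Both chords are compared with the long chord from x₁ to y₂, one endpoint moving at a time. -/
theorem chord_slope_anti (hg : IsHump g σ) {x₁ y₁ x₂ y₂ : ℝ} (hx₁ : 0 ≤ x₁) (h₁ : x₁ < y₁)
    (h₂ : x₂ < y₂) (hx : x₁ ≤ x₂) (hy : y₁ ≤ y₂) (hσ : y₂ ≤ σ) :
    (g y₂ - g x₂) / (y₂ - x₂) ≤ (g y₁ - g x₁) / (y₁ - x₁) := by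
  have m1 : x₁ ∈ Icc 0 σ := ⟨hx₁, by linarith⟩
  have m2 : y₂ ∈ Icc 0 σ := ⟨by linarith, hσ⟩
  have s1 := hg.concave.concaveOn.neg.secant_mono (a := x₁) (x := y₁) (y := y₂) m1
    ⟨by linarith, by linarith⟩ m2 h₁.ne' (by linarith) hy
  have s2 := hg.concave.concaveOn.neg.secant_mono (a := y₂) (x := x₁) (y := x₂) m2
    m1 ⟨by linarith, by linarith⟩ (by linarith) h₂.ne hx
  simp only [Pi.neg_apply] at s1 s2
  have e1 : (-g y₁ - -g x₁) / (y₁ - x₁) = -((g y₁ - g x₁) / (y₁ - x₁)) := by ring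
  have e2 : (-g y₂ - -g x₁) / (y₂ - x₁) = -((g y₂ - g x₁) / (y₂ - x₁)) := by ring
  have e3 : (-g x₁ - -g y₂) / (x₁ - y₂) = -((g y₂ - g x₁) / (y₂ - x₁)) := by
    rw [← neg_sub y₂ x₁, div_neg]; ring
  have e4 : (-g x₂ - -g y₂) / (x₂ - y₂) = -((g y₂ - g x₂) / (y₂ - x₂)) := by
    rw [← neg_sub y₂ x₂, div_neg]; ring
  rw [e1, e2] at s1
  rw [e3, e4] at s2
  linarith

theorem start_gap_eq (hg : IsHump g σ) (α s : ℝ) :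
    s * potential g α - potential g (α * s)
      = α * s * ∫ t in (0 : ℝ)..1, (g (α * t) - g (α * s * t)) := by
  have hc := hg.continuous
  rw [intervalIntegral.integral_sub (Continuous.intervalIntegrable (by fun_prop) _ _)
    (Continuous.intervalIntegrable (by fun_prop) _ _), mul_sub, ← potential_eq_mul g (α * s),
    potential_eq_mul g α]
  ring

/-- By `start_gap_eq` the quotient is an average over t of chord slopes of g between αst and αt,
with nonnegative weights independent of α. Each slope decreases as α grows. -/
theorem start_gap_div_sq_anti (hg : IsHump g σ) {α β s : ℝ} (h0 : 0 < α) (hαβ : α ≤ β)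
    (hβ : β ≤ σ) (hs : s ∈ Ioo (0 : ℝ) 1) :
    (s * potential g β - potential g (β * s)) / β ^ 2
      ≤ (s * potential g α - potential g (α * s)) / α ^ 2 := by
  have hb : 0 < β := h0.trans_le hαβ
  have hc := hg.continuous
  have e : ∀ a, 0 < a → (s * potential g a - potential g (a * s)) / a ^ 2
      = s * ∫ t in (0 : ℝ)..1, (g (a * t) - g (a * s * t)) / a := by
    intro a ha
    rw [hg.start_gap_eq, intervalIntegral.integral_div]
    field_simp
  rw [e α h0, e β hb]
  apply mul_le_mul_of_nonneg_left _ hs.1.le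
  apply intervalIntegral.integral_mono_on zero_le_one
    (Continuous.intervalIntegrable (by fun_prop) _ _)
    (Continuous.intervalIntegrable (by fun_prop) _ _)
  intro t ht
  rcases ht.1.eq_or_lt with rfl | ht0
  · simp
  have lt : ∀ a, 0 < a → a * s * t < a * t := by
    intro a ha
    have := mul_pos ha ht0
    nlinarith [hs.2]
  have hk : 0 < t * (1 - s) := mul_pos ht0 (sub_pos.2 hs.2)
  have hle : s * t ≤ s * t := le_rfl
  have := hg.chord_slope_anti (x₁ := α * s * t) (y₁ := α * t) (x₂ := β * s * t) (y₂ := β * t)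
    (by have := hs.1; positivity) (lt α h0) (lt β hb) (by have := hs.1; gcongr) (by gcongr)
    (by nlinarith [ht.2])
  have e2 : ∀ a, 0 < a → (g (a * t) - g (a * s * t)) / (a * t - a * s * t)
      = (g (a * t) - g (a * s * t)) / a / (t * (1 - s)) := by
    intro a ha
    rw [div_div]; congr 1; ring
  rw [e2 α h0, e2 β hb] at this
  exact (div_le_div_iff_of_pos_right hk).1 this

/-- In terms of τ = 1/α the rescaled difference is the integral of τ g(r/τ) over r ∈ [s, 1]. The
integrand is the perspective of the concave function g, hence concave in τ. -/
theorem rescaled_concave (hg : IsHump g σ) {α β s t : ℝ} (hα : α ∈ Ioc 0 σ)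
    (hβ : β ∈ Ioc 0 σ) (hs : s ∈ Icc (0 : ℝ) 1) (ht : t ∈ Icc (0 : ℝ) 1) {τ : ℝ}
    (hτ : τ = (1 - t) * α⁻¹ + t * β⁻¹) :
    (1 - t) * ((α⁻¹) ^ 2 * (potential g α - potential g (α * s)))
        + t * ((β⁻¹) ^ 2 * (potential g β - potential g (β * s)))
      ≤ τ ^ 2 * (potential g τ⁻¹ - potential g (τ⁻¹ * s)) := by
  have hc := hg.continuous
  have hα0 := hα.1
  have hβ0 := hβ.1
  have hτ0 : 0 < τ := by
    rw [hτ]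
    rcases ht.1.eq_or_lt with h | h
    · rw [← h]; simpa using hα0
    · have := mul_nonneg (sub_nonneg.2 ht.2) (inv_pos.2 hα0).le
      have := mul_pos h (inv_pos.2 hβ0)
      linarith
  have e : ∀ a, 0 < a → (a⁻¹) ^ 2 * (potential g a - potential g (a * s))
      = ∫ r in s..1, a⁻¹ * g (a * r) := by
    intro a ha
    rw [intervalIntegral.integral_const_mul, hg.potential_sub]
    have := intervalIntegral.mul_integral_comp_mul_left (a := s) (b := 1) (f := g) a
    rw [mul_one] at this
    rw [← this]
    field_simp
  have eτ := e τ⁻¹ (inv_pos.2 hτ0)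
  rw [inv_inv] at eτ
  rw [e α hα0, e β hβ0, eτ, ← intervalIntegral.integral_const_mul,
    ← intervalIntegral.integral_const_mul, ← intervalIntegral.integral_add
      (Continuous.intervalIntegrable (by fun_prop) _ _)
      (Continuous.intervalIntegrable (by fun_prop) _ _)]
  apply intervalIntegral.integral_mono_on hs.2
    (Continuous.intervalIntegrable (by fun_prop) _ _)
    (Continuous.intervalIntegrable (by fun_prop) _ _)
  intro r hr
  have hr0 : 0 ≤ r := hs.1.trans hr.1
  have m : ∀ a ∈ Ioc 0 σ, a * r ∈ Icc 0 σ := fun a ha =>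
    ⟨mul_nonneg ha.1.le hr0, by nlinarith [hr.2, ha.1, ha.2]⟩
  have h1t := sub_nonneg.2 ht.2
  have ht0 := ht.1
  have := hg.concave.concaveOn.2 (m α hα) (m β hβ)
    (show 0 ≤ (1 - t) * α⁻¹ / τ by positivity) (show 0 ≤ t * β⁻¹ / τ by positivity)
    (by rw [← add_div, ← hτ, div_self hτ0.ne'])
  simp only [smul_eq_mul] at this
  have e3 : (1 - t) * α⁻¹ / τ * (α * r) + t * β⁻¹ / τ * (β * r) = τ⁻¹ * r := by
    field_simp
    ring
  rw [e3] at this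
  have := mul_le_mul_of_nonneg_left this hτ0.le
  refine le_trans (le_of_eq ?_) this
  field_simp

end IsHump

end MinkowskiHarvest

namespace MinkowskiHarvest

/-! ### Integrals over the unit interval with endpoint singularities -/

theorem integral_lt_of_lt_Ioo {f h : ℝ → ℝ}
    (hf : IntervalIntegrable f MeasureTheory.volume 0 1)
    (hh : IntervalIntegrable h MeasureTheory.volume 0 1) (hlt : ∀ s ∈ Ioo (0 : ℝ) 1, f s < h s) :
    ∫ s in (0 : ℝ)..1, f s < ∫ s in (0 : ℝ)..1, h s := by
  rw [← sub_pos, ← intervalIntegral.integral_sub hh hf]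
  exact intervalIntegral.intervalIntegral_pos_of_pos_on (hh.sub hf)
    (fun s hs => sub_pos.2 (hlt s hs)) zero_lt_one

theorem ae_Ioo_of_mem_uIoc : ∀ᵐ s : ℝ, s ∈ uIoc (0 : ℝ) 1 → s ∈ Ioo (0 : ℝ) 1 := by
  have : ∀ᵐ s : ℝ, s ≠ 1 := by simp [MeasureTheory.ae_iff]
  filter_upwards [this] with s hs hmem
  rw [uIoc_of_le zero_le_one] at hmem
  exact ⟨hmem.1, hmem.2.lt_of_ne hs⟩

theorem hasDerivAt_arcsin_affine {s : ℝ} (hs : s ∈ Ioo (0 : ℝ) 1) :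
    HasDerivAt (fun s => Real.arcsin (2 * s - 1)) (1 / Real.sqrt (s * (1 - s))) s := by
  have h1 : HasDerivAt (fun s : ℝ => 2 * s - 1) 2 s := by
    simpa using ((hasDerivAt_id s).const_mul 2).sub_const 1
  have h2 := (Real.hasDerivAt_arcsin (x := 2 * s - 1) (by linarith [hs.1]) (by linarith [hs.2])).comp
    s h1
  refine h2.congr_deriv ?_
  rw [show 1 - (2 * s - 1) ^ 2 = 2 ^ 2 * (s * (1 - s)) by ring, Real.sqrt_mul (by norm_num),
    Real.sqrt_sq (by norm_num)]
  have : 0 < s * (1 - s) := mul_pos hs.1 (sub_pos.2 hs.2)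
  field_simp

theorem intervalIntegrable_inv_sqrt_mul :
    IntervalIntegrable (fun s : ℝ => 1 / Real.sqrt (s * (1 - s))) MeasureTheory.volume 0 1 := by
  apply intervalIntegral.intervalIntegrable_deriv_of_nonneg
    (g := fun s => Real.arcsin (2 * s - 1)) (by fun_prop)
  · intro s hs
    simp only [zero_le_one, inf_of_le_left, sup_of_le_right] at hs
    exact hasDerivAt_arcsin_affine hs
  · intro s _
    positivity

theorem integral_inv_sqrt_mul :
    ∫ s in (0 : ℝ)..1, 1 / Real.sqrt (s * (1 - s)) = Real.pi := by
  rw [intervalIntegral.integral_eq_sub_of_hasDerivAt_of_le zero_le_one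
    (f := fun s => Real.arcsin (2 * s - 1)) (by fun_prop) (fun s hs => hasDerivAt_arcsin_affine hs)
    intervalIntegrable_inv_sqrt_mul]
  norm_num

theorem hasDerivAt_arcsin_unit {s : ℝ} (hs : s ∈ Ioo (0 : ℝ) 1) :
    HasDerivAt Real.arcsin (1 / Real.sqrt (1 - s ^ 2)) s :=
  Real.hasDerivAt_arcsin (by linarith [hs.1]) (by linarith [hs.2])

theorem intervalIntegrable_inv_sqrt_one_sub_sq :
    IntervalIntegrable (fun s : ℝ => 1 / Real.sqrt (1 - s ^ 2)) MeasureTheory.volume 0 1 := by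
  apply intervalIntegral.intervalIntegrable_deriv_of_nonneg (g := Real.arcsin)
    Real.continuous_arcsin.continuousOn
  · intro s hs
    simp only [zero_le_one, inf_of_le_left, sup_of_le_right] at hs
    exact hasDerivAt_arcsin_unit hs
  · intro s _
    positivity

theorem integral_inv_sqrt_one_sub_sq :
    ∫ s in (0 : ℝ)..1, 1 / Real.sqrt (1 - s ^ 2) = Real.pi / 2 := by
  rw [intervalIntegral.integral_eq_sub_of_hasDerivAt_of_le zero_le_one
    Real.continuous_arcsin.continuousOn (fun s hs => hasDerivAt_arcsin_unit hs)
    intervalIntegrable_inv_sqrt_one_sub_sq]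
  simp

theorem integral_inv_one_sub_add {δ : ℝ} (hδ : 0 < δ) :
    ∫ s in (0 : ℝ)..1, 1 / (1 - s + δ) = Real.log ((1 + δ) / δ) := by
  have := intervalIntegral.integral_comp_sub_left (a := 0) (b := 1) (fun x : ℝ => 1 / x) (1 + δ)
  simp only [sub_zero, add_sub_cancel_left] at this
  rw [← integral_one_div_of_pos hδ (by linarith), ← this]
  congr 1
  ext s
  congr 1
  ring

/-! ### The time map -/

/-- The energy gap `F(α) - F(αs)`, where `F(x) = lam G(x) - μ x`. -/
noncomputable def gap (g : ℝ → ℝ) (lam μ α s : ℝ) : ℝ :=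
  lam * (potential g α - potential g (α * s)) - μ * (α * (1 - s))

/-- The length of the interval on which the solution of amplitude `α` decreases from `α` to `0`. -/
noncomputable def timeMap (g : ℝ → ℝ) (lam μ α : ℝ) : ℝ :=
  ∫ s in (0 : ℝ)..1, α * slowness (gap g lam μ α s)

/-- `α` is an admissible amplitude: `F(α) ≥ 0` and `f(α) > 0`. -/
structure Admissible (g : ℝ → ℝ) (σ lam μ α : ℝ) : Prop where
  pos : 0 < α
  lt : α < σ
  energy : μ * α ≤ lam * potential g α
  force : μ < lam * g α

variable {g : ℝ → ℝ} {σ : ℝ}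

theorem Admissible.lam_pos (hg : IsHump g σ) {lam μ α : ℝ} (h : Admissible g σ lam μ α)
    (hμ : 0 ≤ μ) : 0 < lam :=
  pos_of_mul_pos_left (hμ.trans_lt h.force) (hg.pos α ⟨h.pos, h.lt⟩).le

/-- `potential_sub_scaled_ge` bounds the gap below by s(1 - s) α f(α) + (1 - s)² F(α), and F(α) ≥ 0.
The remaining factor s(1 - s) leaves only integrable inverse square root singularities in the time
density. -/
theorem Admissible.gap_ge (hg : IsHump g σ) {lam μ α s : ℝ} (h : Admissible g σ lam μ α)
    (hμ : 0 ≤ μ) (hs : s ∈ Icc (0 : ℝ) 1) :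
    α * (lam * g α - μ) * (s * (1 - s)) ≤ gap g lam μ α s := by
  have h1 := mul_le_mul_of_nonneg_left (hg.potential_sub_scaled_ge h.pos.le h.lt.le hs)
    (h.lam_pos hg hμ).le
  have h2 : 0 ≤ (1 - s) ^ 2 * (lam * potential g α - μ * α) :=
    mul_nonneg (sq_nonneg _) (sub_nonneg.2 h.energy)
  unfold gap
  nlinarith

theorem Admissible.gap_pos (hg : IsHump g σ) {lam μ α s : ℝ} (h : Admissible g σ lam μ α)
    (hμ : 0 ≤ μ) (hs : s ∈ Ioo (0 : ℝ) 1) : 0 < gap g lam μ α s :=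
  (mul_pos (mul_pos h.pos (sub_pos.2 h.force)) (mul_pos hs.1 (sub_pos.2 hs.2))).trans_le
    (h.gap_ge hg hμ (Ioo_subset_Icc_self hs))

theorem continuous_gap (hg : IsHump g σ) :
    Continuous fun p : ℝ × ℝ × ℝ × ℝ => gap g p.1 p.2.1 p.2.2.1 p.2.2.2 := by
  have := hg.continuous_potential
  unfold gap
  fun_prop

theorem continuous_gap_right (hg : IsHump g σ) (lam μ α : ℝ) : Continuous (gap g lam μ α) := by
  have := hg.continuous_potential
  unfold gap
  fun_prop

theorem gap_le (hg : IsHump g σ) {lam μ α s : ℝ} (hlam : 0 ≤ lam) (hμ : 0 ≤ μ) (h0 : 0 < α)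
    (h1 : α ≤ σ) (hs : s ∈ Icc (0 : ℝ) 1) : gap g lam μ α s ≤ lam * potential g σ := by
  have h2 : 0 ≤ μ * (α * (1 - s)) := mul_nonneg hμ (mul_nonneg h0.le (sub_nonneg.2 hs.2))
  have h3 := mul_le_mul_of_nonneg_left (hg.potential_sub_le (x := α) (y := α * s) ⟨h0.le, h1⟩
    ⟨mul_nonneg h0.le hs.1, by nlinarith [hs.2]⟩) hlam
  unfold gap
  linarith

theorem measurable_integrand (hg : IsHump g σ) (lam μ α : ℝ) :
    Measurable fun s => α * slowness (gap g lam μ α s) :=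
  (measurable_slowness.comp (continuous_gap_right hg lam μ α).measurable).const_mul _

theorem mul_slowness_le_of_ge {α w c s : ℝ} (hα : 0 ≤ α) (hc : 0 < c) (hs : s ∈ Ioo (0 : ℝ) 1)
    (hw : c * (s * (1 - s)) ≤ w) :
    α * slowness w ≤ α + α / Real.sqrt (2 * c) * (1 / Real.sqrt (s * (1 - s))) := by
  have h1 : 0 < s * (1 - s) := mul_pos hs.1 (sub_pos.2 hs.2)
  have h2 : 0 < c * (s * (1 - s)) := mul_pos hc h1
  have h3 := (slowness_anti h2 hw).trans (slowness_le h2)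
  rw [← mul_assoc, Real.sqrt_mul (by positivity)] at h3
  calc α * slowness w ≤ α * (1 + 1 / (Real.sqrt (2 * c) * Real.sqrt (s * (1 - s)))) := by gcongr
    _ = _ := by field_simp

theorem intervalIntegrable_majorant (a b : ℝ) :
    IntervalIntegrable (fun s : ℝ => a + b * (1 / Real.sqrt (s * (1 - s))))
      MeasureTheory.volume 0 1 :=
  (intervalIntegrable_const).add (intervalIntegrable_inv_sqrt_mul.const_mul _)

theorem integral_majorant (a b : ℝ) :
    ∫ s in (0 : ℝ)..1, (a + b * (1 / Real.sqrt (s * (1 - s)))) = a + b * Real.pi := by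
  rw [intervalIntegral.integral_add (by simp) (intervalIntegrable_inv_sqrt_mul.const_mul _),
    intervalIntegral.integral_const_mul, integral_inv_sqrt_mul]
  simp

/-- Integrability of the time density, from a lower bound of the gap. -/
theorem intervalIntegrable_of_gap_ge (hg : IsHump g σ) {lam μ α c : ℝ} (hα : 0 ≤ α) (hc : 0 < c)
    (h : ∀ s ∈ Ioo (0 : ℝ) 1, c * (s * (1 - s)) ≤ gap g lam μ α s) :
    IntervalIntegrable (fun s => α * slowness (gap g lam μ α s)) MeasureTheory.volume 0 1 := by
  apply (intervalIntegrable_majorant α (α / Real.sqrt (2 * c))).mono_fun'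
    (measurable_integrand hg lam μ α).aestronglyMeasurable
  rw [EventuallyLE, MeasureTheory.ae_restrict_iff' measurableSet_uIoc]
  filter_upwards [ae_Ioo_of_mem_uIoc] with s hs hmem
  have hs' := hs hmem
  have hw : 0 < gap g lam μ α s :=
    (mul_pos hc (mul_pos hs'.1 (sub_pos.2 hs'.2))).trans_le (h s hs')
  rw [Real.norm_of_nonneg (mul_nonneg hα (slowness_pos hw).le)]
  exact mul_slowness_le_of_ge hα hc hs' (h s hs')

theorem Admissible.intervalIntegrable (hg : IsHump g σ) {lam μ α : ℝ}
    (h : Admissible g σ lam μ α) (hμ : 0 ≤ μ) :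
    IntervalIntegrable (fun s => α * slowness (gap g lam μ α s)) MeasureTheory.volume 0 1 :=
  intervalIntegrable_of_gap_ge hg h.pos.le (mul_pos h.pos (sub_pos.2 h.force))
    fun _ hs => h.gap_ge hg hμ (Ioo_subset_Icc_self hs)

theorem Admissible.timeMap_le (hg : IsHump g σ) {lam μ α c : ℝ} (h : Admissible g σ lam μ α)
    (hμ : 0 ≤ μ) (hc : 0 < c)
    (hgap : ∀ s ∈ Ioo (0 : ℝ) 1, c * (s * (1 - s)) ≤ gap g lam μ α s) :
    timeMap g lam μ α ≤ α + α / Real.sqrt (2 * c) * Real.pi := by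
  rw [← integral_majorant]
  apply intervalIntegral.integral_mono_on_of_le_Ioo zero_le_one (h.intervalIntegrable hg hμ)
    (intervalIntegrable_majorant _ _)
  intro s hs
  exact mul_slowness_le_of_ge h.pos.le hc hs (hgap s hs)

theorem timeMap_lt_of_gap_lt (hg : IsHump g σ) {lam μ lam' μ' α : ℝ}
    (h : Admissible g σ lam μ α) (h' : Admissible g σ lam' μ' α) (hμ : 0 ≤ μ) (hμ' : 0 ≤ μ')
    (hlt : ∀ s ∈ Ioo (0 : ℝ) 1, gap g lam' μ' α s < gap g lam μ α s) :
    timeMap g lam μ α < timeMap g lam' μ' α := by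
  apply integral_lt_of_lt_Ioo (h.intervalIntegrable hg hμ) (h'.intervalIntegrable hg hμ')
  intro s hs
  exact mul_lt_mul_of_pos_left (slowness_strictAntiOn (h'.gap_pos hg hμ' hs)
    (h.gap_pos hg hμ hs) (hlt s hs)) h.pos

theorem timeMap_lt_of_lam_lt (hg : IsHump g σ) {lam μ lam' α : ℝ}
    (h : Admissible g σ lam μ α) (h' : Admissible g σ lam' μ α) (hμ : 0 ≤ μ) (hlt : lam' < lam) :
    timeMap g lam μ α < timeMap g lam' μ α := by
  refine timeMap_lt_of_gap_lt hg h h' hμ hμ fun s hs => ?_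
  have := mul_lt_mul_of_pos_right hlt
    (hg.potential_sub_scaled_pos h.pos h.lt.le (Ioo_subset_Ico_self hs))
  unfold gap
  linarith

theorem timeMap_lt_of_mu_lt (hg : IsHump g σ) {lam μ μ' α : ℝ}
    (h : Admissible g σ lam μ α) (h' : Admissible g σ lam μ' α) (hμ : 0 ≤ μ) (hlt : μ < μ') :
    timeMap g lam μ α < timeMap g lam μ' α := by
  refine timeMap_lt_of_gap_lt hg h h' hμ (hμ.trans hlt.le) fun s hs => ?_
  have := mul_lt_mul_of_pos_right hlt (mul_pos h.pos (sub_pos.2 hs.2))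
  unfold gap
  linarith

theorem Admissible.mul_slowness_le_timeMap (hg : IsHump g σ) {lam μ α : ℝ}
    (h : Admissible g σ lam μ α) (hμ : 0 ≤ μ) :
    α * slowness (lam * potential g σ) ≤ timeMap g lam μ α := by
  have : ∫ _ in (0 : ℝ)..1, α * slowness (lam * potential g σ) ≤ timeMap g lam μ α := by
    apply intervalIntegral.integral_mono_on_of_le_Ioo zero_le_one (by simp)
      (h.intervalIntegrable hg hμ)
    intro s hs
    exact mul_le_mul_of_nonneg_left (slowness_anti (h.gap_pos hg hμ hs)
      (gap_le hg (h.lam_pos hg hμ).le hμ h.pos h.lt.le (Ioo_subset_Icc_self hs))) h.pos.le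
  simpa using this

theorem Admissible.lt_timeMap (hg : IsHump g σ) {lam μ α : ℝ}
    (h : Admissible g σ lam μ α) (hμ : 0 ≤ μ) : α < timeMap g lam μ α := by
  refine lt_of_lt_of_le ?_ (h.mul_slowness_le_timeMap hg hμ)
  exact lt_mul_of_one_lt_right h.pos (one_lt_slowness
    (mul_pos (h.lam_pos hg hμ) (hg.potential_pos hg.sigma_pos le_rfl)))

/-- Since f(α) = Kδ, the chord bound gives a gap of at most αK(1 - s)(1 - s + δ) ≤ αK(1 - s + δ)².
The density is then at least a constant over 1 - s + δ, and its integral diverges logarithmically as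
the force f(α) tends to 0. -/
theorem Admissible.log_le_timeMap (hg : IsHump g σ) {lam μ α K δ : ℝ}
    (h : Admissible g σ lam μ α) (hμ : 0 ≤ μ) (hK : K = lam * g α / (σ - α) * α)
    (hδ : δ = (lam * g α - μ) / K) :
    α / Real.sqrt ((lam * potential g σ + 2) * (α * K)) * Real.log ((1 + δ) / δ)
      ≤ timeMap g lam μ α := by
  have hlam := h.lam_pos hg hμ
  have hα := h.pos
  have hgα := hg.pos α ⟨h.pos, h.lt⟩
  have hσα := sub_pos.2 h.lt
  have hK0 : 0 < K := by rw [hK]; positivity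
  have hδ0 : 0 < δ := by rw [hδ]; exact div_pos (sub_pos.2 h.force) hK0
  have hM : 0 < lam * potential g σ := mul_pos hlam (hg.potential_pos hg.sigma_pos le_rfl)
  rw [← integral_inv_one_sub_add hδ0, ← intervalIntegral.integral_const_mul]
  apply intervalIntegral.integral_mono_on_of_le_Ioo zero_le_one _ (h.intervalIntegrable hg hμ)
  · intro s hs
    have hs' := Ioo_subset_Icc_self hs
    have h1s := sub_pos.2 hs.2
    have hw := h.gap_pos hg hμ hs
    have hwM := gap_le hg hlam.le hμ h.pos h.lt.le hs'
    have hup : gap g lam μ α s ≤ α * K * (1 - s + δ) ^ 2 := by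
      have h1 := mul_le_mul_of_nonneg_left (hg.potential_sub_scaled_le h.pos h.lt hs') hlam.le
      have e1 : lam * (α * (1 - s) * (g α + g α / (σ - α) * (α * (1 - s)))) - μ * (α * (1 - s))
          = α * (1 - s) * (lam * g α - μ + K * (1 - s)) := by rw [hK]; ring
      have e2 : lam * g α - μ = K * δ := by rw [hδ]; field_simp
      rw [e2] at e1
      have h2 : gap g lam μ α s ≤ α * (1 - s) * (K * δ + K * (1 - s)) := by
        unfold gap; linarith
      refine h2.trans ?_
      have h3 : 0 ≤ α * K * ((1 - s) * δ + δ ^ 2) := by positivity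
      nlinarith
    have hprod : gap g lam μ α s * (gap g lam μ α s + 2)
        ≤ (lam * potential g σ + 2) * (α * K) * (1 - s + δ) ^ 2 := by
      calc _ ≤ (α * K * (1 - s + δ) ^ 2) * (lam * potential g σ + 2) := by gcongr
        _ = _ := by ring
    have h4 := le_slowness hw
    have h5 : 1 / Real.sqrt ((lam * potential g σ + 2) * (α * K) * (1 - s + δ) ^ 2)
        ≤ 1 / Real.sqrt (gap g lam μ α s * (gap g lam μ α s + 2)) := by
      apply one_div_le_one_div_of_le
      · positivity
      · exact Real.sqrt_le_sqrt hprod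
    rw [Real.sqrt_mul (by positivity), Real.sqrt_sq (by positivity)] at h5
    calc _ = α * (1 / (Real.sqrt ((lam * potential g σ + 2) * (α * K)) * (1 - s + δ))) := by
          field_simp
      _ ≤ _ := mul_le_mul_of_nonneg_left (h5.trans h4) hα.le
  · apply ContinuousOn.intervalIntegrable
    apply ContinuousOn.mul continuousOn_const
    apply ContinuousOn.div continuousOn_const (by fun_prop)
    intro s hs
    rw [uIcc_of_le zero_le_one] at hs
    have := sub_nonneg.2 hs.2
    positivity

/-! ### Convexity of the time map in the reciprocal amplitude -/

/-- Concavity keeps the force positive on [α, β], so the energy cannot fall below its nonnegative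
value at α. -/
theorem Admissible.between (hg : IsHump g σ) {lam μ α β γ : ℝ} (hα : Admissible g σ lam μ α)
    (hβ : Admissible g σ lam μ β) (hμ : 0 ≤ μ) (hγ : γ ∈ Icc α β) :
    Admissible g σ lam μ γ := by
  have hlam := hα.lam_pos hg hμ
  have force : ∀ x ∈ Icc α β, μ < lam * g x := by
    intro x hx
    have hseg : x ∈ segment ℝ α β := by rwa [segment_eq_Icc (hx.1.trans hx.2)]
    have := hg.concave.concaveOn.ge_on_segment ⟨hα.pos.le, hα.lt.le⟩ ⟨hβ.pos.le, hβ.lt.le⟩ hseg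
    rcases min_le_iff.1 this with h | h
    · exact hα.force.trans_le (mul_le_mul_of_nonneg_left h hlam.le)
    · exact hβ.force.trans_le (mul_le_mul_of_nonneg_left h hlam.le)
  refine ⟨hα.pos.trans_le hγ.1, hγ.2.trans_lt hβ.lt, ?_, force γ hγ⟩
  have h1 : ∫ t in α..γ, μ / lam ≤ ∫ t in α..γ, g t := by
    apply intervalIntegral.integral_mono_on hγ.1 (by simp)
      (hg.continuous.intervalIntegrable _ _)
    intro x hx
    rw [div_le_iff₀ hlam, mul_comm]
    exact (force x ⟨hx.1, hx.2.trans hγ.2⟩).le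
  rw [intervalIntegral.integral_const, smul_eq_mul, ← hg.potential_sub] at h1
  have h2 := mul_le_mul_of_nonneg_left h1 hlam.le
  have h3 : lam * ((γ - α) * (μ / lam)) = (γ - α) * μ := by field_simp
  have := hα.energy
  nlinarith

theorem density_gap {lam μ α s : ℝ} (hα : 0 < α) :
    density α⁻¹ ((α⁻¹) ^ 2 * gap g lam μ α s) = α * slowness (gap g lam μ α s) := by
  unfold density
  rw [mul_div_cancel_left₀ _ (by positivity), div_inv_eq_mul, mul_comm]

/-- In reciprocal amplitudes the rescaled gap at γ is at least the convex combination of those at α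
and β: `rescaled_concave` handles G, and the harvesting term μ(1 - s)τ is linear. As `density`
decreases in X, its strict convexity on the segment finishes. -/
theorem integrand_lt_of_between (hg : IsHump g σ) {lam μ α β γ s t : ℝ}
    (hα : Admissible g σ lam μ α) (hβ : Admissible g σ lam μ β) (hμ : 0 ≤ μ) (hne : α ≠ β)
    (ht : t ∈ Ioo (0 : ℝ) 1) (hγ : γ⁻¹ = (1 - t) * α⁻¹ + t * β⁻¹) (hs : s ∈ Ioo (0 : ℝ) 1) :
    γ * slowness (gap g lam μ γ s) < (1 - t) * (α * slowness (gap g lam μ α s))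
      + t * (β * slowness (gap g lam μ β s)) := by
  have hα0 := hα.pos
  have hβ0 := hβ.pos
  have hlam := hα.lam_pos hg hμ
  have h1t := sub_pos.2 ht.2
  have ht0 := ht.1
  have hγ0 : 0 < γ := by rw [← inv_pos, hγ]; positivity
  have hwα := hα.gap_pos hg hμ hs
  have hwβ := hβ.gap_pos hg hμ hs
  rw [← density_gap hγ0, ← density_gap hα0, ← density_gap hβ0, hγ]
  refine lt_of_le_of_lt (density_anti (by positivity) ?_ ?_)
    (density_lt_of_segment (t := t) (inv_pos.2 hα0) (inv_pos.2 hβ0) (by positivity)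
      (by positivity) (inv_injective.ne hne) ht)
  · positivity
  · have hc := mul_le_mul_of_nonneg_left (hg.rescaled_concave ⟨hα0, hα.lt.le⟩ ⟨hβ0, hβ.lt.le⟩
      (Ioo_subset_Icc_self hs) (Ioo_subset_Icc_self ht) hγ) hlam.le
    rw [inv_inv] at hc
    rw [← hγ]
    have e : ∀ a : ℝ, 0 < a → (a⁻¹) ^ 2 * gap g lam μ a s
        = lam * ((a⁻¹) ^ 2 * (potential g a - potential g (a * s))) - μ * (1 - s) * a⁻¹ := by
      intro a ha
      unfold gap
      field_simp
    rw [e α hα0, e β hβ0, e γ hγ0]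
    have e2 : μ * (1 - s) * γ⁻¹ = (1 - t) * (μ * (1 - s) * α⁻¹) + t * (μ * (1 - s) * β⁻¹) := by
      rw [hγ]; ring
    rw [e2]
    linarith

theorem exists_weight {α β γ : ℝ} (hα : 0 < α) (hγ : γ ∈ Ioo α β) :
    ∃ t ∈ Ioo (0 : ℝ) 1, γ⁻¹ = (1 - t) * α⁻¹ + t * β⁻¹ ∧ t = (α⁻¹ - γ⁻¹) / (α⁻¹ - β⁻¹) := by
  have h1 : γ⁻¹ < α⁻¹ := inv_strictAnti₀ hα hγ.1
  have h2 : β⁻¹ < γ⁻¹ := inv_strictAnti₀ (hα.trans hγ.1) hγ.2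
  have h3 : 0 < α⁻¹ - β⁻¹ := by linarith
  refine ⟨_, ⟨div_pos (by linarith) h3, (div_lt_one h3).2 (by linarith)⟩, ?_, rfl⟩
  have h4 : (α⁻¹ - γ⁻¹) / (α⁻¹ - β⁻¹) * (α⁻¹ - β⁻¹) = α⁻¹ - γ⁻¹ := div_mul_cancel₀ _ h3.ne'
  linear_combination h4

theorem timeMap_lt_max (hg : IsHump g σ) {lam μ α β γ : ℝ}
    (hα : Admissible g σ lam μ α) (hβ : Admissible g σ lam μ β) (hμ : 0 ≤ μ)
    (hγ : γ ∈ Ioo α β) :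
    timeMap g lam μ γ < max (timeMap g lam μ α) (timeMap g lam μ β) := by
  obtain ⟨t, ht, e, -⟩ := exists_weight hα.pos hγ
  have hγ' := hα.between hg hβ hμ (Ioo_subset_Icc_self hγ)
  have hlt : timeMap g lam μ γ < (1 - t) * timeMap g lam μ α + t * timeMap g lam μ β := by
    have i1 := (hα.intervalIntegrable hg hμ).const_mul (1 - t)
    have i2 := (hβ.intervalIntegrable hg hμ).const_mul t
    unfold timeMap
    rw [← intervalIntegral.integral_const_mul, ← intervalIntegral.integral_const_mul,
      ← intervalIntegral.integral_add i1 i2]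
    exact integral_lt_of_lt_Ioo (hγ'.intervalIntegrable hg hμ) (i1.add i2) fun s hs =>
      integrand_lt_of_between hg hα hβ hμ (hγ.1.trans hγ.2).ne ht e hs
  refine hlt.trans_le ?_
  have h1 := mul_le_mul_of_nonneg_left (le_max_left (timeMap g lam μ α) (timeMap g lam μ β))
    (sub_pos.2 ht.2).le
  have h2 := mul_le_mul_of_nonneg_left (le_max_right (timeMap g lam μ α) (timeMap g lam μ β))
    ht.1.le
  linarith

/-! ### Continuity of the time map -/

theorem continuousWithinAt_timeMap (hg : IsHump g σ) {p₀ : ℝ × ℝ × ℝ}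
    (h₀ : Admissible g σ p₀.1 p₀.2.1 p₀.2.2) (hμ₀ : 0 ≤ p₀.2.1) :
    ContinuousWithinAt (fun p : ℝ × ℝ × ℝ => timeMap g p.1 p.2.1 p.2.2)
      {p | 0 ≤ p.2.1 ∧ Admissible g σ p.1 p.2.1 p.2.2} p₀ := by
  have hc := hg.continuous
  set c := p₀.2.2 * (p₀.1 * g p₀.2.2 - p₀.2.1) with hcdef
  -- Dominated convergence: near `p₀` the constant α f(α) of `Admissible.gap_ge` stays above c/2,
  -- which gives one integrable majorant for all admissible parameters nearby.
  have hc0 : 0 < c := mul_pos h₀.pos (sub_pos.2 h₀.force)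
  have ev1 : ∀ᶠ p : ℝ × ℝ × ℝ in 𝓝 p₀, c / 2 < p.2.2 * (p.1 * g p.2.2 - p.2.1) :=
    ContinuousAt.eventually_lt (f := fun _ => c / 2) continuousAt_const
      (g := fun p : ℝ × ℝ × ℝ => p.2.2 * (p.1 * g p.2.2 - p.2.1))
      (Continuous.continuousAt (by fun_prop)) (by simp only [← hcdef]; linarith)
  unfold timeMap
  apply intervalIntegral.continuousWithinAt_of_dominated_interval
    (bound := fun s => σ + σ / Real.sqrt (2 * (c / 2)) * (1 / Real.sqrt (s * (1 - s))))
  · exact Eventually.of_forall fun p => (measurable_integrand hg _ _ _).aestronglyMeasurable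
  · filter_upwards [self_mem_nhdsWithin, mem_nhdsWithin_of_mem_nhds ev1] with p hp hpc
    filter_upwards [ae_Ioo_of_mem_uIoc] with s hs hmem
    have hs' := hs hmem
    have hss : 0 < s * (1 - s) := mul_pos hs'.1 (sub_pos.2 hs'.2)
    have hw := hp.2.gap_pos hg hp.1 hs'
    rw [Real.norm_of_nonneg (mul_nonneg hp.2.pos.le (slowness_pos hw).le)]
    have := mul_slowness_le_of_ge (α := σ) (c := c / 2) hg.sigma_pos.le (by linarith) hs'
      ((mul_le_mul_of_nonneg_right hpc.le hss.le).trans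
        (hp.2.gap_ge hg hp.1 (Ioo_subset_Icc_self hs')))
    exact (mul_le_mul_of_nonneg_right hp.2.lt.le (slowness_pos hw).le).trans this
  · exact intervalIntegrable_majorant _ _
  · filter_upwards [ae_Ioo_of_mem_uIoc] with s hs hmem
    have hw := h₀.gap_pos hg hμ₀ (hs hmem)
    apply ContinuousAt.continuousWithinAt
    apply ContinuousAt.mul (Continuous.continuousAt (by fun_prop))
    apply ContinuousAt.comp (g := slowness)
      (f := fun p : ℝ × ℝ × ℝ => gap g p.1 p.2.1 p.2.2 s)
    · exact continuousOn_slowness.continuousAt (Ioi_mem_nhds hw)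
    · exact ((continuous_gap hg).comp (f := fun p : ℝ × ℝ × ℝ => (p.1, p.2.1, p.2.2, s))
        (by fun_prop)).continuousAt

/-- Continuity of the time map along a curve of admissible parameters. -/
theorem continuousOn_timeMap_comp (hg : IsHump g σ) {S : Set ℝ} {l m a : ℝ → ℝ}
    (hl : ContinuousOn l S) (hm : ContinuousOn m S) (ha : ContinuousOn a S)
    (h : ∀ x ∈ S, 0 ≤ m x ∧ Admissible g σ (l x) (m x) (a x)) :
    ContinuousOn (fun x => timeMap g (l x) (m x) (a x)) S := by
  intro x hx
  exact (continuousWithinAt_timeMap hg (p₀ := (l x, m x, a x)) (h x hx).2 (h x hx).1).comp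
    (f := fun x => (l x, m x, a x)) ((hl x hx).prodMk ((hm x hx).prodMk (ha x hx))) h

end MinkowskiHarvest

namespace MinkowskiHarvest

variable {g : ℝ → ℝ} {σ : ℝ}

theorem Admissible.mono (hg : IsHump g σ) {lam lam' μ μ' α : ℝ} (h : Admissible g σ lam μ α)
    (hlam : lam ≤ lam') (hμ : μ' ≤ μ) : Admissible g σ lam' μ' α := by
  have h1 := mul_le_mul_of_nonneg_right hlam (hg.potential_pos h.pos h.lt.le).le
  have h2 := mul_le_mul_of_nonneg_right hlam (hg.pos α ⟨h.pos, h.lt⟩).le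
  have h3 := mul_le_mul_of_nonneg_right hμ h.pos.le
  exact ⟨h.pos, h.lt, by linarith [h.energy], by linarith [h.force]⟩

/-! ### Existence of parameters with a prescribed time -/

/-- As `lam` grows, the upper bound of the time tends to α, the time needed at unit speed. -/
theorem exists_timeMap_lt (hg : IsHump g σ) {μ α L : ℝ} (hμ : 0 ≤ μ) (hα : α ∈ Ioo 0 σ)
    (hL : α < L) (lam₀ : ℝ) :
    ∃ lam, lam₀ ≤ lam ∧ Admissible g σ lam μ α ∧ timeMap g lam μ α < L := by
  have hα0 := hα.1
  have hG := hg.potential_pos hα.1 hα.2.le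
  have hgα := hg.pos α hα
  have t1 : Tendsto (fun lam => lam * g α - μ) atTop atTop :=
    tendsto_atTop_add_const_right _ _ (tendsto_id.atTop_mul_const hgα)
  have t2 : Tendsto (fun lam => α + α / Real.sqrt (2 * (α * (lam * g α - μ))) * Real.pi) atTop
      (𝓝 (α + 0 * Real.pi)) := by
    refine tendsto_const_nhds.add (Tendsto.mul_const _ (Tendsto.div_atTop tendsto_const_nhds ?_))
    exact Real.tendsto_sqrt_atTop.comp
      ((t1.const_mul_atTop hα0).const_mul_atTop (by norm_num))
  have t3 : Tendsto (fun lam => lam * potential g α) atTop atTop :=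
    tendsto_id.atTop_mul_const hG
  obtain ⟨lam, h1, h2, h3, h4⟩ := ((eventually_ge_atTop lam₀).and
    ((t1.eventually_gt_atTop 0).and ((t3.eventually_ge_atTop (μ * α)).and
      (t2.eventually_lt_const (by simpa using hL))))).exists
  have adm : Admissible g σ lam μ α := ⟨hα0, hα.2, h3, by linarith⟩
  refine ⟨lam, h1, adm, lt_of_le_of_lt ?_ h4⟩
  exact adm.timeMap_le hg hμ (mul_pos hα0 h2)
    fun s hs => adm.gap_ge hg hμ (Ioo_subset_Icc_self hs)

/-- The hypothesis on the limit of μ says that the force vanishes in the limit. Then δ → 0⁺ in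
`log_le_timeMap` while the prefactor keeps a positive limit. -/
theorem tendsto_timeMap_atTop (hg : IsHump g σ) {ι : Type*} {l : Filter ι} {lam μ α : ι → ℝ}
    {lam₀ α₀ : ℝ} (hlam : Tendsto lam l (𝓝 lam₀)) (hα : Tendsto α l (𝓝 α₀))
    (hμ : Tendsto μ l (𝓝 (lam₀ * g α₀))) (hlam₀ : 0 < lam₀) (hα₀ : α₀ ∈ Ioo 0 σ)
    (hadm : ∀ᶠ i in l, 0 ≤ μ i ∧ Admissible g σ (lam i) (μ i) (α i)) :
    Tendsto (fun i => timeMap g (lam i) (μ i) (α i)) l atTop := by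
  have hgα := hg.pos α₀ hα₀
  have hσα := sub_pos.2 hα₀.2
  have hα0 := hα₀.1
  have hG := hg.potential_pos hg.sigma_pos le_rfl
  have tg : Tendsto (fun i => g (α i)) l (𝓝 (g α₀)) := (hg.continuous.tendsto α₀).comp hα
  set K : ι → ℝ := fun i => lam i * g (α i) / (σ - α i) * α i with hK
  have tK : Tendsto K l (𝓝 (lam₀ * g α₀ / (σ - α₀) * α₀)) :=
    ((hlam.mul tg).div (tendsto_const_nhds.sub hα) hσα.ne').mul hα
  have hK0 : 0 < lam₀ * g α₀ / (σ - α₀) * α₀ := by positivity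
  set δ : ι → ℝ := fun i => (lam i * g (α i) - μ i) / K i with hδ
  have tδ : Tendsto δ l (𝓝[>] 0) := by
    apply tendsto_nhdsWithin_of_tendsto_nhds_of_eventually_within
    · have : Tendsto δ l _ := ((hlam.mul tg).sub hμ).div tK hK0.ne'
      rwa [sub_self, zero_div] at this
    · filter_upwards [hadm, tK.eventually_const_lt hK0] with i hi hKi
      exact div_pos (sub_pos.2 hi.2.force) hKi
  have tlog : Tendsto (fun i => Real.log ((1 + δ i) / δ i)) l atTop := by
    refine Real.tendsto_log_atTop.comp ?_
    have t1 : Tendsto (fun i => (δ i)⁻¹ + 1) l atTop :=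
      tendsto_atTop_add_const_right _ _ (tendsto_inv_nhdsGT_zero.comp tδ)
    refine t1.congr' ?_
    filter_upwards [tδ.eventually self_mem_nhdsWithin] with i hi
    have : δ i ≠ 0 := (show 0 < δ i from hi).ne'
    field_simp
  have tC : Tendsto (fun i => α i / Real.sqrt ((lam i * potential g σ + 2) * (α i * K i))) l
      (𝓝 (α₀ / Real.sqrt ((lam₀ * potential g σ + 2)
        * (α₀ * (lam₀ * g α₀ / (σ - α₀) * α₀))))) := by
    apply hα.div _ (by positivity)
    exact (Real.continuous_sqrt.tendsto _).comp
      (((hlam.mul_const _).add_const 2).mul (hα.mul tK))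
  refine tendsto_atTop_mono' l ?_ (tC.pos_mul_atTop (by positivity) tlog)
  filter_upwards [hadm] with i hi
  exact hi.2.log_le_timeMap hg hi.1 rfl rfl

/-- When g(α) is at most the mean of g, positive force already implies nonnegative energy. So `lam`
may descend to μ / g(α), where the force vanishes and the time blows up. -/
theorem exists_lt_timeMap (hg : IsHump g σ) {μ α : ℝ} (hμ : 0 < μ) (hα : α ∈ Ioo 0 σ)
    (h : α * g α ≤ potential g α) (L : ℝ) :
    ∃ lam, Admissible g σ lam μ α ∧ L < timeMap g lam μ α := by
  have hgα := hg.pos α hα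
  have hG := hg.potential_pos hα.1 hα.2.le
  have ev : ∀ᶠ lam in 𝓝[>] (μ / g α), 0 ≤ μ ∧ Admissible g σ lam μ α := by
    filter_upwards [self_mem_nhdsWithin] with lam hlam
    have h1 : μ < lam * g α := (div_lt_iff₀ hgα).1 hlam
    have h2 : 0 < lam := lt_trans (by positivity) (show μ / g α < lam from hlam)
    refine ⟨hμ.le, hα.1, hα.2, ?_, h1⟩
    calc μ * α ≤ lam * g α * α := mul_le_mul_of_nonneg_right h1.le hα.1.le
      _ = lam * (α * g α) := by ring
      _ ≤ _ := mul_le_mul_of_nonneg_left h h2.le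
  have t := tendsto_timeMap_atTop hg (l := 𝓝[>] (μ / g α)) (lam := id) (μ := fun _ => μ)
    (α := fun _ => α) (lam₀ := μ / g α) (α₀ := α) (tendsto_id.mono_left nhdsWithin_le_nhds)
    tendsto_const_nhds (by rw [div_mul_cancel₀ _ hgα.ne']; exact tendsto_const_nhds)
    (by positivity) hα ev
  obtain ⟨lam, h1, h2⟩ := (ev.and (t.eventually_gt_atTop L)).exists
  exact ⟨lam, h1.2, h2⟩

theorem exists_timeMap_eq (hg : IsHump g σ) {lam₁ μ α L : ℝ} (hμ : 0 ≤ μ)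
    (h : Admissible g σ lam₁ μ α) (h1 : L ≤ timeMap g lam₁ μ α) (hL : α < L) :
    ∃ lam, lam₁ ≤ lam ∧ Admissible g σ lam μ α ∧ timeMap g lam μ α = L := by
  obtain ⟨lam₂, h12, h2, h3⟩ := exists_timeMap_lt hg hμ ⟨h.pos, h.lt⟩ hL lam₁
  have hcont : ContinuousOn (fun lam => timeMap g lam μ α) (Icc lam₁ lam₂) :=
    continuousOn_timeMap_comp hg (l := fun x => x) (m := fun _ => μ) (a := fun _ => α)
      continuousOn_id continuousOn_const continuousOn_const
      fun x hx => ⟨hμ, h.mono hg hx.1 le_rfl⟩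
  obtain ⟨lam, hlam, e⟩ := intermediate_value_Icc' h12 hcont ⟨h3.le, h1⟩
  exact ⟨lam, hlam.1, h.mono hg hlam.1 le_rfl, e⟩

/-! ### The starting point of the bifurcation curve -/

/-- At the starting point of the curve the energy `F(α)` vanishes. -/
theorem admissible_start {lam α : ℝ} (hlam : 0 < lam) (hα : α ∈ Ioo 0 σ)
    (h : potential g α < α * g α) : Admissible g σ lam (lam * (potential g α / α)) α := by
  have hα0 := hα.1
  refine ⟨hα.1, hα.2, le_of_eq (by field_simp), mul_lt_mul_of_pos_left ?_ hlam⟩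
  rwa [div_lt_iff₀ hα0, mul_comm]

theorem start_gap {lam α s : ℝ} (hα : 0 < α) :
    gap g lam (lam * (potential g α / α)) α s
      = α ^ 2 * (lam * ((s * potential g α - potential g (α * s)) / α ^ 2)) := by
  unfold gap
  field_simp
  ring

/-- At zero energy the gap is α² x, where x is `lam` times the quotient of `start_gap_div_sq_anti`.
Both a larger amplitude and a smaller `lam` lower x, and `mul_slowness_scaled_lt` compares the
densities. -/
theorem start_timeMap_lt (hg : IsHump g σ) {lam lam' α β : ℝ} (hlam : lam' ≤ lam)
    (hlam' : 0 < lam') (hα : 0 < α) (hαβ : α < β) (hβ : β < σ)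
    (hE : potential g β < β * g β) :
    timeMap g lam (lam * (potential g α / α)) α
      < timeMap g lam' (lam' * (potential g β / β)) β := by
  have hb : 0 < β := hα.trans hαβ
  have hEα := hg.potential_lt_mul_of_lt hβ.le hE.le ⟨hα, hαβ⟩
  have hl := hlam'.trans_le hlam
  have pα := (div_pos (hg.potential_pos hα (hαβ.trans hβ).le) hα).le
  have pβ := (div_pos (hg.potential_pos hb hβ.le) hb).le
  apply integral_lt_of_lt_Ioo
    ((admissible_start hl ⟨hα, hαβ.trans hβ⟩ hEα).intervalIntegrable hg (by positivity))
    ((admissible_start hlam' ⟨hb, hβ⟩ hE).intervalIntegrable hg (by positivity))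
  intro s hs
  rw [start_gap hα, start_gap hb]
  have hz := sub_pos.2 (hg.potential_scaled_lt hb hβ.le hE hs)
  have hanti := hg.start_gap_div_sq_anti hα hαβ.le hβ.le hs
  have hz' : 0 < (s * potential g β - potential g (β * s)) / β ^ 2 := by positivity
  exact mul_slowness_scaled_lt hα hαβ (mul_pos hlam' hz')
    (mul_le_mul hlam hanti hz'.le hl.le)

theorem start_timeMap_le (hg : IsHump g σ) {lam α β : ℝ} (hlam : 0 < lam) (hα : 0 < α)
    (hαβ : α ≤ β) (hβ : β < σ) (hE : potential g β < β * g β) :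
    timeMap g lam (lam * (potential g α / α)) α
      ≤ α + Real.pi / Real.sqrt (2 * (lam * ((β * g β - potential g β) / β ^ 2))) := by
  have hb : 0 < β := hα.trans_le hαβ
  have hk : 0 < (β * g β - potential g β) / β ^ 2 := div_pos (sub_pos.2 hE) (by positivity)
  have hEα : potential g α < α * g α := by
    rcases hαβ.eq_or_lt with rfl | h
    · exact hE
    · exact hg.potential_lt_mul_of_lt hβ.le hE.le ⟨hα, h⟩
  have pα := (div_pos (hg.potential_pos hα (hαβ.trans_lt hβ).le) hα).le
  have := (admissible_start hlam ⟨hα, hαβ.trans_lt hβ⟩ hEα).timeMap_le hg (by positivity)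
    (c := α ^ 2 * (lam * ((β * g β - potential g β) / β ^ 2))) (by positivity) ?_
  · refine this.trans_eq ?_
    rw [show 2 * (α ^ 2 * (lam * ((β * g β - potential g β) / β ^ 2)))
      = α ^ 2 * (2 * (lam * ((β * g β - potential g β) / β ^ 2))) by ring,
      Real.sqrt_mul (by positivity), Real.sqrt_sq hα.le]
    field_simp
  · intro s hs
    rw [start_gap hα, mul_assoc, mul_assoc]
    refine mul_le_mul_of_nonneg_left (mul_le_mul_of_nonneg_left ?_ hlam.le) (by positivity)
    refine le_trans ?_ (hg.start_gap_div_sq_anti hα hαβ hβ.le hs)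
    rw [div_mul_eq_mul_div]
    refine div_le_div_of_nonneg_right ?_ (by positivity)
    have := hg.potential_sub_scaled_ge hb.le hβ.le (Ioo_subset_Icc_self hs)
    nlinarith

theorem tendsto_potential_div (hg : IsHump g σ) :
    Tendsto (fun α => potential g α / α) (𝓝[>] 0) (𝓝[>] 0) := by
  apply tendsto_nhdsWithin_of_tendsto_nhds_of_eventually_within
  · have := (hg.hasDerivAt_potential 0).tendsto_slope_zero_right
    rw [hg.map_zero] at this
    refine this.congr fun α => ?_
    simp only [zero_add, potential_zero, sub_zero, smul_eq_mul]
    rw [inv_mul_eq_div]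
  · filter_upwards [self_mem_nhdsWithin, mem_nhdsWithin_of_mem_nhds (Iio_mem_nhds hg.sigma_pos)]
      with α h0 h1
    exact div_pos (hg.potential_pos h0 (le_of_lt h1)) h0

/-- Zero energy with μ fixed means `lam` = μα / G(α). As α → 0 this `lam` tends to infinity and the
time to 0; as α → ω the force tends to 0 and the time to infinity. The intermediate value theorem
gives θ. -/
theorem exists_start (hg : IsHump g σ) {μ L : ℝ} (hμ : 0 < μ) (hL : 0 < L) :
    ∃ θ lam, θ ∈ Ioo 0 σ ∧ potential g θ < θ * g θ ∧ 0 < lam ∧ μ = lam * (potential g θ / θ) ∧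
      timeMap g lam μ θ = L := by
  obtain ⟨ω, hω, hωe, hiff⟩ := hg.exists_potential_eq_mul
  have hp : ∀ α ∈ Ioc 0 ω, 0 < potential g α / α := fun α hα =>
    div_pos (hg.potential_pos hα.1 (hα.2.trans hω.2.le)) hα.1
  have hG := hg.continuous_potential
  have hlc : ContinuousOn (fun α => μ / (potential g α / α)) (Ioc 0 ω) := by
    apply ContinuousOn.div continuousOn_const _ fun α hα => (hp α hα).ne'
    exact hG.continuousOn.div continuousOn_id fun α hα => hα.1.ne'
  have hE : ∀ α ∈ Ioo 0 ω, potential g α < α * g α := fun α hα =>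
    (hiff α ⟨hα.1, hα.2.trans hω.2⟩).2 hα.2
  have hμe : ∀ α ∈ Ioo 0 ω, μ = μ / (potential g α / α) * (potential g α / α) := fun α hα =>
    (div_mul_cancel₀ _ (hp α (Ioo_subset_Ioc_self hα)).ne').symm
  have hadm : ∀ α ∈ Ioo 0 ω, 0 ≤ μ ∧ Admissible g σ (μ / (potential g α / α)) μ α := by
    intro α hα
    refine ⟨hμ.le, ?_⟩
    have := admissible_start (div_pos hμ (hp α (Ioo_subset_Ioc_self hα)))
      ⟨hα.1, hα.2.trans hω.2⟩ (hE α hα)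
    rwa [← hμe α hα] at this
  have hcont : ContinuousOn (fun α => timeMap g (μ / (potential g α / α)) μ α) (Ioo 0 ω) :=
    continuousOn_timeMap_comp hg (hlc.mono Ioo_subset_Ioc_self) continuousOn_const
      continuousOn_id hadm
  obtain ⟨a, ha, hLa⟩ : ∃ a ∈ Ioo 0 ω, timeMap g (μ / (potential g a / a)) μ a ≤ L := by
    have hβ : ω / 2 ∈ Ioo 0 ω := ⟨by linarith [hω.1], by linarith [hω.1]⟩
    set k := (ω / 2 * g (ω / 2) - potential g (ω / 2)) / (ω / 2) ^ 2
    have hk : 0 < k := div_pos (sub_pos.2 (hE _ hβ)) (pow_pos hβ.1 2)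
    have tl : Tendsto (fun α => μ / (potential g α / α)) (𝓝[>] 0) atTop := by
      simp only [div_eq_mul_inv μ]
      exact (tendsto_inv_nhdsGT_zero.comp (tendsto_potential_div hg)).const_mul_atTop hμ
    have t : Tendsto (fun α => α + Real.pi / Real.sqrt (2 * (μ / (potential g α / α) * k)))
        (𝓝[>] 0) (𝓝 (0 + 0)) := by
      refine (tendsto_id.mono_left nhdsWithin_le_nhds).add
        (Tendsto.div_atTop tendsto_const_nhds ?_)
      exact Real.tendsto_sqrt_atTop.comp ((tl.atTop_mul_const hk).const_mul_atTop (by norm_num))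
    rw [add_zero] at t
    obtain ⟨a, h1, h2, h3⟩ := ((t.eventually_lt_const hL).and
      ((eventually_mem_nhdsWithin (s := Ioi (0 : ℝ))).and
        (mem_nhdsWithin_of_mem_nhds (Iio_mem_nhds hβ.1)))).exists
    have ha : a ∈ Ioo 0 ω := ⟨h2, lt_trans h3 hβ.2⟩
    refine ⟨a, ha, ?_⟩
    have := start_timeMap_le hg (div_pos hμ (hp a (Ioo_subset_Ioc_self ha))) ha.1
      (le_of_lt h3) (hβ.2.trans hω.2) (hE _ hβ)
    rw [← hμe a ha] at this
    exact this.trans h1.le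
  obtain ⟨b, hb, hLb⟩ : ∃ b ∈ Ioo 0 ω, L ≤ timeMap g (μ / (potential g b / b)) μ b := by
    have hω' : ω ∈ Ioc 0 ω := right_mem_Ioc.2 hω.1
    have hlt : 𝓝[<] ω ≤ 𝓝[Ioc 0 ω] ω := by
      apply nhdsWithin_le_of_mem
      filter_upwards [self_mem_nhdsWithin, mem_nhdsWithin_of_mem_nhds (Ioi_mem_nhds hω.1)]
        with x h1 h2
      exact ⟨h2, le_of_lt h1⟩
    have hgω : g ω = potential g ω / ω := by
      rw [hωe, mul_div_cancel_left₀ _ hω.1.ne']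
    have ev : ∀ᶠ α in 𝓝[<] ω, α ∈ Ioo 0 ω := by
      filter_upwards [self_mem_nhdsWithin, mem_nhdsWithin_of_mem_nhds (Ioi_mem_nhds hω.1)]
        with x h1 h2
      exact ⟨h2, h1⟩
    have t := tendsto_timeMap_atTop hg (l := 𝓝[<] ω) (μ := fun _ => μ) (α := id)
      ((hlc ω hω').mono_left hlt) (tendsto_id.mono_left nhdsWithin_le_nhds)
      (by rw [hgω, div_mul_cancel₀ _ (hp ω hω').ne']; exact tendsto_const_nhds)
      (div_pos hμ (hp ω hω')) hω (ev.mono hadm)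
    obtain ⟨b, h1, h2⟩ := (ev.and (t.eventually_ge_atTop L)).exists
    exact ⟨b, h1, h2⟩
  obtain ⟨θ, hθ, e⟩ := isPreconnected_Ioo.intermediate_value ha hb hcont ⟨hLa, hLb⟩
  exact ⟨θ, _, ⟨hθ.1, hθ.2.trans hω.2⟩, hE θ hθ, div_pos hμ (hp θ (Ioo_subset_Ioc_self hθ)),
    hμe θ hθ, e⟩

end MinkowskiHarvest

namespace MinkowskiHarvest

variable {g : ℝ → ℝ} {σ : ℝ}

/-! ### The solution curve for fixed `μ` -/

/-- `(lam, θ)` is the starting point of the curve: `F(θ) = 0` and the time is `L`. -/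
structure IsStart (g : ℝ → ℝ) (σ L μ lam θ : ℝ) : Prop where
  mem : θ ∈ Ioo 0 σ
  mean_lt : potential g θ < θ * g θ
  lam_pos : 0 < lam
  mu_eq : μ = lam * (potential g θ / θ)
  time : timeMap g lam μ θ = L

/-- The pairs `(lam, α)` of an admissible amplitude and a parameter for which the time is `L`. -/
def timeCurve (g : ℝ → ℝ) (σ L μ : ℝ) : Set (ℝ × ℝ) :=
  {p | Admissible g σ p.1 μ p.2 ∧ timeMap g p.1 μ p.2 = L}

theorem lt_of_timeMap_lt (hg : IsHump g σ) {L μ lam lam' α : ℝ} (hμ : 0 ≤ μ)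
    (h : (lam, α) ∈ timeCurve g σ L μ) (h' : Admissible g σ lam' μ α)
    (hlt : timeMap g lam' μ α < L) : lam < lam' := by
  by_contra! hle
  rcases hle.eq_or_lt with rfl | hle
  · exact hlt.ne h.2
  · have := timeMap_lt_of_lam_lt hg h.1 h' hμ hle
    rw [h.2] at this
    exact this.not_gt hlt

theorem lt_of_lt_timeMap (hg : IsHump g σ) {L μ lam lam' α : ℝ} (hμ : 0 ≤ μ)
    (h : (lam, α) ∈ timeCurve g σ L μ) (h' : Admissible g σ lam' μ α)
    (hlt : L < timeMap g lam' μ α) : lam' < lam := by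
  by_contra! hle
  rcases hle.eq_or_lt with rfl | hle
  · exact hlt.ne h.2.symm
  · have := timeMap_lt_of_lam_lt hg h' h.1 hμ hle
    rw [h.2] at this
    exact this.not_gt hlt

theorem timeMap_le_of_le (hg : IsHump g σ) {L μ lam lam' α : ℝ} (hμ : 0 ≤ μ)
    (h : (lam, α) ∈ timeCurve g σ L μ) (hle : lam ≤ lam') :
    Admissible g σ lam' μ α ∧ timeMap g lam' μ α ≤ L := by
  have h' := h.1.mono hg hle le_rfl
  refine ⟨h', ?_⟩
  by_contra! hlt
  exact (lt_of_lt_timeMap hg hμ h h' hlt).not_ge hle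

theorem timeCurve_unique (hg : IsHump g σ) {L μ lam lam' α : ℝ} (hμ : 0 ≤ μ)
    (h : (lam, α) ∈ timeCurve g σ L μ) (h' : (lam', α) ∈ timeCurve g σ L μ) : lam = lam' := by
  by_contra hne
  rcases lt_or_gt_of_ne hne with hlt | hlt
  · have := timeMap_lt_of_lam_lt hg h'.1 h.1 hμ hlt
    exact this.ne (h'.2.trans h.2.symm)
  · have := timeMap_lt_of_lam_lt hg h.1 h'.1 hμ hlt
    exact this.ne (h.2.trans h'.2.symm)

/-! ### Range of amplitudes on the curve -/

namespace IsStart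

variable {L μ lam₀ θ : ℝ}

theorem admissible (h : IsStart g σ L μ lam₀ θ) : Admissible g σ lam₀ μ θ := by
  have := admissible_start h.lam_pos h.mem h.mean_lt
  rwa [← h.mu_eq] at this

theorem mem_timeCurve (h : IsStart g σ L μ lam₀ θ) : (lam₀, θ) ∈ timeCurve g σ L μ :=
  ⟨h.admissible, h.time⟩

theorem mu_pos (hg : IsHump g σ) (h : IsStart g σ L μ lam₀ θ) : 0 < μ := by
  rw [h.mu_eq]
  exact mul_pos h.lam_pos (div_pos (hg.potential_pos h.mem.1 h.mem.2.le) h.mem.1)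

theorem energy_eq (h : IsStart g σ L μ lam₀ θ) : lam₀ * potential g θ = μ * θ := by
  have := h.mem.1
  rw [h.mu_eq]
  field_simp

theorem lt_length (hg : IsHump g σ) (h : IsStart g σ L μ lam₀ θ) : θ < L := by
  have := h.admissible.lt_timeMap hg (h.mu_pos hg).le
  rwa [h.time] at this

/-- At zero energy, the time is less than `L` for amplitudes below the starting one. -/
theorem timeMap_lt (hg : IsHump g σ) (h : IsStart g σ L μ lam₀ θ) {lam α : ℝ}
    (hα : 0 < α) (hlt : α < θ) (he : μ = lam * (potential g α / α)) :
    timeMap g lam μ α < L := by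
  have hp := div_pos (hg.potential_pos hα (hlt.trans h.mem.2).le) hα
  have hle : potential g α / α ≤ potential g θ / θ := by
    have := hg.potential_scaled_le (s := α / θ) h.mem.1 h.mem.2.le h.mean_lt.le
      ⟨by have := h.mem.1; positivity, (div_le_one h.mem.1).2 hlt.le⟩
    rw [mul_div_cancel₀ _ h.mem.1.ne'] at this
    rw [div_le_iff₀ hα]
    refine this.trans_eq (by ring)
  have hll : lam₀ ≤ lam := by
    by_contra! hc
    have h1 := mul_lt_mul_of_pos_right hc hp
    have h2 := mul_le_mul_of_nonneg_left hle h.lam_pos.le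
    rw [← he] at h1
    rw [← h.mu_eq] at h2
    linarith
  have := start_timeMap_lt hg hll h.lam_pos hα hlt h.mem.2 h.mean_lt
  rwa [← he, ← h.mu_eq, h.time] at this

/-- At zero energy, the time is greater than `L` for amplitudes above the starting one. -/
theorem lt_timeMap (hg : IsHump g σ) (h : IsStart g σ L μ lam₀ θ) {lam α : ℝ}
    (hα : α < σ) (hlt : θ < α) (hE : potential g α < α * g α) (hlam : 0 < lam)
    (he : μ = lam * (potential g α / α)) : L < timeMap g lam μ α := by
  have hα0 := h.mem.1.trans hlt
  have hp := div_pos (hg.potential_pos h.mem.1 h.mem.2.le) h.mem.1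
  have hle : potential g θ / θ ≤ potential g α / α := by
    have := hg.potential_scaled_le (s := θ / α) hα0 hα.le hE.le
      ⟨by have := h.mem.1; positivity, (div_le_one hα0).2 hlt.le⟩
    rw [mul_div_cancel₀ _ hα0.ne'] at this
    rw [div_le_iff₀ h.mem.1]
    refine this.trans_eq (by ring)
  have hll : lam ≤ lam₀ := by
    by_contra! hc
    have h1 := mul_lt_mul_of_pos_right hc hp
    have h2 := mul_le_mul_of_nonneg_left hle hlam.le
    rw [← he] at h2
    rw [← h.mu_eq] at h1
    linarith
  have := start_timeMap_lt hg hll hlam h.mem.1 hlt hα hE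
  rwa [← he, ← h.mu_eq, h.time] at this

/-- Below θ the zero-energy parameter already gives a time less than L. Reaching L would need a
smaller `lam`, hence negative energy. -/
theorem le_of_mem (hg : IsHump g σ) (h : IsStart g σ L μ lam₀ θ) {lam α : ℝ}
    (hc : (lam, α) ∈ timeCurve g σ L μ) : θ ≤ α := by
  by_contra! hlt
  have hμ := h.mu_pos hg
  have hα := hc.1.pos
  have hp := div_pos (hg.potential_pos hα hc.1.lt.le) hα
  have hE := hg.potential_lt_mul_of_lt h.mem.2.le h.mean_lt.le ⟨hα, hlt⟩
  have hl : 0 < μ / (potential g α / α) := div_pos hμ hp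
  have he : μ = μ / (potential g α / α) * (potential g α / α) := (div_mul_cancel₀ _ hp.ne').symm
  have hadm := admissible_start hl ⟨hα, hc.1.lt⟩ hE
  rw [← he] at hadm
  have h1 := lt_of_timeMap_lt hg hμ.le hc hadm (h.timeMap_lt hg hα hlt he)
  have h2 := hc.1.energy
  have h3 := mul_lt_mul_of_pos_right h1 (hg.potential_pos hα hc.1.lt.le)
  have h4 : μ / (potential g α / α) * potential g α = μ * α := by
    have := hg.potential_pos hα hc.1.lt.le
    field_simp
  simp only at h2
  linarith

theorem lt_of_mem (hg : IsHump g σ) (hμ : 0 ≤ μ) {lam α : ℝ}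
    (hc : (lam, α) ∈ timeCurve g σ L μ) : α < min σ L := by
  have := hc.1.lt_timeMap hg hμ
  rw [hc.2] at this
  exact lt_min hc.1.lt this

/-- Zero energy at an amplitude above θ would make the time exceed L. -/
theorem energy_lt (hg : IsHump g σ) (h : IsStart g σ L μ lam₀ θ) {lam α : ℝ}
    (hc : (lam, α) ∈ timeCurve g σ L μ) (hlt : θ < α) : μ * α < lam * potential g α := by
  refine hc.1.energy.lt_of_ne fun he => ?_
  simp only at he
  have hα := hc.1.pos
  have hμ := h.mu_pos hg
  have hlam := hc.1.lam_pos hg hμ.le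
  have hE : potential g α < α * g α := by
    have := mul_lt_mul_of_pos_right hc.1.force hα
    simp only at this
    rw [he] at this
    nlinarith
  have := h.lt_timeMap hg hc.1.lt hlt hE hlam (by simp only; field_simp; linarith)
  exact this.ne hc.2.symm

/-- A time above L occurs at zero energy if g(α) exceeds its mean, and otherwise near vanishing
force. Increasing `lam` brings the time down to L, since α < L. -/
theorem exists_mem (hg : IsHump g σ) (h : IsStart g σ L μ lam₀ θ) {α : ℝ}
    (hα : α ∈ Ico θ (min σ L)) : ∃ lam, (lam, α) ∈ timeCurve g σ L μ := by
  rcases hα.1.eq_or_lt with rfl | hlt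
  · exact ⟨lam₀, h.mem_timeCurve⟩
  have hμ := h.mu_pos hg
  have hα0 := h.mem.1.trans hlt
  have hασ := hα.2.trans_le (min_le_left _ _)
  have hαL := hα.2.trans_le (min_le_right _ _)
  have hp := div_pos (hg.potential_pos hα0 hασ.le) hα0
  have : ∃ lam₁, Admissible g σ lam₁ μ α ∧ L < timeMap g lam₁ μ α := by
    rcases lt_or_ge (potential g α) (α * g α) with hE | hE
    · have he : μ = μ / (potential g α / α) * (potential g α / α) :=
        (div_mul_cancel₀ _ hp.ne').symm
      have hl : 0 < μ / (potential g α / α) := div_pos hμ hp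
      have hadm := admissible_start hl ⟨hα0, hασ⟩ hE
      rw [← he] at hadm
      exact ⟨_, hadm, h.lt_timeMap hg hασ hlt hE hl he⟩
    · exact exists_lt_timeMap hg hμ ⟨hα0, hασ⟩ hE L
  obtain ⟨lam₁, h1, h2⟩ := this
  obtain ⟨lam, -, h3, h4⟩ := exists_timeMap_eq hg hμ.le h1 h2.le hαL
  exact ⟨lam, h3, h4⟩

end IsStart

theorem tendsto_timeMap_of_strict (hg : IsHump g σ) {lam μ α₀ : ℝ} (hμ : 0 ≤ μ)
    (h : Admissible g σ lam μ α₀) (hs : μ * α₀ < lam * potential g α₀) :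
    (∀ᶠ α in 𝓝 α₀, Admissible g σ lam μ α) ∧
      Tendsto (fun α => timeMap g lam μ α) (𝓝 α₀) (𝓝 (timeMap g lam μ α₀)) := by
  have hc := hg.continuous
  have hG := hg.continuous_potential
  have ev : ∀ᶠ α in 𝓝 α₀, Admissible g σ lam μ α := by
    have e1 := ContinuousAt.eventually_lt (f := fun α => μ * α)
      (g := fun α => lam * potential g α) (x₀ := α₀) (Continuous.continuousAt (by fun_prop))
      (Continuous.continuousAt (by fun_prop)) hs
    have e2 := ContinuousAt.eventually_lt (f := fun _ => μ)
      (g := fun α => lam * g α) (x₀ := α₀) (Continuous.continuousAt (by fun_prop))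
      (Continuous.continuousAt (by fun_prop)) h.force
    filter_upwards [e1, e2, Ioo_mem_nhds h.pos h.lt] with α h1 h2 h3
    exact ⟨h3.1, h3.2, h1.le, h2⟩
  refine ⟨ev, ?_⟩
  have := continuousOn_timeMap_comp hg (S := {α | Admissible g σ lam μ α}) (l := fun _ => lam)
    (m := fun _ => μ) (a := fun x => x) continuousOn_const continuousOn_const continuousOn_id
    fun x hx => ⟨hμ, hx⟩
  exact this.continuousAt ev

/-! ### Continuity, quasiconvexity and blow-up of the graph function -/

namespace IsStart

variable {L μ lam₀ θ : ℝ} {Λ : ℝ → ℝ}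

/-- A fixed parameter slightly below or above Λ(α₀) gives a time strictly above or below L, and this
persists for nearby amplitudes. At θ a smaller parameter would be inadmissible; there the bound Λ(α)
≥ μα / G(α), an equality at θ, controls Λ from below. -/
theorem continuousOn (hg : IsHump g σ) (h : IsStart g σ L μ lam₀ θ)
    (hΛ : ∀ α ∈ Ico θ (min σ L), (Λ α, α) ∈ timeCurve g σ L μ) :
    ContinuousOn Λ (Ico θ (min σ L)) := by
  have hμ := h.mu_pos hg
  have hc := hg.continuous
  have hG := hg.continuous_potential
  intro α₀ hα₀
  have h₀ := hΛ α₀ hα₀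
  have hG₀ := hg.potential_pos h₀.1.pos h₀.1.lt.le
  rw [ContinuousWithinAt, tendsto_order]
  constructor
  · intro lam hlam
    rcases hα₀.1.eq_or_lt with rfl | hlt
    · have e0 : Λ θ = μ * θ / potential g θ := by
        rw [timeCurve_unique hg hμ.le h₀ h.mem_timeCurve, ← h.energy_eq,
          mul_div_cancel_right₀ _ hG₀.ne']
      rw [e0] at hlam
      have ev : ∀ᶠ α in 𝓝 θ, lam < μ * α / potential g α :=
        ContinuousAt.eventually_lt (f := fun _ => lam)
          (g := fun α => μ * α / potential g α) continuousAt_const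
          (ContinuousAt.div (Continuous.continuousAt (by fun_prop)) hG.continuousAt hG₀.ne') hlam
      filter_upwards [mem_nhdsWithin_of_mem_nhds ev, self_mem_nhdsWithin] with α h1 hα
      have h2 := hΛ α hα
      exact h1.trans_le ((div_le_iff₀ (hg.potential_pos h2.1.pos h2.1.lt.le)).2 h2.1.energy)
    · have hs := h.energy_lt hg h₀ hlt
      obtain ⟨lam', hl1, hl2, hl3⟩ : ∃ lam', lam' ∈ Ioo lam (Λ α₀) ∧
          μ * α₀ < lam' * potential g α₀ ∧ μ < lam' * g α₀ := by
        have e1 := ContinuousAt.eventually_lt (f := fun _ : ℝ => μ * α₀)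
          (g := fun x => x * potential g α₀) (x₀ := Λ α₀) (Continuous.continuousAt (by fun_prop))
          (Continuous.continuousAt (by fun_prop)) hs
        have e2 := ContinuousAt.eventually_lt (f := fun _ : ℝ => μ)
          (g := fun x => x * g α₀) (x₀ := Λ α₀) (Continuous.continuousAt (by fun_prop))
          (Continuous.continuousAt (by fun_prop)) h₀.1.force
        have e3 : ∀ᶠ x in 𝓝[<] (Λ α₀), x ∈ Ioo lam (Λ α₀) := Ioo_mem_nhdsLT hlam
        exact (e3.and ((e1.and e2).filter_mono nhdsWithin_le_nhds)).exists
      have hadm : Admissible g σ lam' μ α₀ := ⟨h₀.1.pos, h₀.1.lt, hl2.le, hl3⟩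
      have hT : L < timeMap g lam' μ α₀ := by
        have := timeMap_lt_of_lam_lt hg h₀.1 hadm hμ.le hl1.2
        rwa [h₀.2] at this
      obtain ⟨ev1, ev2⟩ := tendsto_timeMap_of_strict hg hμ.le hadm hl2
      filter_upwards [mem_nhdsWithin_of_mem_nhds ev1,
        mem_nhdsWithin_of_mem_nhds (ev2.eventually_const_lt hT), self_mem_nhdsWithin]
        with α h1 h2 hα
      exact hl1.1.trans (lt_of_lt_timeMap hg hμ.le (hΛ α hα) h1 h2)
  · intro lam hlam
    have hadm := h₀.1.mono hg hlam.le le_rfl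
    have hs : μ * α₀ < lam * potential g α₀ :=
      h₀.1.energy.trans_lt (mul_lt_mul_of_pos_right hlam hG₀)
    have hT := timeMap_lt_of_lam_lt hg hadm h₀.1 hμ.le hlam
    simp only [h₀.2] at hT
    obtain ⟨ev1, ev2⟩ := tendsto_timeMap_of_strict hg hμ.le hadm hs
    filter_upwards [mem_nhdsWithin_of_mem_nhds ev1,
      mem_nhdsWithin_of_mem_nhds (ev2.eventually_lt_const hT), self_mem_nhdsWithin]
      with α h1 h2 hα
    exact lt_of_timeMap_lt hg hμ.le (hΛ α hα) h1 h2

/-- At the larger of the two parameters both outer times are at most L. The time at γ is then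
strictly less, so Λ(γ) is smaller than that parameter. -/
theorem lt_max (hg : IsHump g σ) (hμ : 0 ≤ μ)
    (hΛ : ∀ α ∈ Ico θ (min σ L), (Λ α, α) ∈ timeCurve g σ L μ) {α β γ : ℝ}
    (hα : α ∈ Ico θ (min σ L)) (hβ : β ∈ Ico θ (min σ L)) (hγ : γ ∈ Ioo α β) :
    Λ γ < max (Λ α) (Λ β) := by
  obtain ⟨a1, a2⟩ := timeMap_le_of_le hg hμ (hΛ α hα) (le_max_left _ (Λ β))
  obtain ⟨b1, b2⟩ := timeMap_le_of_le hg hμ (hΛ β hβ) (le_max_right (Λ α) _)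
  exact lt_of_timeMap_lt hg hμ (hΛ γ ⟨hα.1.trans hγ.1.le, hγ.2.trans hβ.2⟩)
    (a1.between hg b1 hμ (Ioo_subset_Icc_self hγ))
    ((timeMap_lt_max hg a1 b1 hμ hγ).trans_le (max_le a2 b2))

/-- A bounded `lam` bounds the gap, so the speed stays below a constant less than 1, which excludes
amplitudes near L. Near σ the force fails because g(σ) = 0. Whichever of L and σ is smaller decides
the case. -/
theorem blowup (hg : IsHump g σ) (h : IsStart g σ L μ lam₀ θ)
    (hΛ : ∀ α ∈ Ico θ (min σ L), (Λ α, α) ∈ timeCurve g σ L μ) (M : ℝ) :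
    ∃ a < min σ L, ∀ α ∈ Ico θ (min σ L), a < α → M < Λ α := by
  have hμ := h.mu_pos hg
  have hL : 0 < L := h.mem.1.trans (h.lt_length hg)
  set N := max M 1 with hN
  have hN0 : 0 < N := zero_lt_one.trans_le (le_max_right _ _)
  have key : ∀ α ∈ Ico θ (min σ L), Λ α ≤ M →
      α * slowness (N * potential g σ) ≤ L ∧ μ < N * g α := by
    intro α hα hle
    obtain ⟨h1, h2⟩ := timeMap_le_of_le hg hμ.le (hΛ α hα) (hle.trans (le_max_left _ 1))
    exact ⟨(h1.mul_slowness_le_timeMap hg hμ.le).trans h2, h1.force⟩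
  rcases le_or_gt L σ with hLσ | hLσ
  · have hsl := one_lt_slowness (mul_pos hN0 (hg.potential_pos hg.sigma_pos le_rfl))
    refine ⟨L / slowness (N * potential g σ), ?_, fun α hα hlt => ?_⟩
    · rw [min_eq_right hLσ]
      exact div_lt_self hL hsl
    · by_contra! hle
      have := (key α hα hle).1
      rw [← le_div_iff₀ (zero_lt_one.trans hsl)] at this
      exact this.not_gt hlt
  · rw [min_eq_left hLσ.le] at *
    have ev : ∀ᶠ α in 𝓝[<] σ, N * g α < μ := by
      apply mem_nhdsWithin_of_mem_nhds
      have hc := hg.continuous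
      refine ContinuousAt.eventually_lt (f := fun α => N * g α) (g := fun _ => μ)
        (Continuous.continuousAt (by fun_prop)) continuousAt_const ?_
      simpa [hg.map_sigma] using hμ
    obtain ⟨a, ha, hsub⟩ := (mem_nhdsLT_iff_exists_Ioo_subset).1 ev
    refine ⟨a, ha, fun α hα hlt => ?_⟩
    by_contra! hle
    have h1 := (key α hα hle).2
    have h2 : N * g α < μ := hsub ⟨hlt, hα.2⟩
    exact h1.not_gt h2

end IsStart

end MinkowskiHarvest

namespace MinkowskiHarvest

variable {g : ℝ → ℝ} {σ : ℝ}

/-! ### The curve moves to the left from its starting point -/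

theorem integral_le_of_gain {f p q : ℝ → ℝ} {k r : ℝ} (hr : r ∈ Ioo (0 : ℝ) 1)
    (hf : IntervalIntegrable f MeasureTheory.volume 0 1)
    (hp : IntervalIntegrable p MeasureTheory.volume 0 1)
    (hq : IntervalIntegrable q MeasureTheory.volume 0 1)
    (hq0 : ∀ s ∈ Ioo (0 : ℝ) 1, 0 ≤ q s) (h1 : ∀ s ∈ Ioo (0 : ℝ) r, f s ≤ p s - k)
    (h2 : ∀ s ∈ Ioo (0 : ℝ) 1, f s ≤ p s + q s) :
    ∫ s in (0 : ℝ)..1, f s ≤ (∫ s in (0 : ℝ)..1, p s) - k * r + ∫ s in (0 : ℝ)..1, q s := by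
  have hd := (hf.sub hp).sub hq
  have s1 : uIcc (0 : ℝ) r ⊆ uIcc 0 1 := by
    rw [uIcc_of_le hr.1.le, uIcc_of_le zero_le_one]; exact Icc_subset_Icc_right hr.2.le
  have s2 : uIcc r 1 ⊆ uIcc (0 : ℝ) 1 := by
    rw [uIcc_of_le hr.2.le, uIcc_of_le zero_le_one]; exact Icc_subset_Icc_left hr.1.le
  have e : ∫ s in (0 : ℝ)..1, (f s - p s - q s)
      = (∫ s in (0 : ℝ)..1, f s) - (∫ s in (0 : ℝ)..1, p s) - ∫ s in (0 : ℝ)..1, q s := by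
    rw [intervalIntegral.integral_sub (hf.sub hp) hq, intervalIntegral.integral_sub hf hp]
  have i1 : ∫ s in (0 : ℝ)..r, (f s - p s - q s) ≤ ∫ _ in (0 : ℝ)..r, -k := by
    apply intervalIntegral.integral_mono_on_of_le_Ioo hr.1.le (hd.mono_set s1) (by simp)
    intro s hs
    linarith [h1 s hs, hq0 s ⟨hs.1, hs.2.trans hr.2⟩]
  have i2 : ∫ s in r..1, (f s - p s - q s) ≤ ∫ _ in r..1, (0 : ℝ) := by
    apply intervalIntegral.integral_mono_on_of_le_Ioo hr.2.le (hd.mono_set s2) (by simp)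
    intro s hs
    linarith [h2 s ⟨hr.1.trans hs.1, hs.2⟩]
  have e2 := intervalIntegral.integral_add_adjacent_intervals (hd.mono_set s1) (hd.mono_set s2)
  simp only [intervalIntegral.integral_const, smul_eq_mul, sub_zero, mul_zero] at i1 i2
  linarith

namespace IsStart

variable {L μ lam θ : ℝ}

/-- Right of the starting amplitude, the amplitudes are admissible and the energy grows at least
linearly. -/
theorem exists_linear_energy (hg : IsHump g σ) (h : IsStart g σ L μ lam θ) :
    ∃ β c, θ < β ∧ 0 < c ∧ ∀ γ ∈ Icc θ β, Admissible g σ lam μ γ ∧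
      potential g γ ≤ γ * g γ ∧ c * (γ - θ) ≤ lam * potential g γ - μ * γ := by
  have hc := hg.continuous
  have hG := hg.continuous_potential
  have hlam := h.lam_pos
  have hf := sub_pos.2 h.admissible.force
  set c := (lam * g θ - μ) / 2 with hcdef
  have hc0 : 0 < c := half_pos hf
  have e1 : ∀ᶠ x in 𝓝 θ, c + μ < lam * g x :=
    ContinuousAt.eventually_lt (f := fun _ => c + μ) (g := fun x => lam * g x) continuousAt_const
      (Continuous.continuousAt (by fun_prop)) (by rw [hcdef]; linarith)
  have e2 : ∀ᶠ x in 𝓝 θ, potential g x < x * g x :=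
    ContinuousAt.eventually_lt (f := fun x => potential g x) (g := fun x => x * g x)
      hG.continuousAt (Continuous.continuousAt (by fun_prop)) h.mean_lt
  obtain ⟨r, hr, hball⟩ := Metric.eventually_nhds_iff.1
    (e1.and (e2.and (Iio_mem_nhds h.mem.2)))
  have key : ∀ γ ∈ Icc θ (θ + r / 2), c + μ < lam * g γ ∧ potential g γ < γ * g γ ∧ γ < σ := by
    intro γ hγ
    exact hball (by rw [Real.dist_eq, abs_lt]; constructor <;> linarith [hγ.1, hγ.2])
  refine ⟨θ + r / 2, c, by linarith, hc0, fun γ hγ => ?_⟩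
  obtain ⟨k1, k2, k3⟩ := key γ hγ
  have hint : ∫ t in θ..γ, (c + μ) / lam ≤ ∫ t in θ..γ, g t := by
    apply intervalIntegral.integral_mono_on hγ.1 (by simp)
      (hg.continuous.intervalIntegrable _ _)
    intro x hx
    rw [div_le_iff₀ hlam, mul_comm]
    exact (key x ⟨hx.1, hx.2.trans hγ.2⟩).1.le
  rw [intervalIntegral.integral_const, smul_eq_mul, ← hg.potential_sub] at hint
  have h2 := mul_le_mul_of_nonneg_left hint hlam.le
  have h3 : lam * ((γ - θ) * ((c + μ) / lam)) = (γ - θ) * (c + μ) := by field_simp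
  have h4 := h.energy_eq
  have h5 : c * (γ - θ) ≤ lam * potential g γ - μ * γ := by nlinarith
  have h6 : 0 ≤ c * (γ - θ) := mul_nonneg hc0.le (sub_nonneg.2 hγ.1)
  exact ⟨⟨h.mem.1.trans_le hγ.1, k3, by linarith, by linarith⟩, k2.le, h5⟩

theorem gap_le_mul (hg : IsHump g σ) (h : IsStart g σ L μ lam θ) {s : ℝ}
    (hs : s ∈ Icc (0 : ℝ) 1) : gap g lam μ θ s ≤ μ * θ * s := by
  have h1 : 0 ≤ potential g (θ * s) :=
    hg.potential_nonneg ⟨mul_nonneg h.mem.1.le hs.1, by nlinarith [hs.2, h.mem.1, h.mem.2]⟩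
  have h2 := mul_nonneg h.lam_pos.le h1
  have h3 := h.energy_eq
  unfold gap
  nlinarith

/-- At zero energy the gap is at most μθs, so the density is of order at least 1/q for s ≤ q². -/
theorem div_le_mul_slowness (hg : IsHump g σ) (h : IsStart g σ L μ lam θ) {q s : ℝ} (hq : 0 < q)
    (hs : s ∈ Ioo (0 : ℝ) 1) (hsq : s ≤ q ^ 2) :
    θ / Real.sqrt (μ * θ * (μ * θ + 2)) / q ≤ θ * slowness (gap g lam μ θ s) := by
  have hμ := h.mu_pos hg
  have hθ := h.mem.1
  have hp : 0 < μ * θ := mul_pos hμ hθ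
  have hw := h.admissible.gap_pos hg hμ.le hs
  have hwle := h.gap_le_mul hg (Ioo_subset_Icc_self hs)
  generalize gap g lam μ θ s = w at *
  have h2 : w ≤ μ * θ * q ^ 2 := hwle.trans (mul_le_mul_of_nonneg_left hsq hp.le)
  have h3 : w ≤ μ * θ := hwle.trans (by nlinarith [hs.2])
  have h1 : w * (w + 2) ≤ μ * θ * (μ * θ + 2) * q ^ 2 := by
    calc _ ≤ (μ * θ * q ^ 2) * (μ * θ + 2) :=
          mul_le_mul h2 (by linarith) (by linarith) (by positivity)
      _ = _ := by ring
  have h4 : 1 / Real.sqrt (μ * θ * (μ * θ + 2) * q ^ 2) ≤ 1 / Real.sqrt (w * (w + 2)) :=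
    one_div_le_one_div_of_le (by positivity) (Real.sqrt_le_sqrt h1)
  rw [Real.sqrt_mul (by positivity), Real.sqrt_sq hq.le] at h4
  calc _ = θ * (1 / (Real.sqrt (μ * θ * (μ * θ + 2)) * q)) := by
        rw [div_div, mul_one_div]
    _ ≤ _ := mul_le_mul_of_nonneg_left (h4.trans (le_slowness hw)) hθ.le

end IsStart

/-- The gap is at least (1 - s)F(γ) ≥ y²/2 for s ≤ 1/2: positive energy removes the singularity at s
= 0. -/
theorem Admissible.slowness_le_of_energy (hg : IsHump g σ) {lam μ γ s y : ℝ}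
    (h : Admissible g σ lam μ γ) (hμ : 0 ≤ μ) (hE : potential g γ ≤ γ * g γ) (hy : 0 < y)
    (hy1 : y ≤ 1) (hyF : y ^ 2 ≤ lam * potential g γ - μ * γ) (hs : s ∈ Ioc (0 : ℝ) (1 / 2)) :
    slowness (gap g lam μ γ s) ≤ 2 / y := by
  have hs' : s ∈ Ioo (0 : ℝ) 1 := ⟨hs.1, by linarith [hs.2]⟩
  have hw := h.gap_pos hg hμ hs'
  have h1 : y ^ 2 ≤ 2 * gap g lam μ γ s := by
    have h2 := mul_le_mul_of_nonneg_left (hg.potential_scaled_le h.pos h.lt.le hE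
      (Ioo_subset_Icc_self hs')) (h.lam_pos hg hμ).le
    have h3 : (1 - s) * (lam * potential g γ - μ * γ) ≤ gap g lam μ γ s := by
      unfold gap; linarith
    have h4 : 0 < y ^ 2 := by positivity
    nlinarith [hs.2]
  have h2 := slowness_le hw
  have h3 : 1 / Real.sqrt (2 * gap g lam μ γ s) ≤ 1 / y :=
    one_div_le_one_div_of_le hy (Real.le_sqrt_of_sq_le h1)
  have h4 : 1 ≤ 1 / y := (one_le_div hy).2 hy1
  have h5 : 2 / y = 1 / y + 1 / y := by ring
  linarith

namespace IsStart

variable {L μ lam θ : ℝ}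

/-- Take γ = θ + x², whose energy is at least c x² = y². On (0, q²) the density at θ is at least A/q
and that at γ at most 2β/y. Choosing q = Ay/(4β) makes the latter A/(2q), so the gain is Aq/2 = Dx.
Elsewhere convexity between θ and β costs at most t · T with weight t ≤ Cx². For small x the linear
gain wins. -/
theorem exists_timeMap_lt (hg : IsHump g σ) (h : IsStart g σ L μ lam θ) :
    ∃ α, θ < α ∧ Admissible g σ lam μ α ∧ timeMap g lam μ α < L := by
  have hμ := h.mu_pos hg
  have hθ := h.mem.1
  obtain ⟨β, c, hβ, hc, hlin⟩ := h.exists_linear_energy hg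
  have hβadm := (hlin β (right_mem_Icc.2 hβ.le)).1
  have hβ0 := hβadm.pos
  obtain ⟨A, hA⟩ : ∃ A, A = θ / Real.sqrt (μ * θ * (μ * θ + 2)) := ⟨_, rfl⟩
  have hA0 : 0 < A := by rw [hA]; positivity
  have hinv : 0 < θ⁻¹ - β⁻¹ := sub_pos.2 (inv_strictAnti₀ hθ hβ)
  obtain ⟨C, hC⟩ : ∃ C, C = 1 / (θ ^ 2 * (θ⁻¹ - β⁻¹)) := ⟨_, rfl⟩
  obtain ⟨D, hD⟩ : ∃ D, D = A ^ 2 * Real.sqrt c / (8 * β) := ⟨_, rfl⟩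
  have hD0 : 0 < D := by rw [hD]; positivity
  obtain ⟨T, hT⟩ : ∃ T, T = timeMap g lam μ β := ⟨_, rfl⟩
  have hT0 : 0 < T := by rw [hT]; exact hβ0.trans (hβadm.lt_timeMap hg hμ.le)
  obtain ⟨x, hx0, hx1, hx2, hx3, hx4⟩ : ∃ x : ℝ, 0 < x ∧ x ^ 2 < β - θ ∧ Real.sqrt c * x < 1 ∧
      A * (Real.sqrt c * x) / (4 * β) < 1 / 2 ∧ C * x * T < D := by
    have e1 : ∀ᶠ x : ℝ in 𝓝 0, x ^ 2 < β - θ :=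
      ContinuousAt.eventually_lt (by fun_prop) continuousAt_const (by simpa using hβ)
    have e2 : ∀ᶠ x : ℝ in 𝓝 0, Real.sqrt c * x < 1 :=
      ContinuousAt.eventually_lt (by fun_prop) continuousAt_const (by simp)
    have e3 : ∀ᶠ x : ℝ in 𝓝 0, A * (Real.sqrt c * x) / (4 * β) < 1 / 2 :=
      ContinuousAt.eventually_lt (by fun_prop) continuousAt_const (by simp)
    have e4 : ∀ᶠ x : ℝ in 𝓝 0, C * x * T < D :=
      ContinuousAt.eventually_lt (by fun_prop) continuousAt_const (by simpa using hD0)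
    exact ((eventually_mem_nhdsWithin (s := Ioi (0 : ℝ))).and
      ((e1.and (e2.and (e3.and e4))).filter_mono nhdsWithin_le_nhds)).exists
  have hsc : 0 < Real.sqrt c := Real.sqrt_pos.2 hc
  obtain ⟨y, hy⟩ : ∃ y, y = Real.sqrt c * x := ⟨_, rfl⟩
  have hy0 : 0 < y := by rw [hy]; positivity
  have hyc : y ^ 2 = c * x ^ 2 := by rw [hy, mul_pow, Real.sq_sqrt hc.le]
  obtain ⟨q, hq⟩ : ∃ q, q = A * y / (4 * β) := ⟨_, rfl⟩
  have hq0 : 0 < q := by rw [hq]; positivity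
  rw [← hy, ← hq] at hx3
  rw [← hy] at hx2
  obtain ⟨γ, hγdef⟩ : ∃ γ, γ = θ + x ^ 2 := ⟨_, rfl⟩
  have hγ : γ ∈ Ioo θ β := ⟨by rw [hγdef]; nlinarith, by rw [hγdef]; linarith⟩
  obtain ⟨hγadm, hγE, hγF⟩ := hlin γ (Ioo_subset_Icc_self hγ)
  have hγ0 := hγadm.pos
  have hyF : y ^ 2 ≤ lam * potential g γ - μ * γ := by
    rwa [hyc, show x ^ 2 = γ - θ by rw [hγdef]; ring]
  obtain ⟨t, ht, hte, htq⟩ := exists_weight hθ hγ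
  have htC : t ≤ C * x ^ 2 := by
    have e : θ⁻¹ - γ⁻¹ = x ^ 2 / (θ * γ) := by
      rw [show x ^ 2 = γ - θ by rw [hγdef]; ring]; field_simp
    rw [htq, e, hC, div_mul_eq_mul_div, one_mul, div_div]
    apply div_le_div_of_nonneg_left (by positivity) (by positivity)
    have : θ * θ ≤ θ * γ := mul_le_mul_of_nonneg_left hγ.1.le hθ.le
    exact mul_le_mul_of_nonneg_right (by linarith [sq θ]) hinv.le
  have hr : q ^ 2 ∈ Ioo (0 : ℝ) 1 := ⟨by positivity, by nlinarith⟩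
  have hgain := integral_le_of_gain (k := A / (2 * q)) hr (hγadm.intervalIntegrable hg hμ.le)
    (h.admissible.intervalIntegrable hg hμ.le)
    ((hβadm.intervalIntegrable hg hμ.le).const_mul t) ?_ ?_ ?_
  · refine ⟨γ, hγ.1, hγadm, ?_⟩
    have hgain' : timeMap g lam μ γ ≤ L - A / (2 * q) * q ^ 2 + t * T := by
      rw [← h.time, hT]
      unfold timeMap
      rwa [← intervalIntegral.integral_const_mul t]
    have h1 : A / (2 * q) * q ^ 2 = D * x := by
      have : A / (2 * q) * q ^ 2 = A * q / 2 := by field_simp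
      rw [this, hD, hq, hy]; field_simp; norm_num
    rw [h1] at hgain'
    have h2 := mul_le_mul_of_nonneg_right htC hT0.le
    have h3 := mul_lt_mul_of_pos_right hx4 hx0
    have h4 : C * x * T * x = C * x ^ 2 * T := by ring
    linarith
  · intro s hs
    exact mul_nonneg ht.1.le (mul_pos hβ0 (slowness_pos (hβadm.gap_pos hg hμ.le hs))).le
  · intro s hs
    have hs1 : s < 1 / 2 := hs.2.trans (by nlinarith)
    have hs' : s ∈ Ioo (0 : ℝ) 1 := ⟨hs.1, by linarith⟩
    have low := h.div_le_mul_slowness hg hq0 hs' hs.2.le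
    rw [← hA] at low
    have up : γ * slowness (gap g lam μ γ s) ≤ A / (2 * q) := by
      calc γ * slowness (gap g lam μ γ s) ≤ β * (2 / y) :=
            mul_le_mul hγ.2.le
              (hγadm.slowness_le_of_energy hg hμ.le hγE hy0 hx2.le hyF ⟨hs.1, hs1.le⟩)
              (slowness_pos (hγadm.gap_pos hg hμ.le hs')).le hβ0.le
        _ = A / (2 * q) := by rw [hq]; field_simp; norm_num
    have : A / q = A / (2 * q) + A / (2 * q) := by field_simp; norm_num
    linarith
  · intro s hs
    have h1 := integrand_lt_of_between hg h.admissible hβadm hμ.le hβ.ne ht hte hs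
    have h2 := mul_nonneg ht.1.le
      (mul_pos hθ (slowness_pos (h.admissible.gap_pos hg hμ.le hs))).le
    linarith

end IsStart

/-! ### Strictly quasiconvex functions -/

/-- Blow-up confines the search for a minimum to a compact interval. Two minimizers would have a
smaller value at their midpoint, so the minimum is strict. On either side the maximum in the
quasiconvexity inequality is the value at the end away from the minimum, which gives strict
monotonicity. -/
theorem exists_turning_point {Λ : ℝ → ℝ} {θ m : ℝ} (hcont : ContinuousOn Λ (Ico θ m))
    (hqc : ∀ α ∈ Ico θ m, ∀ β ∈ Ico θ m, ∀ γ ∈ Ioo α β, Λ γ < max (Λ α) (Λ β))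
    (hblow : ∀ M, ∃ a < m, ∀ α ∈ Ico θ m, a < α → M < Λ α)
    (hleft : ∃ α ∈ Ico θ m, θ < α ∧ Λ α < Λ θ) :
    ∃ α, θ < α ∧ α < m ∧ StrictAntiOn Λ (Icc θ α) ∧ StrictMonoOn Λ (Ico α m) ∧
      ∀ β ∈ Ico θ m, β ≠ α → Λ α < Λ β := by
  obtain ⟨α₁, hα₁, hθα₁, hlt⟩ := hleft
  have hθm : θ < m := hθα₁.trans hα₁.2
  obtain ⟨a, ham, ha⟩ := hblow (Λ θ)
  obtain ⟨x, hx, hmin⟩ := (isCompact_Icc (a := θ) (b := max a θ)).exists_isMinOn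
    ⟨θ, left_mem_Icc.2 (le_max_right _ _)⟩
    (hcont.mono fun y hy => ⟨hy.1, hy.2.trans_lt (max_lt ham hθm)⟩)
  have hxm : x ∈ Ico θ m := ⟨hx.1, hx.2.trans_lt (max_lt ham hθm)⟩
  have hxθ : Λ x ≤ Λ θ := isMinOn_iff.1 hmin θ (left_mem_Icc.2 (le_max_right _ _))
  have hglob : ∀ β ∈ Ico θ m, Λ x ≤ Λ β := by
    intro β hβ
    rcases le_or_gt β (max a θ) with h | h
    · exact isMinOn_iff.1 hmin β ⟨hβ.1, h⟩
    · exact hxθ.trans (ha β hβ ((le_max_left _ _).trans_lt h)).le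
  have hstrict : ∀ β ∈ Ico θ m, β ≠ x → Λ x < Λ β := by
    intro β hβ hne
    refine (hglob β hβ).lt_of_ne fun he => ?_
    rcases lt_or_gt_of_ne hne with h | h
    · have h1 := hqc β hβ x hxm ((β + x) / 2) ⟨by linarith, by linarith⟩
      have h2 := hglob ((β + x) / 2) ⟨by linarith [hβ.1], by linarith [hxm.2]⟩
      rw [← he, max_self] at h1
      exact h1.not_ge h2
    · have h1 := hqc x hxm β hβ ((β + x) / 2) ⟨by linarith, by linarith⟩
      have h2 := hglob ((β + x) / 2) ⟨by linarith [hxm.1], by linarith [hβ.2]⟩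
      rw [← he, max_self] at h1
      exact h1.not_ge h2
  have hθx : θ < x := by
    refine hxm.1.lt_of_ne ?_
    rintro rfl
    exact (hglob α₁ hα₁).not_gt hlt
  refine ⟨x, hθx, hxm.2, ?_, ?_, hstrict⟩
  · intro b hb c hc hbc
    have hbm : b ∈ Ico θ m := ⟨hb.1, hb.2.trans_lt hxm.2⟩
    rcases hc.2.eq_or_lt with rfl | h
    · exact hstrict b hbm hbc.ne
    · have h1 := hqc b hbm x hxm c ⟨hbc, h⟩
      rwa [max_eq_left (hglob b hbm)] at h1
  · intro b hb c hc hbc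
    have hcm : c ∈ Ico θ m := ⟨hθx.le.trans hc.1, hc.2⟩
    rcases hb.1.eq_or_lt with rfl | h
    · exact hstrict c hcm hbc.ne'
    · have h1 := hqc x hxm c hcm b ⟨h, hbc⟩
      rwa [max_eq_right (hglob c hcm)] at h1

end MinkowskiHarvest

namespace MinkowskiHarvest

variable {g : ℝ → ℝ} {σ : ℝ}

/-! ### The solution branch and its dependence on `μ` -/

/-- The solution curve for the harvesting rate `μ` is the graph of `Λ`, which starts at
`(lamBar, θ)` and turns at `(lamStar, α)`. -/
structure IsBranch (g : ℝ → ℝ) (σ L μ : ℝ) (Λ : ℝ → ℝ) (lamBar θ lamStar α : ℝ) : Prop where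
  start : IsStart g σ L μ lamBar θ
  lt_turn : θ < α
  turn_lt : α < min σ L
  mem : ∀ x ∈ Ico θ (min σ L), (Λ x, x) ∈ timeCurve g σ L μ
  at_start : Λ θ = lamBar
  at_turn : Λ α = lamStar
  cont : ContinuousOn Λ (Ico θ (min σ L))
  anti : StrictAntiOn Λ (Icc θ α)
  mono : StrictMonoOn Λ (Ico α (min σ L))
  turn_lt_of_ne : ∀ x ∈ Ico θ (min σ L), x ≠ α → lamStar < Λ x
  blowup : ∀ M, ∃ a < min σ L, ∀ x ∈ Ico θ (min σ L), a < x → M < Λ x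

theorem exists_isBranch (hg : IsHump g σ) {L μ : ℝ} (hL : 0 < L) (hμ : 0 < μ) :
    ∃ Λ lamBar θ lamStar α, IsBranch g σ L μ Λ lamBar θ lamStar α := by
  obtain ⟨θ, lam₀, h1, h2, h3, h4, h5⟩ := exists_start hg hμ hL
  have h : IsStart g σ L μ lam₀ θ := ⟨h1, h2, h3, h4, h5⟩
  have hex : ∀ x, ∃ lam, x ∈ Ico θ (min σ L) → (lam, x) ∈ timeCurve g σ L μ := by
    intro x
    by_cases hx : x ∈ Ico θ (min σ L)
    · obtain ⟨lam, hlam⟩ := h.exists_mem hg hx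
      exact ⟨lam, fun _ => hlam⟩
    · exact ⟨0, fun hx' => absurd hx' hx⟩
  choose Λ hΛ using hex
  have hθm : θ < min σ L := lt_min h1.2 (h.lt_length hg)
  have hΛθ : Λ θ = lam₀ :=
    timeCurve_unique hg hμ.le (hΛ θ (left_mem_Ico.2 hθm)) h.mem_timeCurve
  have hcont := h.continuousOn hg hΛ
  have hblow := h.blowup hg hΛ
  obtain ⟨x, hx1, hx2, hx3⟩ := h.exists_timeMap_lt hg
  have hxm : x ∈ Ico θ (min σ L) :=
    ⟨hx1.le, lt_min hx2.lt ((hx2.lt_timeMap hg hμ.le).trans hx3)⟩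
  obtain ⟨α, a1, a2, a3, a4, a5⟩ := exists_turning_point hcont
    (fun α hα β hβ γ hγ => IsStart.lt_max hg hμ.le hΛ hα hβ hγ) hblow
    ⟨x, hxm, hx1, by rw [hΛθ]; exact lt_of_timeMap_lt hg hμ.le (hΛ x hxm) hx2 hx3⟩
  exact ⟨Λ, lam₀, θ, Λ α, α, h, a1, a2, hΛ, hΛθ, rfl, hcont, a3, a4, a5, hblow⟩

/-- The mean value of `g` on `[0, α]` increases with `α` up to an amplitude with `g(α)` above the
mean. -/
theorem IsHump.potential_div_mono (hg : IsHump g σ) {α β : ℝ} (hα : 0 < α) (hαβ : α ≤ β)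
    (hβ : β < σ) (hE : potential g β ≤ β * g β) : potential g α / α ≤ potential g β / β := by
  have hb := hα.trans_le hαβ
  have := hg.potential_scaled_le (s := α / β) hb hβ.le hE ⟨by positivity, (div_le_one hb).2 hαβ⟩
  rw [mul_div_cancel₀ _ hb.ne'] at this
  rw [div_le_iff₀ hα]
  exact this.trans_eq (by ring)

/-- If lam₂ ≤ lam₁, equality of the times forces θ₂ ≤ θ₁, and μ = lam · G(θ)/θ would give μ₂ ≤ μ₁.
Once lam₁ < lam₂ is known, θ₂ ≤ θ₁ would make the second time the shorter one. -/
theorem IsStart.lt_of_mu_lt (hg : IsHump g σ) {L μ₁ μ₂ lam₁ lam₂ θ₁ θ₂ : ℝ}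
    (h₁ : IsStart g σ L μ₁ lam₁ θ₁) (h₂ : IsStart g σ L μ₂ lam₂ θ₂) (hμ : μ₁ < μ₂) :
    lam₁ < lam₂ ∧ θ₁ < θ₂ := by
  have hlam : lam₁ < lam₂ := by
    by_contra! hle
    have hθ : θ₂ ≤ θ₁ := by
      by_contra! hlt
      have := start_timeMap_lt hg hle h₂.lam_pos h₁.mem.1 hlt h₂.mem.2 h₂.mean_lt
      rw [← h₁.mu_eq, ← h₂.mu_eq, h₁.time, h₂.time] at this
      exact this.false
    have h3 := hg.potential_div_mono h₂.mem.1 hθ h₁.mem.2 h₁.mean_lt.le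
    have h4 : μ₂ ≤ μ₁ := by
      rw [h₁.mu_eq, h₂.mu_eq]
      exact mul_le_mul hle h3 (div_pos (hg.potential_pos h₂.mem.1 h₂.mem.2.le) h₂.mem.1).le
        h₁.lam_pos.le
    exact h4.not_gt hμ
  refine ⟨hlam, ?_⟩
  by_contra! hle
  rcases hle.eq_or_lt with heq | hlt
  · have ha := h₁.admissible
    rw [← heq] at ha
    have hT : timeMap g lam₂ μ₂ θ₂ < timeMap g lam₁ μ₁ θ₂ := by
      refine timeMap_lt_of_gap_lt hg h₂.admissible ha (h₂.mu_pos hg).le (h₁.mu_pos hg).le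
        fun s hs => ?_
      have e1 := h₁.mu_eq
      rw [← heq] at e1
      rw [e1, h₂.mu_eq, start_gap h₂.mem.1, start_gap h₂.mem.1]
      have := sub_pos.2 (hg.potential_scaled_lt h₂.mem.1 h₂.mem.2.le h₂.mean_lt hs)
      have hp := h₂.mem.1
      gcongr
    have ht1 := h₁.time
    rw [← heq] at ht1
    rw [h₂.time, ht1] at hT
    exact hT.false
  · have := start_timeMap_lt hg hlam.le h₁.lam_pos h₂.mem.1 hlt h₁.mem.2 h₁.mean_lt
    rw [← h₁.mu_eq, ← h₂.mu_eq, h₁.time, h₂.time] at this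
    exact this.false

/-- The quotient μ/lam is the mean of g on [0, θ], which grows with θ and hence with μ. -/
theorem IsStart.mul_le_mul_of_lt (hg : IsHump g σ) {L μ₁ μ₂ lam₁ lam₂ θ₁ θ₂ : ℝ}
    (h₁ : IsStart g σ L μ₁ lam₁ θ₁) (h₂ : IsStart g σ L μ₂ lam₂ θ₂) (hμ : μ₁ < μ₂) :
    lam₂ * μ₁ ≤ lam₁ * μ₂ := by
  have h3 := hg.potential_div_mono h₁.mem.1 (h₁.lt_of_mu_lt hg h₂ hμ).2.le h₂.mem.2 h₂.mean_lt.le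
  have h4 := mul_le_mul_of_nonneg_left h3 (mul_pos h₁.lam_pos h₂.lam_pos).le
  calc lam₂ * μ₁ = lam₁ * lam₂ * (potential g θ₁ / θ₁) := by rw [h₁.mu_eq]; ring
    _ ≤ lam₁ * lam₂ * (potential g θ₂ / θ₂) := h4
    _ = lam₁ * μ₂ := by rw [h₂.mu_eq]; ring

/-! ### Minimality of the turning parameter and its monotonicity in μ -/

namespace IsBranch

variable {L μ lamBar θ lamStar α : ℝ} {Λ : ℝ → ℝ}

theorem turn_mem (h : IsBranch g σ L μ Λ lamBar θ lamStar α) : α ∈ Ico θ (min σ L) :=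
  ⟨h.lt_turn.le, h.turn_lt⟩

theorem turn_mem_timeCurve (h : IsBranch g σ L μ Λ lamBar θ lamStar α) :
    (lamStar, α) ∈ timeCurve g σ L μ := by
  have := h.mem α h.turn_mem
  rwa [h.at_turn] at this

theorem lamStar_lt_lamBar (h : IsBranch g σ L μ Λ lamBar θ lamStar α) : lamStar < lamBar := by
  rw [← h.at_start]
  exact h.turn_lt_of_ne θ ⟨le_rfl, h.lt_turn.trans h.turn_lt⟩ h.lt_turn.ne

theorem lamStar_pos (hg : IsHump g σ) (h : IsBranch g σ L μ Λ lamBar θ lamStar α) :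
    0 < lamStar :=
  h.turn_mem_timeCurve.1.lam_pos hg (h.start.mu_pos hg).le

/-- `lamStar` is the least parameter for which some admissible amplitude has time at most L. For x <
θ nonnegative energy alone forces lam ≥ `lamBar`; for x ≥ θ the parameter is at least Λ(x). -/
theorem lamStar_le (hg : IsHump g σ) (h : IsBranch g σ L μ Λ lamBar θ lamStar α) {lam x : ℝ}
    (hadm : Admissible g σ lam μ x) (ht : timeMap g lam μ x ≤ L) : lamStar ≤ lam := by
  have hμ := h.start.mu_pos hg
  rcases lt_or_ge x θ with hlt | hge
  · refine h.lamStar_lt_lamBar.le.trans ?_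
    have h1 := hg.potential_div_mono hadm.pos hlt.le h.start.mem.2 h.start.mean_lt.le
    have h2 := hadm.energy
    have hx := hadm.pos
    have hp := div_pos (hg.potential_pos h.start.mem.1 h.start.mem.2.le) h.start.mem.1
    have h3 : μ ≤ lam * (potential g x / x) := by
      rw [← mul_div_assoc, le_div_iff₀ hx]; exact h2
    rw [h.start.mu_eq] at h3
    have h4 := mul_le_mul_of_nonneg_left h1 (hadm.lam_pos hg hμ.le).le
    exact le_of_mul_le_mul_right (h3.trans h4) hp
  · have hx : x ∈ Ico θ (min σ L) :=
      ⟨hge, lt_min hadm.lt ((hadm.lt_timeMap hg hμ.le).trans_le ht)⟩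
    have h1 : lamStar ≤ Λ x := by
      by_cases hxα : x = α
      · rw [hxα, h.at_turn]
      · exact (h.turn_lt_of_ne x hx hxα).le
    refine h1.trans ?_
    by_contra! hlt
    have := timeMap_lt_of_lam_lt hg (h.mem x hx).1 hadm hμ.le hlt
    simp only [(h.mem x hx).2] at this
    exact this.not_ge ht

/-- At the turning point of the larger rate, less harvesting shortens the time, so the curve for μ
passes strictly left of that point. It does reach the amplitude α', because θ < θ' < α'. -/
theorem lt_of_mu_lt (hg : IsHump g σ) {μ' lamBar' θ' lamStar' α' : ℝ} {Λ' : ℝ → ℝ}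
    (h : IsBranch g σ L μ Λ lamBar θ lamStar α)
    (h' : IsBranch g σ L μ' Λ' lamBar' θ' lamStar' α') (hμ : μ < μ') : lamStar < lamStar' := by
  have hμ0 := h.start.mu_pos hg
  have hc := h'.turn_mem_timeCurve
  have hadm : Admissible g σ lamStar' μ α' := hc.1.mono hg le_rfl hμ.le
  have hT := timeMap_lt_of_mu_lt hg hadm hc.1 hμ0.le hμ
  simp only [hc.2] at hT
  have hx : α' ∈ Ico θ (min σ L) :=
    ⟨((h.start.lt_of_mu_lt hg h'.start hμ).2.trans h'.lt_turn).le, h'.turn_lt⟩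
  have h1 := lt_of_timeMap_lt hg hμ0.le (h.mem _ hx) hadm hT
  refine lt_of_le_of_lt ?_ h1
  by_cases hxα : α' = α
  · rw [hxα, h.at_turn]
  · exact (h.turn_lt_of_ne _ hx hxα).le

/-- Multiplying `lam` and μ by the same k > 1 multiplies the gap by k and so shortens the time.
Minimality of `lamStar'` then gives lamStar' ≤ k · lamStar. -/
theorem mul_le_mul_of_lt (hg : IsHump g σ) {μ' lamBar' θ' lamStar' α' : ℝ} {Λ' : ℝ → ℝ}
    (h : IsBranch g σ L μ Λ lamBar θ lamStar α)
    (h' : IsBranch g σ L μ' Λ' lamBar' θ' lamStar' α') (hμ : μ < μ') :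
    lamStar' * μ ≤ lamStar * μ' := by
  have hμ0 := h.start.mu_pos hg
  have hc := h.turn_mem_timeCurve
  have hα := hc.1.pos
  set k := μ' / μ with hk
  have hk1 : 1 < k := (one_lt_div hμ0).2 hμ
  have hk0 : 0 < k := zero_lt_one.trans hk1
  have hkμ : k * μ = μ' := div_mul_cancel₀ _ hμ0.ne'
  have hadm : Admissible g σ (k * lamStar) μ' α := by
    have h1 := mul_le_mul_of_nonneg_left hc.1.energy hk0.le
    have h2 := mul_lt_mul_of_pos_left hc.1.force hk0
    simp only at h1 h2
    exact ⟨hc.1.pos, hc.1.lt, by rw [← hkμ]; linarith, by rw [← hkμ]; linarith⟩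
  have hT : timeMap g (k * lamStar) μ' α < timeMap g lamStar μ α := by
    refine timeMap_lt_of_gap_lt hg hadm hc.1 (hμ0.trans hμ).le hμ0.le fun s hs => ?_
    have e : gap g (k * lamStar) μ' α s = k * gap g lamStar μ α s := by
      rw [← hkμ]; unfold gap; ring
    have := hc.1.gap_pos hg hμ0.le hs
    simp only at this
    rw [e]
    nlinarith
  have hT' := hc.2
  simp only at hT'
  rw [hT'] at hT
  have h3 := h'.lamStar_le hg hadm hT.le
  have h4 := mul_le_mul_of_nonneg_right h3 hμ0.le
  calc _ ≤ _ := h4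
    _ = lamStar * (k * μ) := by ring
    _ = _ := by rw [hkμ]

end IsBranch

/-- With h increasing and h(y)/y nonincreasing, h(y) lies between h(x) and h(x) · y/x on either side
of x. -/
theorem continuousOn_of_sublinear {h : ℝ → ℝ} (hmono : StrictMonoOn h (Ioi 0))
    (hsub : ∀ x, 0 < x → ∀ y, x < y → h y * x ≤ h x * y) : ContinuousOn h (Ioi 0) := by
  intro x hx
  have hx0 : 0 < x := hx
  have t : Tendsto (fun y => h x * (y / x)) (𝓝[Ioi 0] x) (𝓝 (h x)) := by
    have : ContinuousAt (fun y => h x * (y / x)) x := by fun_prop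
    have := this.tendsto
    rw [div_self hx0.ne', mul_one] at this
    exact this.mono_left nhdsWithin_le_nhds
  have t1 := t.min (tendsto_const_nhds (x := h x))
  have t2 := t.max (tendsto_const_nhds (x := h x))
  rw [min_self] at t1
  rw [max_self] at t2
  refine tendsto_of_tendsto_of_tendsto_of_le_of_le' t1 t2 ?_ ?_
  · filter_upwards [self_mem_nhdsWithin] with y hy
    rcases lt_or_ge y x with hlt | hge
    · refine min_le_of_left_le ?_
      rw [← mul_div_assoc, div_le_iff₀ hx0]
      exact hsub y hy x hlt
    · exact min_le_of_right_le (hmono.monotoneOn hx hy hge)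
  · filter_upwards [self_mem_nhdsWithin] with y hy
    rcases le_or_gt y x with hle | hgt
    · exact le_max_of_le_right (hmono.monotoneOn hy hx hle)
    · refine le_max_of_le_left ?_
      rw [← mul_div_assoc, le_div_iff₀ hx0]
      exact hsub x hx0 y hgt

theorem IsHump.exists_bound (hg : IsHump g σ) : ∃ M, 0 < M ∧ ∀ u ∈ Icc 0 σ, g u ≤ M := by
  obtain ⟨x, -, hx⟩ := isCompact_Icc.exists_isMaxOn (nonempty_Icc.2 hg.sigma_pos.le)
    hg.continuous.continuousOn
  exact ⟨max (g x) 1, zero_lt_one.trans_le (le_max_right _ _),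
    fun u hu => (isMaxOn_iff.1 hx u hu).trans (le_max_left _ _)⟩

theorem IsBranch.div_le_lamStar (hg : IsHump g σ) {L μ lamBar θ lamStar α M : ℝ} {Λ : ℝ → ℝ}
    (h : IsBranch g σ L μ Λ lamBar θ lamStar α) (hM : 0 < M) (hb : ∀ u ∈ Icc 0 σ, g u ≤ M) :
    μ / M ≤ lamStar := by
  have hc := h.turn_mem_timeCurve
  rw [div_le_iff₀ hM]
  exact hc.1.force.le.trans (mul_le_mul_of_nonneg_left (hb α ⟨hc.1.pos.le, hc.1.lt.le⟩)
    (h.lamStar_pos hg).le)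

/-! ### Bounds from the slope of `g` at zero -/

namespace IsHump

theorem potential_sub_scaled_ge_of_slope (hg : IsHump g σ) {γ α s : ℝ} (hα : 0 ≤ α)
    (hmono : MonotoneOn (fun u => g u - γ * u) (Icc 0 α)) (hs : s ∈ Icc (0 : ℝ) 1) :
    α ^ 2 * (γ * (1 - s ^ 2) / 2) ≤ potential g α - potential g (α * s) := by
  have h0 : ∀ u ∈ Icc 0 α, γ * u ≤ g u := by
    intro u hu
    have := hmono (left_mem_Icc.2 hα) hu hu.1
    simp only [hg.map_zero, mul_zero, sub_zero] at this
    linarith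
  have hle : α * s ≤ α := by nlinarith [hs.2]
  have : ∫ t in (α * s)..α, γ * t ≤ ∫ t in (α * s)..α, g t :=
    intervalIntegral.integral_mono_on hle (Continuous.intervalIntegrable (by fun_prop) _ _)
      (hg.continuous.intervalIntegrable _ _)
      fun t ht => h0 t ⟨(mul_nonneg hα hs.1).trans ht.1, ht.2⟩
  rw [intervalIntegral.integral_const_mul, integral_id, ← hg.potential_sub] at this
  refine le_trans (le_of_eq ?_) this
  ring

theorem potential_sub_scaled_le_of_slope (hg : IsHump g σ) {γ α s : ℝ} (hα : 0 ≤ α)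
    (hanti : AntitoneOn (fun u => g u - γ * u) (Icc 0 α)) (hs : s ∈ Icc (0 : ℝ) 1) :
    potential g α - potential g (α * s) ≤ α ^ 2 * (γ * (1 - s ^ 2) / 2) := by
  have h0 : ∀ u ∈ Icc 0 α, g u ≤ γ * u := by
    intro u hu
    have := hanti (left_mem_Icc.2 hα) hu hu.1
    simp only [hg.map_zero, mul_zero, sub_zero] at this
    linarith
  have hle : α * s ≤ α := by nlinarith [hs.2]
  have : ∫ t in (α * s)..α, g t ≤ ∫ t in (α * s)..α, γ * t :=
    intervalIntegral.integral_mono_on hle (hg.continuous.intervalIntegrable _ _)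
      (Continuous.intervalIntegrable (by fun_prop) _ _)
      fun t ht => h0 t ⟨(mul_nonneg hα hs.1).trans ht.1, ht.2⟩
  rw [intervalIntegral.integral_const_mul, integral_id, ← hg.potential_sub] at this
  refine this.trans_eq ?_
  ring

theorem mul_sub_potential_ge_of_slope (hg : IsHump g σ) {γ α : ℝ} (hα : 0 ≤ α)
    (hmono : MonotoneOn (fun u => g u - γ * u) (Icc 0 α)) :
    γ * α ^ 2 / 2 ≤ α * g α - potential g α := by
  have : ∫ t in (0 : ℝ)..α, g t ≤ ∫ t in (0 : ℝ)..α, (g α - γ * (α - t)) :=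
    intervalIntegral.integral_mono_on hα (hg.continuous.intervalIntegrable _ _)
      (Continuous.intervalIntegrable (by fun_prop) _ _) fun t ht => by
        have := hmono ht (right_mem_Icc.2 hα) ht.2
        simp only at this
        linarith
  have e : ∫ t in (0 : ℝ)..α, (g α - γ * (α - t)) = α * g α - γ * α ^ 2 / 2 := by
    have : ∀ t, g α - γ * (α - t) = (g α - γ * α) + γ * t := fun t => by ring
    simp only [this]
    rw [intervalIntegral.integral_add (by simp)
      (Continuous.intervalIntegrable (by fun_prop) _ _), intervalIntegral.integral_const_mul,
      integral_id]
    simp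
    ring
  rw [e] at this
  unfold potential
  linarith

theorem start_gap_le_of_slope (hg : IsHump g σ) {γ α s : ℝ} (hα : 0 ≤ α)
    (hanti : AntitoneOn (fun u => g u - γ * u) (Icc 0 α)) (hs : s ∈ Icc (0 : ℝ) 1) :
    s * potential g α - potential g (α * s) ≤ α ^ 2 * (γ * (s * (1 - s)) / 2) := by
  have hc := hg.continuous
  have : ∫ t in (0 : ℝ)..1, (g (α * t) - g (α * s * t))
      ≤ ∫ t in (0 : ℝ)..1, γ * α * (1 - s) * t := by
    apply intervalIntegral.integral_mono_on zero_le_one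
      (Continuous.intervalIntegrable (by fun_prop) _ _)
      (Continuous.intervalIntegrable (by fun_prop) _ _)
    intro t ht
    have h1 : α * t ≤ α := by nlinarith [ht.2]
    have h2 : α * s * t ≤ α * t := by nlinarith [mul_nonneg hα ht.1, hs.2]
    have h3 : 0 ≤ α * s * t := mul_nonneg (mul_nonneg hα hs.1) ht.1
    have := hanti ⟨h3, h2.trans h1⟩ ⟨h3.trans h2, h1⟩ h2
    simp only at this
    linarith
  rw [intervalIntegral.integral_const_mul, integral_id] at this
  rw [hg.start_gap_eq]
  have := mul_le_mul_of_nonneg_left this (mul_nonneg hα hs.1)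
  refine this.trans_eq ?_
  ring

end IsHump

/-- Lower bound of the parameter along the solution curve. -/
theorem pi_div_lt_of_mem_timeCurve (hg : IsHump g σ) {L μ lam α γ : ℝ} (hμ : 0 ≤ μ) (hγ : 0 < γ)
    (hanti : AntitoneOn (fun u => g u - γ * u) (Icc 0 σ)) (h : (lam, α) ∈ timeCurve g σ L μ) :
    Real.pi / (2 * Real.sqrt (lam * γ)) < L := by
  obtain ⟨hadm, ht⟩ := h
  simp only at hadm ht
  have hlam := hadm.lam_pos hg hμ
  have hα := hadm.pos
  rw [← ht]
  have e : Real.pi / (2 * Real.sqrt (lam * γ))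
      = ∫ s in (0 : ℝ)..1, 1 / Real.sqrt (lam * γ) * (1 / Real.sqrt (1 - s ^ 2)) := by
    rw [intervalIntegral.integral_const_mul, integral_inv_sqrt_one_sub_sq]
    field_simp
  rw [e]
  apply integral_lt_of_lt_Ioo (intervalIntegrable_inv_sqrt_one_sub_sq.const_mul _)
    (hadm.intervalIntegrable hg hμ)
  intro s hs
  have h1s : 0 < 1 - s ^ 2 := by nlinarith [hs.1, hs.2]
  have hw := hadm.gap_pos hg hμ hs
  have hle : gap g lam μ α s ≤ α ^ 2 * (lam * γ * (1 - s ^ 2) / 2) := by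
    have h1 := mul_le_mul_of_nonneg_left (hg.potential_sub_scaled_le_of_slope hα.le
      (hanti.mono (Icc_subset_Icc_right hadm.lt.le)) (Ioo_subset_Icc_self hs)) hlam.le
    have h2 : 0 ≤ μ * (α * (1 - s)) := mul_nonneg hμ (mul_nonneg hα.le (by linarith [hs.2]))
    unfold gap
    linarith
  calc 1 / Real.sqrt (lam * γ) * (1 / Real.sqrt (1 - s ^ 2))
      = 1 / Real.sqrt (2 * (lam * γ * (1 - s ^ 2) / 2)) := by
        rw [show 2 * (lam * γ * (1 - s ^ 2) / 2) = lam * γ * (1 - s ^ 2) by ring,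
          Real.sqrt_mul (show 0 ≤ lam * γ by positivity) (1 - s ^ 2), one_div_mul_one_div]
    _ < α * slowness (α ^ 2 * (lam * γ * (1 - s ^ 2) / 2)) :=
        lt_mul_slowness_scaled hα (by positivity)
    _ ≤ _ := mul_le_mul_of_nonneg_left (slowness_anti hw hle) hα.le

/-- Lower bound of the parameter at the starting point. -/
theorem IsStart.pi_div_lt (hg : IsHump g σ) {L μ lam θ γ : ℝ} (hγ : 0 < γ)
    (hanti : AntitoneOn (fun u => g u - γ * u) (Icc 0 σ)) (h : IsStart g σ L μ lam θ) :
    Real.pi / Real.sqrt (lam * γ) < L := by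
  have hlam := h.lam_pos
  have hθ := h.mem.1
  have hμ := (h.mu_pos hg).le
  rw [← h.time]
  have e : Real.pi / Real.sqrt (lam * γ)
      = ∫ s in (0 : ℝ)..1, 1 / Real.sqrt (lam * γ) * (1 / Real.sqrt (s * (1 - s))) := by
    rw [intervalIntegral.integral_const_mul, integral_inv_sqrt_mul]
    field_simp
  rw [e]
  apply integral_lt_of_lt_Ioo (intervalIntegrable_inv_sqrt_mul.const_mul _)
    (h.admissible.intervalIntegrable hg hμ)
  intro s hs
  have h1s : 0 < s * (1 - s) := mul_pos hs.1 (sub_pos.2 hs.2)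
  have hw := h.admissible.gap_pos hg hμ hs
  have hle : gap g lam μ θ s ≤ θ ^ 2 * (lam * γ * (s * (1 - s)) / 2) := by
    have h1 := mul_le_mul_of_nonneg_left (hg.start_gap_le_of_slope hθ.le
      (hanti.mono (Icc_subset_Icc_right h.mem.2.le)) (Ioo_subset_Icc_self hs)) hlam.le
    rw [h.mu_eq, start_gap hθ]
    have e1 : θ ^ 2 * (lam * ((s * potential g θ - potential g (θ * s)) / θ ^ 2))
        = lam * (s * potential g θ - potential g (θ * s)) := by field_simp
    rw [e1]
    linarith
  calc 1 / Real.sqrt (lam * γ) * (1 / Real.sqrt (s * (1 - s)))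
      = 1 / Real.sqrt (2 * (lam * γ * (s * (1 - s)) / 2)) := by
        rw [show 2 * (lam * γ * (s * (1 - s)) / 2) = lam * γ * (s * (1 - s)) by ring,
          Real.sqrt_mul (show 0 ≤ lam * γ by positivity) (s * (1 - s)), one_div_mul_one_div]
    _ < θ * slowness (θ ^ 2 * (lam * γ * (s * (1 - s)) / 2)) :=
        lt_mul_slowness_scaled hθ (by positivity)
    _ ≤ _ := mul_le_mul_of_nonneg_left (slowness_anti hw hle) hθ.le

/-- Without harvesting, small amplitudes have a time less than `L` if `lam` is large. -/
theorem exists_timeMap_zero_lt (hg : IsHump g σ) {L lam γ a : ℝ} (hlam : 0 < lam) (hγ : 0 < γ)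
    (ha : a ∈ Ioo 0 σ) (hmono : MonotoneOn (fun u => g u - γ * u) (Icc 0 a))
    (hL : Real.pi / (2 * Real.sqrt (lam * γ)) < L) :
    ∃ α, Admissible g σ lam 0 α ∧ timeMap g lam 0 α < L := by
  set P := Real.pi / (2 * Real.sqrt (lam * γ)) with hP
  -- The time will be at most α + P, so α ≤ (L - P)/2 keeps it below L.
  set α := min a ((L - P) / 2) with hα
  have hα0 : 0 < α := lt_min ha.1 (by linarith)
  have hαa : α ≤ a := min_le_left _ _
  have hα2 : α ≤ (L - P) / 2 := min_le_right _ _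
  have hασ : α < σ := hαa.trans_lt ha.2
  have hadm : Admissible g σ lam 0 α := ⟨hα0, hασ,
    by rw [zero_mul]; exact (mul_pos hlam (hg.potential_pos hα0 hασ.le)).le,
    mul_pos hlam (hg.pos α ⟨hα0, hασ⟩)⟩
  refine ⟨α, hadm, ?_⟩
  have hint : IntervalIntegrable (fun s : ℝ => α + 1 / Real.sqrt (lam * γ)
      * (1 / Real.sqrt (1 - s ^ 2))) MeasureTheory.volume 0 1 :=
    intervalIntegrable_const.add (intervalIntegrable_inv_sqrt_one_sub_sq.const_mul _)
  have hle : timeMap g lam 0 α ≤ ∫ s in (0 : ℝ)..1, (α + 1 / Real.sqrt (lam * γ)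
      * (1 / Real.sqrt (1 - s ^ 2))) := by
    apply intervalIntegral.integral_mono_on_of_le_Ioo zero_le_one
      (hadm.intervalIntegrable hg le_rfl) hint
    intro s hs
    have h1s : 0 < 1 - s ^ 2 := by nlinarith [hs.1, hs.2]
    have hge : α ^ 2 * (lam * γ * (1 - s ^ 2) / 2) ≤ gap g lam 0 α s := by
      have h1 := mul_le_mul_of_nonneg_left (hg.potential_sub_scaled_ge_of_slope hα0.le
        (hmono.mono (Icc_subset_Icc_right hαa)) (Ioo_subset_Icc_self hs)) hlam.le
      unfold gap
      linarith
    calc α * slowness (gap g lam 0 α s)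
        ≤ α * slowness (α ^ 2 * (lam * γ * (1 - s ^ 2) / 2)) :=
          mul_le_mul_of_nonneg_left (slowness_anti (by positivity) hge) hα0.le
      _ ≤ α + 1 / Real.sqrt (2 * (lam * γ * (1 - s ^ 2) / 2)) :=
          mul_slowness_scaled_le hα0 (by positivity)
      _ = _ := by
        rw [show 2 * (lam * γ * (1 - s ^ 2) / 2) = lam * γ * (1 - s ^ 2) by ring,
          Real.sqrt_mul (show 0 ≤ lam * γ by positivity) (1 - s ^ 2), one_div_mul_one_div]
  rw [intervalIntegral.integral_add (by simp)
    (intervalIntegrable_inv_sqrt_one_sub_sq.const_mul _), intervalIntegral.integral_const_mul,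
    integral_inv_sqrt_one_sub_sq] at hle
  have e : 1 / Real.sqrt (lam * γ) * (Real.pi / 2) = P := by rw [hP]; field_simp
  rw [e] at hle
  simp only [intervalIntegral.integral_const, sub_zero, smul_eq_mul, one_mul] at hle
  linarith

/-- For small `μ` the turning point lies to the left of `lam`. -/
theorem eventually_lamStar_le (hg : IsHump g σ) {L lam γ a : ℝ} (hlam : 0 < lam) (hγ : 0 < γ)
    (ha : a ∈ Ioo 0 σ) (hmono : MonotoneOn (fun u => g u - γ * u) (Icc 0 a))
    (hL : Real.pi / (2 * Real.sqrt (lam * γ)) < L) :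
    ∀ᶠ μ in 𝓝[>] 0, ∀ Λ lamBar θ lamStar α, IsBranch g σ L μ Λ lamBar θ lamStar α →
      lamStar ≤ lam := by
  -- An amplitude with time below L at μ = 0 keeps this property for small μ by continuity, and
  -- `lamStar` is minimal.
  obtain ⟨α, hadm, hT⟩ := exists_timeMap_zero_lt hg hlam hγ ha hmono hL
  have hα := hadm.pos
  have ev : ∀ᶠ μ in 𝓝[≥] (0 : ℝ), 0 ≤ μ ∧ Admissible g σ lam μ α := by
    have e1 : ∀ᶠ μ : ℝ in 𝓝 0, μ * α < lam * potential g α :=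
      ContinuousAt.eventually_lt (by fun_prop) continuousAt_const
        (by simpa using mul_pos hlam (hg.potential_pos hα hadm.lt.le))
    filter_upwards [self_mem_nhdsWithin, mem_nhdsWithin_of_mem_nhds e1,
      mem_nhdsWithin_of_mem_nhds (Iio_mem_nhds hadm.force)] with μ h1 h2 h3
    exact ⟨h1, hα, hadm.lt, h2.le, h3⟩
  have hcont := continuousOn_timeMap_comp hg (S := {μ | 0 ≤ μ ∧ Admissible g σ lam μ α})
    (l := fun _ => lam) (m := fun x => x) (a := fun _ => α) continuousOn_const continuousOn_id
    continuousOn_const fun x hx => hx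
  have ht := (hcont 0 ⟨le_rfl, hadm⟩).tendsto.eventually_lt_const hT
  have ht' : ∀ᶠ μ in 𝓝[≥] (0 : ℝ), timeMap g lam μ α < L := by
    rw [eventually_nhdsWithin_iff] at ht ev ⊢
    filter_upwards [ht, ev] with μ h1 h2 h3
    exact h1 (h2 h3)
  have hmono' : 𝓝[>] (0 : ℝ) ≤ 𝓝[≥] 0 := nhdsWithin_mono _ Ioi_subset_Ici_self
  filter_upwards [hmono' ev, hmono' ht'] with μ h1 h2 Λ lamBar θ lamStar x hb
  exact hb.lamStar_le hg h1.2 h2.le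

/-- For small `μ` the starting point lies to the left of `lam`. -/
theorem eventually_lamBar_le (hg : IsHump g σ) {L lam γ a : ℝ} (hlam : 0 < lam) (hγ : 0 < γ)
    (ha : a ∈ Ioo 0 σ) (hmono : MonotoneOn (fun u => g u - γ * u) (Icc 0 a))
    (hL : Real.pi / Real.sqrt (lam * γ) < L) :
    ∀ᶠ μ in 𝓝[>] 0, ∀ lamBar θ, IsStart g σ L μ lamBar θ → lamBar ≤ lam := by
  set P := Real.pi / Real.sqrt (lam * γ) with hP
  set α := min a ((L - P) / 2) with hα
  have hα0 : 0 < α := lt_min ha.1 (by linarith)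
  have hαa : α ≤ a := min_le_left _ _
  have hα2 : α ≤ (L - P) / 2 := min_le_right _ _
  have hασ : α < σ := hαa.trans_lt ha.2
  have hslope := hg.mul_sub_potential_ge_of_slope hα0.le
    (hmono.mono (Icc_subset_Icc_right hαa))
  have hE : potential g α < α * g α := by
    have : 0 < γ * α ^ 2 / 2 := by positivity
    linarith
  have hT : timeMap g lam (lam * (potential g α / α)) α < L := by
    refine (start_timeMap_le hg hlam hα0 le_rfl hασ hE).trans_lt ?_
    have h1 : lam * γ ≤ 2 * (lam * ((α * g α - potential g α) / α ^ 2)) := by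
      have : γ / 2 ≤ (α * g α - potential g α) / α ^ 2 := by
        rw [le_div_iff₀ (by positivity)]; linarith
      have := mul_le_mul_of_nonneg_left this hlam.le
      linarith
    have h2 : Real.pi / Real.sqrt (2 * (lam * ((α * g α - potential g α) / α ^ 2))) ≤ P := by
      rw [hP]
      exact div_le_div_of_nonneg_left Real.pi_pos.le (Real.sqrt_pos.2 (by positivity))
        (Real.sqrt_le_sqrt h1)
    linarith
  -- μ₀ is the rate of zero energy at (lam, α), where the time is below L. For μ < μ₀ suppose lamBar
  -- > lam: then θ > α would give μ ≥ μ₀, and θ ≤ α a time below L.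
  set μ₀ := lam * (potential g α / α) with hμ₀
  have hμ₀0 : 0 < μ₀ := mul_pos hlam (div_pos (hg.potential_pos hα0 hασ.le) hα0)
  filter_upwards [self_mem_nhdsWithin, mem_nhdsWithin_of_mem_nhds (Iio_mem_nhds hμ₀0)]
    with μ h0 h1 lamBar θ hs
  by_contra! hlt
  have h1' : μ < μ₀ := h1
  rcases lt_or_ge α θ with hθ | hθ
  · have h2 := hg.potential_div_mono hα0 hθ.le hs.mem.2 hs.mean_lt.le
    have h3 : μ₀ ≤ μ := by
      rw [hs.mu_eq, hμ₀]
      exact mul_le_mul hlt.le h2 (div_pos (hg.potential_pos hα0 hασ.le) hα0).le hs.lam_pos.le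
    exact h3.not_gt h1'
  · have h2 : timeMap g lamBar μ θ ≤ timeMap g lam μ₀ α := by
      rcases hθ.eq_or_lt with heq | hθ'
      · have hc : lam * (potential g α / α) < lamBar * (potential g α / α) :=
          mul_lt_mul_of_pos_right hlt (div_pos (hg.potential_pos hα0 hασ.le) hα0)
        rw [← heq, ← hs.mu_eq, heq] at hc
        exact absurd hc h1'.not_gt
      · have := start_timeMap_lt hg hlt.le hlam hs.mem.1 hθ' hασ hE
        rw [← hs.mu_eq] at this
        exact this.le
    rw [hs.time] at h2
    exact h2.not_gt hT

end MinkowskiHarvest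

namespace MinkowskiHarvest

variable {g : ℝ → ℝ} {σ : ℝ}

/-! ### The quadrature formula -/

/-- The energy `F(v) = lam G(v) - μ v`. -/
noncomputable def energyAt (g : ℝ → ℝ) (lam μ v : ℝ) : ℝ := lam * potential g v - μ * v

theorem gap_eq_energy (g : ℝ → ℝ) (lam μ α s : ℝ) :
    gap g lam μ α s = energyAt g lam μ α - energyAt g lam μ (α * s) := by
  unfold gap energyAt; ring

theorem IsHump.hasDerivAt_energy (hg : IsHump g σ) (lam μ v : ℝ) :
    HasDerivAt (energyAt g lam μ) (lam * g v - μ) v :=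
  (((hg.hasDerivAt_potential v).const_mul lam).sub ((hasDerivAt_id v).const_mul μ)).congr_deriv
    (by simp)

theorem IsHump.continuous_energy (hg : IsHump g σ) (lam μ : ℝ) : Continuous (energyAt g lam μ) :=
  continuous_iff_continuousAt.2 fun v => (hg.hasDerivAt_energy lam μ v).continuousAt

theorem Admissible.energy_lt (hg : IsHump g σ) {lam μ α v : ℝ} (h : Admissible g σ lam μ α)
    (hμ : 0 ≤ μ) (hv : v ∈ Ioo 0 α) : energyAt g lam μ v < energyAt g lam μ α := by
  have := h.gap_pos hg hμ (s := v / α) ⟨div_pos hv.1 h.pos, (div_lt_one h.pos).2 hv.2⟩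
  rw [gap_eq_energy, mul_div_cancel₀ _ h.pos.ne'] at this
  linarith

open Classical in
/-- The slowness of the solution of amplitude `α` at height `v`, extended by `1` outside
`(0, α)`. -/
noncomputable def rate (g : ℝ → ℝ) (lam μ α v : ℝ) : ℝ :=
  if v ∈ Ioo 0 α then slowness (energyAt g lam μ α - energyAt g lam μ v) else 1

/-- The time at which the solution of amplitude `α` reaches the height `v`. -/
noncomputable def clock (g : ℝ → ℝ) (lam μ α v : ℝ) : ℝ := ∫ t in v..α, rate g lam μ α t

namespace Admissible

variable {lam μ α : ℝ}

theorem one_le_rate (hg : IsHump g σ) (h : Admissible g σ lam μ α) (hμ : 0 ≤ μ) (v : ℝ) :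
    1 ≤ rate g lam μ α v := by
  unfold rate
  split_ifs with hv
  · exact (one_lt_slowness (sub_pos.2 (h.energy_lt hg hμ hv))).le
  · exact le_rfl

theorem intervalIntegrable_slowness (hg : IsHump g σ) (h : Admissible g σ lam μ α)
    (hμ : 0 ≤ μ) : IntervalIntegrable
      (fun v => slowness (energyAt g lam μ α - energyAt g lam μ v)) MeasureTheory.volume 0 α := by
  have hα := h.pos.ne'
  have h1 := ((h.intervalIntegrable hg hμ).const_mul α⁻¹).comp_mul_left (c := α⁻¹)
  simp only [zero_div, one_div, inv_inv] at h1
  refine h1.congr fun v _ => ?_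
  simp only [gap_eq_energy]
  rw [mul_inv_cancel_left₀ hα, inv_mul_cancel_left₀ hα]

theorem intervalIntegrable_rate (hg : IsHump g σ) (h : Admissible g σ lam μ α)
    (hμ : 0 ≤ μ) (a b : ℝ) :
    IntervalIntegrable (rate g lam μ α) MeasureTheory.volume a b := by
  have h1 : MeasureTheory.IntegrableOn
      (fun v => slowness (energyAt g lam μ α - energyAt g lam μ v) - 1) (Ioo 0 α) := by
    refine MeasureTheory.IntegrableOn.mono_set ?_ Ioo_subset_Ioc_self
    exact ((h.intervalIntegrable_slowness hg hμ).sub intervalIntegrable_const).1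
  have h2 := ((MeasureTheory.integrable_indicator_iff measurableSet_Ioo).2 h1).intervalIntegrable
    (a := a) (b := b)
  refine (h2.add (intervalIntegrable_const (c := (1 : ℝ)))).congr fun v _ => ?_
  simp only [indicator, rate]
  split_ifs <;> ring

theorem clock_top : clock g lam μ α α = 0 := by simp [clock]

theorem clock_zero (h : Admissible g σ lam μ α) :
    clock g lam μ α 0 = timeMap g lam μ α := by
  have e : timeMap g lam μ α
      = ∫ v in (0 : ℝ)..α, slowness (energyAt g lam μ α - energyAt g lam μ v) := by
    have := intervalIntegral.mul_integral_comp_mul_left (a := 0) (b := 1)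
      (f := fun v => slowness (energyAt g lam μ α - energyAt g lam μ v)) α
    rw [mul_zero, mul_one] at this
    rw [← this, ← intervalIntegral.integral_const_mul]
    unfold timeMap
    simp only [gap_eq_energy]
  rw [e]
  unfold clock
  rw [intervalIntegral.integral_of_le h.pos.le, intervalIntegral.integral_of_le h.pos.le,
    MeasureTheory.integral_Ioc_eq_integral_Ioo, MeasureTheory.integral_Ioc_eq_integral_Ioo]
  refine MeasureTheory.setIntegral_congr_fun measurableSet_Ioo fun v hv => ?_
  simp only [rate, if_pos hv]

theorem clock_sub (hg : IsHump g σ) (h : Admissible g σ lam μ α) (hμ : 0 ≤ μ) (v w : ℝ) :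
    clock g lam μ α v - clock g lam μ α w = ∫ t in v..w, rate g lam μ α t :=
  sub_eq_iff_eq_add.2 (intervalIntegral.integral_add_adjacent_intervals
    (h.intervalIntegrable_rate hg hμ _ _) (h.intervalIntegrable_rate hg hμ _ _)).symm

theorem sub_le_clock_sub (hg : IsHump g σ) (h : Admissible g σ lam μ α) (hμ : 0 ≤ μ) {v w : ℝ}
    (hvw : v ≤ w) : w - v ≤ clock g lam μ α v - clock g lam μ α w := by
  rw [h.clock_sub hg hμ]
  have := intervalIntegral.integral_mono_on hvw (f := fun _ => (1 : ℝ)) (by simp)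
    (h.intervalIntegrable_rate hg hμ v w) fun t _ => h.one_le_rate hg hμ t
  simpa using this

theorem clock_strictAnti (hg : IsHump g σ) (h : Admissible g σ lam μ α) (hμ : 0 ≤ μ) :
    StrictAnti (clock g lam μ α) := by
  intro v w hvw
  have := h.sub_le_clock_sub hg hμ hvw.le
  linarith

theorem continuous_clock (hg : IsHump g σ) (h : Admissible g σ lam μ α) (hμ : 0 ≤ μ) :
    Continuous (clock g lam μ α) := by
  have := (intervalIntegral.continuous_primitive
    (h.intervalIntegrable_rate hg hμ) α).neg
  refine this.congr fun v => ?_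
  rw [clock, intervalIntegral.integral_symm, Pi.neg_apply]

theorem hasDerivAt_clock (hg : IsHump g σ) (h : Admissible g σ lam μ α) (hμ : 0 ≤ μ) {v : ℝ}
    (hv : v ∈ Ioo 0 α) :
    HasDerivAt (clock g lam μ α) (-slowness (energyAt g lam μ α - energyAt g lam μ v)) v := by
  have hev : rate g lam μ α =ᶠ[𝓝 v]
      fun v => slowness (energyAt g lam μ α - energyAt g lam μ v) := by
    filter_upwards [Ioo_mem_nhds hv.1 hv.2] with w hw
    simp only [rate, if_pos hw]
  have hc : ContinuousAt (fun v => slowness (energyAt g lam μ α - energyAt g lam μ v)) v :=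
    ContinuousAt.comp (g := slowness)
      (continuousOn_slowness.continuousAt (Ioi_mem_nhds (sub_pos.2 (h.energy_lt hg hμ hv))))
      (continuousAt_const.sub (hg.continuous_energy lam μ).continuousAt)
  have hc' : ContinuousAt (rate g lam μ α) v := hc.congr hev.symm
  have hmeas : StronglyMeasurableAtFilter (rate g lam μ α) (𝓝 v) := by
    refine ⟨Ioo 0 α, Ioo_mem_nhds hv.1 hv.2, ?_⟩
    have := (h.intervalIntegrable_rate hg hμ 0 α).1.aestronglyMeasurable
    exact this.mono_set Ioo_subset_Ioc_self
  have := intervalIntegral.integral_hasDerivAt_left (h.intervalIntegrable_rate hg hμ v α)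
    hmeas hc'
  rwa [hev.eq_of_nhds] at this

/-- `rate` is at least 1 everywhere, also outside (0, α), so the clock is a decreasing bijection of
the whole line and its inverse needs no domain restriction. -/
theorem clock_surjective (hg : IsHump g σ) (h : Admissible g σ lam μ α) (hμ : 0 ≤ μ) :
    Function.Surjective (clock g lam μ α) := by
  apply (h.continuous_clock hg hμ).surjective'
  · refine tendsto_atTop_mono' _ ?_ (tendsto_neg_atBot_atTop.atTop_add
      (tendsto_const_nhds (x := α)))
    filter_upwards [eventually_le_atBot α] with v hv
    have := h.sub_le_clock_sub hg hμ hv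
    rw [clock_top] at this
    linarith
  · refine tendsto_atBot_mono' _ ?_ (tendsto_neg_atTop_atBot.atBot_add
      (tendsto_const_nhds (x := α)))
    filter_upwards [eventually_ge_atTop α] with v hv
    have := h.sub_le_clock_sub hg hμ hv
    rw [clock_top] at this
    linarith

end Admissible

end MinkowskiHarvest

namespace MinkowskiHarvest

variable {g : ℝ → ℝ} {σ : ℝ}

/-! ### Existence of a solution of given amplitude -/

/-- Needed at the maximum of the solution: the derivative of the clock is only available below
height α, so the inverse function rule does not reach that point. -/
theorem hasDerivAt_of_hasDerivAt_of_punctured {f h : ℝ → ℝ} {x : ℝ} {s : Set ℝ} (hs : s ∈ 𝓝 x)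
    (hd : ∀ y ∈ s, y ≠ x → HasDerivAt f (h y) y) (hf : ContinuousAt f x)
    (hh : ContinuousAt h x) : HasDerivAt f (h x) x := by
  have A : HasDerivWithinAt f (h x) (Ici x) x := by
    refine hasDerivWithinAt_Ici_of_tendsto_deriv (s := s ∩ Ioi x) ?_ hf.continuousWithinAt
      (inter_mem (mem_nhdsWithin_of_mem_nhds hs) self_mem_nhdsWithin) ?_
    · exact fun y hy => (hd y hy.1 (ne_of_gt hy.2)).differentiableAt.differentiableWithinAt
    · refine (hh.tendsto.mono_left nhdsWithin_le_nhds).congr' ?_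
      filter_upwards [mem_nhdsWithin_of_mem_nhds hs, self_mem_nhdsWithin] with y h1 h2
      exact (hd y h1 (ne_of_gt h2)).deriv.symm
  have B : HasDerivWithinAt f (h x) (Iic x) x := by
    refine hasDerivWithinAt_Iic_of_tendsto_deriv (s := s ∩ Iio x) ?_ hf.continuousWithinAt
      (inter_mem (mem_nhdsWithin_of_mem_nhds hs) self_mem_nhdsWithin) ?_
    · exact fun y hy => (hd y hy.1 (ne_of_lt hy.2)).differentiableAt.differentiableWithinAt
    · refine (hh.tendsto.mono_left nhdsWithin_le_nhds).congr' ?_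
      filter_upwards [mem_nhdsWithin_of_mem_nhds hs, self_mem_nhdsWithin] with y h1 h2
      exact (hd y h1 (ne_of_lt h2)).deriv.symm
  simpa using B.union A

/-- The inverse of `p ↦ p / √(1 - p²)`. -/
noncomputable def velocity (w : ℝ) : ℝ := w / Real.sqrt (1 + w ^ 2)

theorem velocity_neg (w : ℝ) : velocity (-w) = -velocity w := by
  unfold velocity; rw [neg_sq, neg_div]

theorem abs_velocity_lt_one (w : ℝ) : |velocity w| < 1 := by
  unfold velocity
  have h : 0 < Real.sqrt (1 + w ^ 2) := Real.sqrt_pos.2 (by positivity)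
  rw [abs_div, abs_of_pos h, div_lt_one h]
  apply Real.lt_sqrt_of_sq_lt
  rw [sq_abs]
  linarith

theorem velocity_div_sqrt (w : ℝ) : velocity w / Real.sqrt (1 - velocity w ^ 2) = w := by
  have h : 0 < 1 + w ^ 2 := by positivity
  have e : 1 - velocity w ^ 2 = 1 / (1 + w ^ 2) := by
    unfold velocity
    rw [div_pow, Real.sq_sqrt h.le]
    field_simp
    ring
  rw [e, Real.sqrt_div zero_le_one, Real.sqrt_one, velocity]
  have : 0 < Real.sqrt (1 + w ^ 2) := Real.sqrt_pos.2 h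
  field_simp

theorem contDiff_velocity : ContDiff ℝ 2 velocity := by
  unfold velocity
  apply ContDiff.div contDiff_id
  · exact ContDiff.sqrt (by fun_prop) fun x => by positivity
  · intro x
    have : 0 < 1 + x ^ 2 := by positivity
    positivity

theorem velocity_sqrt {d : ℝ} (hd : 0 < d) :
    velocity (Real.sqrt (d * (d + 2))) = 1 / slowness d := by
  unfold velocity slowness
  rw [Real.sq_sqrt (by positivity), show 1 + d * (d + 2) = (1 + d) ^ 2 by ring,
    Real.sqrt_sq (by positivity), one_div_div]

/-- A function whose derivative is `velocity W`, where `W' = μ - lam g(u)`, solves the equation. -/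
theorem IsHump.isPositiveSolution_of_hasDerivAt (hg : IsHump g σ) {L μ lam : ℝ} {u W : ℝ → ℝ}
    (hc : ContinuousOn u (Icc (-L) L))
    (hu : ∀ x ∈ Ioo (-L) L, HasDerivAt u (velocity (W x)) x)
    (hW : ∀ x ∈ Ioo (-L) L, HasDerivAt W (-(lam * g (u x) - μ)) x)
    (hl : u (-L) = 0) (hr : u L = 0) (hpos : ∀ x ∈ Ioo (-L) L, 0 < u x) :
    IsPositiveSolution g L μ lam u := by
  have hdu : ∀ x ∈ Ioo (-L) L, deriv u x = velocity (W x) := fun x hx => (hu x hx).deriv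
  refine ⟨hc, ?_, fun x hx => ?_, fun x hx => ?_, hl, hr, hpos⟩
  · rw [show (2 : WithTop ℕ∞) = 1 + 1 by norm_num, contDiffOn_succ_iff_deriv_of_isOpen isOpen_Ioo]
    refine ⟨fun x hx => (hu x hx).differentiableAt.differentiableWithinAt, by simp, ?_⟩
    have hW1 : ContDiffOn ℝ 1 W (Ioo (-L) L) := by
      rw [show (1 : WithTop ℕ∞) = 0 + 1 by norm_num,
        contDiffOn_succ_iff_deriv_of_isOpen isOpen_Ioo]
      refine ⟨fun x hx => (hW x hx).differentiableAt.differentiableWithinAt, by simp, ?_⟩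
      rw [contDiffOn_zero]
      have : ContinuousOn (fun x => -(lam * g (u x) - μ)) (Ioo (-L) L) :=
        ((continuousOn_const.mul (hg.continuous.comp_continuousOn
          (hc.mono Ioo_subset_Icc_self))).sub continuousOn_const).neg
      exact this.congr fun x hx => (hW x hx).deriv
    exact ((contDiff_velocity.of_le (by norm_num)).comp_contDiffOn hW1).congr hdu
  · rw [hdu x hx]
    exact abs_velocity_lt_one _
  · have hev : (fun y => deriv u y / Real.sqrt (1 - deriv u y ^ 2)) =ᶠ[𝓝 x] W := by
      filter_upwards [Ioo_mem_nhds hx.1 hx.2] with y hy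
      rw [hdu y hy, velocity_div_sqrt]
    rw [hev.deriv_eq, (hW x hx).deriv, neg_neg]

theorem Admissible.exists_inverse_clock (hg : IsHump g σ) {lam μ α : ℝ}
    (h : Admissible g σ lam μ α) (hμ : 0 ≤ μ) :
    ∃ V : ℝ → ℝ, Continuous V ∧ StrictAnti V ∧ (∀ y, clock g lam μ α (V y) = y) ∧
      ∀ v, V (clock g lam μ α v) = v := by
  have hmono : StrictMono fun v => -clock g lam μ α v := (h.clock_strictAnti hg hμ).neg
  have hsurj : Function.Surjective fun v => -clock g lam μ α v :=
    neg_surjective.comp (h.clock_surjective hg hμ)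
  set e := StrictMono.orderIsoOfSurjective _ hmono hsurj
  have h1 : ∀ y, clock g lam μ α (e.symm (-y)) = y := fun y =>
    neg_injective (StrictMono.orderIsoOfSurjective_self_symm_apply _ hmono hsurj (-y))
  refine ⟨fun y => e.symm (-y), e.symm.continuous.comp continuous_neg,
    fun x y hxy => e.symm.strictMono (neg_lt_neg hxy), h1, fun v =>
    (h.clock_strictAnti hg hμ).injective (h1 _)⟩

theorem supNorm_eq {L : ℝ} {u : ℝ → ℝ} {x₀ : ℝ} (hx₀ : x₀ ∈ Icc (-L) L)
    (h : ∀ x ∈ Icc (-L) L, |u x| ≤ u x₀) : supNorm L u = u x₀ := by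
  have h0 : |u x₀| = u x₀ := le_antisymm (h x₀ hx₀) (le_abs_self _)
  have : IsGreatest ((fun x => |u x|) '' Icc (-L) L) (u x₀) :=
    ⟨⟨x₀, hx₀, h0⟩, by rintro _ ⟨x, hx, rfl⟩; exact h x hx⟩
  exact this.csSup_eq

/-- The solution is V(|x|), where V inverts the clock. Its momentum u'/√(1 - u'²) has absolute value
√(d(d + 2)) for the energy gap d; the first-order system for u and the momentum holds for x ≠ 0 and
extends to 0 by continuity. -/
theorem exists_isPositiveSolution (hg : IsHump g σ) {L μ lam α : ℝ} (hμ : 0 ≤ μ)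
    (h : (lam, α) ∈ timeCurve g σ L μ) :
    ∃ u, IsPositiveSolution g L μ lam u ∧ supNorm L u = α := by
  obtain ⟨hadm, ht⟩ := h
  simp only at hadm ht
  have hα := hadm.pos
  have hL : 0 < L := by rw [← ht]; exact hα.trans (hadm.lt_timeMap hg hμ)
  obtain ⟨V, hVc, hVa, hV1, hV2⟩ := hadm.exists_inverse_clock hg hμ
  have hV0 : V 0 = α := by rw [← Admissible.clock_top (g := g) (lam := lam) (μ := μ), hV2]
  have hVL : V L = 0 := by rw [← ht, ← hadm.clock_zero, hV2]
  have hVmem : ∀ y ∈ Ioo 0 L, V y ∈ Ioo 0 α := fun y hy =>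
    ⟨hVL ▸ hVa hy.2, hV0 ▸ hVa hy.1⟩
  set d : ℝ → ℝ := fun y => energyAt g lam μ α - energyAt g lam μ (V y) with hd
  have hdc : Continuous d := continuous_const.sub ((hg.continuous_energy lam μ).comp hVc)
  have hdpos : ∀ y ∈ Ioo 0 L, 0 < d y := fun y hy =>
    sub_pos.2 (hadm.energy_lt hg hμ (hVmem y hy))
  set S : ℝ → ℝ := fun y => Real.sqrt (d y * (d y + 2)) with hS
  have hSc : Continuous S := Real.continuous_sqrt.comp (by fun_prop)
  have hS0 : S 0 = 0 := by simp [hS, hd, hV0]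
  have dV : ∀ y ∈ Ioo 0 L, HasDerivAt V (-velocity (S y)) y := by
    intro y hy
    have := HasDerivAt.of_local_left_inverse hVc.continuousAt
      (hadm.hasDerivAt_clock hg hμ (hVmem y hy)) (neg_ne_zero.2 (slowness_pos (hdpos y hy)).ne')
      (Eventually.of_forall hV1)
    refine this.congr_deriv ?_
    rw [velocity_sqrt (hdpos y hy), inv_neg, one_div]
  have dS : ∀ y ∈ Ioo 0 L, HasDerivAt S (lam * g (V y) - μ) y := by
    intro y hy
    have hp := hdpos y hy
    have h1 : HasDerivAt d (-((lam * g (V y) - μ) * -velocity (S y))) y :=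
      ((hg.hasDerivAt_energy lam μ (V y)).comp y (dV y hy)).const_sub _
    have h2 := (h1.mul (h1.add_const 2)).sqrt (by simp only [Pi.mul_apply]; positivity)
    refine h2.congr_deriv ?_
    rw [velocity_sqrt hp]
    unfold slowness
    simp only [Pi.mul_apply]
    generalize d y = D at *
    have h3 : 0 < Real.sqrt (D * (D + 2)) := Real.sqrt_pos.2 (by positivity)
    field_simp
    ring
  -- The momentum is odd: positive while u rises on the left, negative on the right.
  set W : ℝ → ℝ := fun x => if 0 ≤ x then -S x else S (-x) with hWdef
  have hWabs : ∀ x, ‖W x‖ ≤ S |x| := by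
    intro x
    have hn : ∀ y, 0 ≤ S y := fun y => Real.sqrt_nonneg _
    simp only [hWdef, Real.norm_eq_abs]
    split_ifs with hx
    · rw [abs_neg, abs_of_nonneg (hn _), abs_of_nonneg hx]
    · rw [abs_of_nonneg (hn _), abs_of_neg (not_le.1 hx)]
  have hW0 : W 0 = 0 := by simp [hWdef, hS0]
  have hWc : ContinuousAt W 0 := by
    rw [ContinuousAt, hW0]
    refine squeeze_zero_norm hWabs ?_
    have : Tendsto (fun x : ℝ => S |x|) (𝓝 0) (𝓝 (S |0|)) :=
      (hSc.comp continuous_abs).tendsto 0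
    rwa [abs_zero, hS0] at this
  set u : ℝ → ℝ := fun x => V |x| with hu
  have huc : Continuous u := hVc.comp continuous_abs
  have hI : Ioo (-L) L ∈ 𝓝 (0 : ℝ) := Ioo_mem_nhds (neg_lt_zero.2 hL) hL
  have hne : ∀ x ∈ Ioo (-L) L, x ≠ 0 → HasDerivAt u (velocity (W x)) x ∧
      HasDerivAt W (-(lam * g (u x) - μ)) x := by
    intro x hx hx0
    rcases lt_or_gt_of_ne hx0 with hneg | hpos
    · have hy : -x ∈ Ioo 0 L := ⟨by linarith, by linarith [hx.1]⟩
      have e1 : u =ᶠ[𝓝 x] fun x => V (-x) := by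
        filter_upwards [Iio_mem_nhds hneg] with y hy
        simp only [hu, abs_of_neg (mem_Iio.1 hy)]
      have e2 : W =ᶠ[𝓝 x] fun x => S (-x) := by
        filter_upwards [Iio_mem_nhds hneg] with y hy
        simp only [hWdef, if_neg (not_le.2 (mem_Iio.1 hy))]
      constructor
      · refine (((dV _ hy).comp x (hasDerivAt_neg x)).congr_deriv ?_).congr_of_eventuallyEq e1
        rw [e2.eq_of_nhds]; ring
      · refine (((dS _ hy).comp x (hasDerivAt_neg x)).congr_deriv ?_).congr_of_eventuallyEq e2
        rw [e1.eq_of_nhds]; ring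
    · have hy : x ∈ Ioo 0 L := ⟨hpos, hx.2⟩
      have e1 : u =ᶠ[𝓝 x] V := by
        filter_upwards [Ioi_mem_nhds hpos] with y hy
        simp only [hu, abs_of_pos (mem_Ioi.1 hy)]
      have e2 : W =ᶠ[𝓝 x] fun x => -S x := by
        filter_upwards [Ioi_mem_nhds hpos] with y hy
        simp only [hWdef, if_pos (mem_Ioi.1 hy).le]
      constructor
      · refine ((dV _ hy).congr_deriv ?_).congr_of_eventuallyEq e1
        rw [e2.eq_of_nhds, velocity_neg]
      · refine ((dS _ hy).neg.congr_deriv ?_).congr_of_eventuallyEq e2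
        rw [e1.eq_of_nhds]
  have hall : ∀ x ∈ Ioo (-L) L, HasDerivAt u (velocity (W x)) x ∧
      HasDerivAt W (-(lam * g (u x) - μ)) x := by
    intro x hx
    rcases eq_or_ne x 0 with rfl | hx0
    · constructor
      · exact hasDerivAt_of_hasDerivAt_of_punctured (h := fun x => velocity (W x)) hI
          (fun y hy hy0 => (hne y hy hy0).1) huc.continuousAt
          (contDiff_velocity.continuous.continuousAt.comp hWc)
      · have hc := hg.continuous
        exact hasDerivAt_of_hasDerivAt_of_punctured (h := fun x => -(lam * g (u x) - μ)) hI
          (fun y hy hy0 => (hne y hy hy0).2) hWc (Continuous.continuousAt (by fun_prop))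
    · exact hne x hx hx0
  have habs : ∀ x ∈ Ioo (-L) L, |x| < L := fun x hx => abs_lt.2 hx
  refine ⟨u, hg.isPositiveSolution_of_hasDerivAt huc.continuousOn (fun x hx => (hall x hx).1)
    (fun x hx => (hall x hx).2) ?_ ?_ ?_, ?_⟩
  · simp only [hu, abs_neg, abs_of_pos hL, hVL]
  · simp only [hu, abs_of_pos hL, hVL]
  · intro x hx
    have := hVa (habs x hx)
    rwa [hVL] at this
  · have hu0 : u 0 = α := by simp [hu, hV0]
    rw [← hu0]
    refine supNorm_eq ⟨by linarith, hL.le⟩ fun x hx => ?_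
    have h1 : 0 ≤ u x := by
      have := hVa.antitone (abs_le.2 hx)
      rwa [hVL] at this
    rw [abs_of_nonneg h1, hu0, ← hV0]
    exact hVa.antitone (abs_nonneg x)

end MinkowskiHarvest

namespace MinkowskiHarvest

variable {g : ℝ → ℝ} {σ : ℝ}

/-! ### Every positive solution is given by the quadrature formula -/

namespace IsPositiveSolution

variable {L μ lam : ℝ} {u : ℝ → ℝ}

theorem hasDerivAt (h : IsPositiveSolution g L μ lam u) {x : ℝ} (hx : x ∈ Ioo (-L) L) :
    HasDerivAt u (deriv u x) x :=
  ((h.contDiffOn.contDiffAt (Ioo_mem_nhds hx.1 hx.2)).differentiableAt (by norm_num)).hasDerivAt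

theorem hasDerivAt_deriv (h : IsPositiveSolution g L μ lam u) {x : ℝ} (hx : x ∈ Ioo (-L) L) :
    HasDerivAt (deriv u) (deriv (deriv u) x) x := by
  have h1 : ContDiffOn ℝ 1 (deriv u) (Ioo (-L) L) := by
    have := h.contDiffOn
    rw [show (2 : WithTop ℕ∞) = 1 + 1 by norm_num,
      contDiffOn_succ_iff_deriv_of_isOpen isOpen_Ioo] at this
    exact this.2.2
  exact ((h1.contDiffAt (Ioo_mem_nhds hx.1 hx.2)).differentiableAt (by norm_num)).hasDerivAt

theorem one_sub_sq_pos (h : IsPositiveSolution g L μ lam u) {x : ℝ} (hx : x ∈ Ioo (-L) L) :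
    0 < 1 - deriv u x ^ 2 := by
  have := (sq_lt_one_iff_abs_lt_one _).2 (h.slope x hx)
  linarith

/-- This is the equation multiplied by u'. With p = u' and r = √(1 - p²), (1/r)' = p p'/r³ = p
(p/r)', and (p/r)' + f(u) = 0. -/
theorem hasDerivAt_first_integral (hg : IsHump g σ) (h : IsPositiveSolution g L μ lam u) {x : ℝ}
    (hx : x ∈ Ioo (-L) L) :
    HasDerivAt (fun y => 1 / Real.sqrt (1 - deriv u y ^ 2) + energyAt g lam μ (u y)) 0 x := by
  have hp := h.hasDerivAt_deriv hx
  have hpos := h.one_sub_sq_pos hx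
  have hr : 0 < Real.sqrt (1 - deriv u x ^ 2) := Real.sqrt_pos.2 hpos
  have hr2 : Real.sqrt (1 - deriv u x ^ 2) ^ 2 = 1 - deriv u x ^ 2 := Real.sq_sqrt hpos.le
  have d1 := ((hp.pow 2).const_sub 1).sqrt hpos.ne'
  have d2 := hp.div d1 hr.ne'
  have d3 := (hasDerivAt_const x (1 : ℝ)).div d1 hr.ne'
  have d4 := (hg.hasDerivAt_energy lam μ (u x)).comp x (h.hasDerivAt hx)
  have e := h.equation x hx
  have e2 := d2.deriv
  refine (d3.add d4).congr_deriv ?_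
  rw [← e]
  erw [e2]
  generalize Real.sqrt (1 - deriv u x ^ 2) = r at *
  generalize deriv (deriv u) x = p' at *
  generalize deriv u x = p at *
  simp
  field_simp
  linear_combination (-(p * p')) * hr2

theorem exists_isMaxOn (h : IsPositiveSolution g L μ lam u) (hL : 0 < L) :
    ∃ x₀ ∈ Ioo (-L) L, ∀ x ∈ Icc (-L) L, u x ≤ u x₀ := by
  obtain ⟨x₀, hx₀, hmax⟩ := isCompact_Icc.exists_isMaxOn (nonempty_Icc.2 (by linarith))
    h.continuousOn
  have h0 : 0 < u x₀ := (h.pos 0 ⟨by linarith, hL⟩).trans_le (hmax ⟨by linarith, hL.le⟩)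
  refine ⟨x₀, ⟨lt_of_le_of_ne hx₀.1 ?_, lt_of_le_of_ne hx₀.2 ?_⟩, fun x hx => hmax hx⟩
  · rintro rfl; exact h0.ne' h.left
  · rintro rfl; exact h0.ne' h.right

theorem nonneg (h : IsPositiveSolution g L μ lam u) {x : ℝ} (hx : x ∈ Icc (-L) L) : 0 ≤ u x := by
  rcases eq_or_lt_of_le hx.1 with rfl | h1
  · exact h.left.ge
  rcases eq_or_lt_of_le hx.2 with rfl | h2
  · exact h.right.ge
  exact (h.pos x ⟨h1, h2⟩).le

theorem supNorm_eq_of_isMax (h : IsPositiveSolution g L μ lam u) {x₀ : ℝ} (hx₀ : x₀ ∈ Ioo (-L) L)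
    (hmax : ∀ x ∈ Icc (-L) L, u x ≤ u x₀) : supNorm L u = u x₀ :=
  supNorm_eq (Ioo_subset_Icc_self hx₀) fun x hx => by
    rw [abs_of_nonneg (h.nonneg hx)]; exact hmax x hx

theorem deriv_eq_zero_of_isMax {x₀ : ℝ}
    (hx₀ : x₀ ∈ Ioo (-L) L) (hmax : ∀ x ∈ Icc (-L) L, u x ≤ u x₀) : deriv u x₀ = 0 := by
  have : IsLocalMax u x₀ := by
    filter_upwards [Icc_mem_nhds hx₀.1 hx₀.2] with x hx using hmax x hx
  exact this.deriv_eq_zero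

/-- Conservation of energy, normalized at the maximum. -/
theorem energy_le_and_sq_eq (hg : IsHump g σ) (h : IsPositiveSolution g L μ lam u) {x₀ : ℝ}
    (hx₀ : x₀ ∈ Ioo (-L) L) (hmax : ∀ x ∈ Icc (-L) L, u x ≤ u x₀) {x : ℝ} (hx : x ∈ Ioo (-L) L) :
    energyAt g lam μ (u x) ≤ energyAt g lam μ (u x₀) ∧
      (1 + (energyAt g lam μ (u x₀) - energyAt g lam μ (u x))) ^ 2 * deriv u x ^ 2 =
        (energyAt g lam μ (u x₀) - energyAt g lam μ (u x)) *
          ((energyAt g lam μ (u x₀) - energyAt g lam μ (u x)) + 2) := by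
  have hconst := isOpen_Ioo.is_const_of_deriv_eq_zero (isPreconnected_Ioo (a := -L) (b := L))
    (fun y hy => (h.hasDerivAt_first_integral hg hy).differentiableAt.differentiableWithinAt)
    (fun y hy => (h.hasDerivAt_first_integral hg hy).deriv) hx hx₀
  simp only [deriv_eq_zero_of_isMax hx₀ hmax] at hconst
  have hpos := h.one_sub_sq_pos hx
  have hr : 0 < Real.sqrt (1 - deriv u x ^ 2) := Real.sqrt_pos.2 hpos
  have hr2 : Real.sqrt (1 - deriv u x ^ 2) ^ 2 = 1 - deriv u x ^ 2 := Real.sq_sqrt hpos.le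
  have hr1 : Real.sqrt (1 - deriv u x ^ 2) ≤ 1 :=
    Real.sqrt_le_one.2 (by linarith [sq_nonneg (deriv u x)])
  have hone : Real.sqrt (1 - (0 : ℝ) ^ 2) = 1 := by simp
  rw [hone] at hconst
  generalize energyAt g lam μ (u x₀) = A at *
  generalize energyAt g lam μ (u x) = B at *
  generalize Real.sqrt (1 - deriv u x ^ 2) = r at *
  have e : 1 + (A - B) = 1 / r := by linarith
  have h1 : 1 ≤ 1 / r := (one_le_div hr).2 hr1
  refine ⟨by linarith, ?_⟩
  have e2 : (1 + (A - B)) ^ 2 * r ^ 2 = 1 := by rw [e]; field_simp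
  rw [hr2] at e2
  linarith

theorem force_nonneg (hg : IsHump g σ) {α : ℝ} (hα : 0 < α)
    (hE : ∀ v ∈ Ioc 0 α, energyAt g lam μ v ≤ energyAt g lam μ α) : 0 ≤ lam * g α - μ := by
  have h1 := (hasDerivWithinAt_iff_tendsto_slope' (notMem_Iio.2 le_rfl)).1
    ((hg.hasDerivAt_energy lam μ α).hasDerivWithinAt (s := Iio α))
  refine ge_of_tendsto h1 ?_
  filter_upwards [Ioo_mem_nhdsLT hα] with v hv
  rw [slope_def_field]
  exact div_nonneg_of_nonpos (by linarith [hE v ⟨hv.1, hv.2.le⟩]) (by linarith [hv.2])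

/-- The amplitude of a positive solution is admissible. -/
theorem admissible (hg : IsHump g σ) (h : IsPositiveSolution g L μ lam u) (hμ : 0 < μ)
    (hlam : 0 < lam) {x₀ : ℝ} (hx₀ : x₀ ∈ Ioo (-L) L)
    (hmax : ∀ x ∈ Icc (-L) L, u x ≤ u x₀) : Admissible g σ lam μ (u x₀) := by
  have hα := h.pos x₀ hx₀
  have hsub : Icc x₀ L ⊆ Icc (-L) L := Icc_subset_Icc_left hx₀.1.le
  -- Every height in (0, u x₀] is attained to the right of x₀, so the energy inequality along the
  -- solution holds at all heights.
  have hE : ∀ v ∈ Ioc 0 (u x₀), energyAt g lam μ v ≤ energyAt g lam μ (u x₀) := by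
    intro v hv
    obtain ⟨x, hx, rfl⟩ : v ∈ u '' Icc x₀ L :=
      intermediate_value_Icc' hx₀.2.le (h.continuousOn.mono hsub) ⟨h.right.trans_le hv.1.le, hv.2⟩
    have hxL : x ≠ L := by rintro rfl; exact hv.1.ne' h.right
    exact (h.energy_le_and_sq_eq hg hx₀ hmax ⟨hx₀.1.trans_le hx.1, lt_of_le_of_ne hx.2 hxL⟩).1
  have hE0 : energyAt g lam μ 0 ≤ energyAt g lam μ (u x₀) := by
    refine le_of_tendsto ((hg.continuous_energy lam μ).continuousWithinAt (s := Ioi 0) (x := 0)) ?_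
    filter_upwards [Ioc_mem_nhdsGT hα] with v hv using hE v hv
  have hf := force_nonneg hg hα hE
  have hgα : 0 < g (u x₀) := by
    by_contra hneg
    nlinarith [mul_nonneg hlam.le (sub_nonneg.2 (not_lt.1 hneg))]
  have hασ : u x₀ < σ := by
    by_contra hle
    rcases eq_or_lt_of_le (not_lt.1 hle) with heq | hlt
    · rw [← heq, hg.map_sigma] at hgα; exact lt_irrefl _ hgα
    · exact hgα.not_ge (hg.nonpos _ hlt)
  refine ⟨hα, hασ, ?_, ?_⟩
  · simp only [energyAt, potential_zero] at hE0
    linarith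
  rcases eq_or_lt_of_le hf with heq | hlt
  swap
  · linarith
  -- If f(α) = 0, the gap is at most K(α - u)², hence |u'| ≤ √(2K)(α - u). Gronwall's inequality
  -- from x₀ keeps u = α up to L, against u(L) = 0.
  exfalso
  set α := u x₀ with hαdef
  set K := lam * (g α / (σ - α)) with hK
  have hK0 : 0 ≤ K := by have := sub_pos.2 hασ; positivity
  have hquad : ∀ v ∈ Icc 0 α, energyAt g lam μ α - energyAt g lam μ v ≤ K * (α - v) ^ 2 := by
    intro v hv
    have := hg.potential_sub_scaled_le hα hασ (s := v / α)
      ⟨div_nonneg hv.1 hα.le, (div_le_one hα).2 hv.2⟩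
    have e : α * (1 - v / α) = α - v := by field_simp
    rw [mul_div_cancel₀ _ hα.ne', e] at this
    have h2 := mul_le_mul_of_nonneg_left this hlam.le
    simp only [energyAt, hK]
    have h3 : lam * g α = μ := by linarith
    linear_combination h2 + (α - v) * h3
  have hz := eq_zero_of_abs_deriv_le_mul_abs_self_of_eq_zero_right (f := fun x => α - u x)
    (f' := fun x => -deriv u x) (K := Real.sqrt (2 * K)) (a := x₀) (b := L)
    (continuousOn_const.sub (h.continuousOn.mono hsub))
    (fun x hx => ((h.hasDerivAt ⟨hx₀.1.trans_le hx.1, hx.2⟩).const_sub α).hasDerivWithinAt)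
    (by simp [hαdef]) (fun x hx => ?_) L ⟨hx₀.2.le, le_rfl⟩
  · simp only [h.right] at hz
    linarith
  · have hx' : x ∈ Ioo (-L) L := ⟨hx₀.1.trans_le hx.1, hx.2⟩
    obtain ⟨hd, hsq⟩ := h.energy_le_and_sq_eq hg hx₀ hmax hx'
    have hv := hmax x (Ioo_subset_Icc_self hx')
    have hq := hquad (u x) ⟨(h.pos x hx').le, hv⟩
    rw [Real.norm_eq_abs, Real.norm_eq_abs, abs_neg, abs_of_nonneg (sub_nonneg.2 hv)]
    apply abs_le_of_sq_le_sq
    · rw [mul_pow, Real.sq_sqrt (by positivity)]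
      generalize energyAt g lam μ (u x) = B at *
      rw [← hαdef] at *
      generalize energyAt g lam μ α = A at *
      obtain ⟨d, hd'⟩ : ∃ d, d = A - B := ⟨_, rfl⟩
      rw [← hd'] at hsq hq
      have hd0 : 0 ≤ d := by linarith
      have h1 : deriv u x ^ 2 ≤ 2 * d := by
        nlinarith [sq_nonneg (deriv u x), mul_nonneg hd0 hd0, mul_nonneg hd0 (sq_nonneg d),
          mul_nonneg hd0 (sq_nonneg (deriv u x)),
          mul_nonneg (mul_nonneg hd0 hd0) (sq_nonneg (deriv u x))]
      linarith
    · exact mul_nonneg (Real.sqrt_nonneg _) (sub_nonneg.2 hv)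

/-- The maximum is attained only once. -/
theorem lt_of_ne (hg : IsHump g σ) (h : IsPositiveSolution g L μ lam u) (hμ : 0 ≤ μ) {x₀ : ℝ}
    (hx₀ : x₀ ∈ Ioo (-L) L) (hmax : ∀ x ∈ Icc (-L) L, u x ≤ u x₀)
    (hadm : Admissible g σ lam μ (u x₀)) {x : ℝ} (hx : x ∈ Ioo (-L) L) (hne : x ≠ x₀) :
    u x < u x₀ := by
  refine lt_of_le_of_ne (hmax x (Ioo_subset_Icc_self hx)) fun heq => ?_
  -- A lower minimum between two maximum points would be critical, contradicting the energy
  -- identity, where the gap is positive. So u is constant on [a, b], and the equation gives zero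
  -- force there.
  have key : ∀ a ∈ Ioo (-L) L, ∀ b ∈ Ioo (-L) L, a < b → u a = u x₀ → u b = u x₀ → False := by
    intro a ha b hb hab hua hub
    have hsub : Icc a b ⊆ Ioo (-L) L := fun y hy => ⟨ha.1.trans_le hy.1, hy.2.trans_lt hb.2⟩
    obtain ⟨y₀, hy₀, hmin⟩ := isCompact_Icc.exists_isMinOn (nonempty_Icc.2 hab.le)
      (h.continuousOn.mono (hsub.trans Ioo_subset_Icc_self))
    have hval : u y₀ = u x₀ := by
      by_contra hne0
      have hlt : u y₀ < u x₀ :=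
        lt_of_le_of_ne (hmax _ (Ioo_subset_Icc_self (hsub hy₀))) hne0
      have hya : y₀ ≠ a := by rintro rfl; exact hne0 hua
      have hyb : y₀ ≠ b := by rintro rfl; exact hne0 hub
      have hloc : IsLocalMin u y₀ := by
        filter_upwards [Icc_mem_nhds (lt_of_le_of_ne hy₀.1 hya.symm) (lt_of_le_of_ne hy₀.2 hyb)]
          with y hy using hmin hy
      have hsq := (h.energy_le_and_sq_eq hg hx₀ hmax (hsub hy₀)).2
      have hlt' := hadm.energy_lt hg hμ ⟨h.pos _ (hsub hy₀), hlt⟩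
      rw [hloc.deriv_eq_zero] at hsq
      nlinarith
    have hall : ∀ y ∈ Icc a b, u y = u x₀ := fun y hy =>
      le_antisymm (hmax _ (Ioo_subset_Icc_self (hsub hy))) (hval ▸ hmin hy)
    have hmid : (a + b) / 2 ∈ Ioo a b := ⟨by linarith, by linarith⟩
    have hzero : ∀ y ∈ Ioo a b, deriv u y = 0 := by
      intro y hy
      have : u =ᶠ[𝓝 y] fun _ => u x₀ := by
        filter_upwards [Icc_mem_nhds hy.1 hy.2] with z hz using hall z hz
      rw [this.deriv_eq, deriv_const]
    have hev : (fun y => deriv u y / Real.sqrt (1 - deriv u y ^ 2)) =ᶠ[𝓝 ((a + b) / 2)]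
        fun _ => 0 := by
      filter_upwards [Ioo_mem_nhds hmid.1 hmid.2] with y hy
      rw [hzero y hy, zero_div]
    have he := h.equation _ (hsub (Ioo_subset_Icc_self hmid))
    rw [hev.deriv_eq, deriv_const, hall _ (Ioo_subset_Icc_self hmid)] at he
    linarith [hadm.force]
  rcases lt_or_gt_of_ne hne with hlt | hgt
  · exact key x hx x₀ hx₀ hlt heq rfl
  · exact key x₀ hx₀ x hx hgt rfl heq

end IsPositiveSolution

/-- A function descending from `α` to `0` along the energy level is timed by the clock. -/
theorem Admissible.clock_eq_sub (hg : IsHump g σ) {lam μ α : ℝ} (h : Admissible g σ lam μ α)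
    (hμ : 0 ≤ μ) {a b : ℝ} {v q : ℝ → ℝ} (hab : a < b) (hc : ContinuousOn v (Icc a b))
    (hva : v a = α) (hvb : v b = 0) (hmem : ∀ x ∈ Ioo a b, v x ∈ Ioo 0 α)
    (hd : ∀ x ∈ Ioo a b, HasDerivAt v (q x) x)
    (hq : ∀ x ∈ Ioo a b, (1 + (energyAt g lam μ α - energyAt g lam μ (v x))) ^ 2 * q x ^ 2 =
      (energyAt g lam μ α - energyAt g lam μ (v x)) *
        ((energyAt g lam μ α - energyAt g lam μ (v x)) + 2)) {x : ℝ} (hx : x ∈ Icc a b) :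
    clock g lam μ α (v x) = x - a := by
  have hpos : ∀ x ∈ Ioo a b, 0 < energyAt g lam μ α - energyAt g lam μ (v x) := fun x hx =>
    sub_pos.2 (h.energy_lt hg hμ (hmem x hx))
  have hne : ∀ x ∈ Ioo a b, q x ≠ 0 := by
    intro x hx h0
    have h1 := hq x hx
    rw [h0] at h1
    nlinarith [hpos x hx]
  -- By Darboux a nonvanishing derivative has one sign, and the end values exclude the positive one.
  have hneg : ∀ x ∈ Ioo a b, q x < 0 := by
    rcases hasDerivWithinAt_forall_lt_or_forall_gt_of_forall_ne (convex_Ioo a b)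
      (fun x hx => (hd x hx).hasDerivWithinAt) hne with hlt | hgt
    · exact hlt
    · exfalso
      have : StrictMonoOn v (Icc a b) := strictMonoOn_of_deriv_pos (convex_Icc a b) hc
        fun x hx => by
          rw [interior_Icc] at hx
          rw [(hd x hx).deriv]; exact hgt x hx
      have := this (left_mem_Icc.2 hab.le) (right_mem_Icc.2 hab.le) hab
      rw [hva, hvb] at this
      exact this.not_gt h.pos
  have hclock : ∀ x ∈ Ioo a b, HasDerivAt (fun y => clock g lam μ α (v y)) 1 x := by
    intro x hx
    refine ((h.hasDerivAt_clock hg hμ (hmem x hx)).comp x (hd x hx)).congr_deriv ?_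
    have hD := hpos x hx
    have h1 := hq x hx
    have h2 := hneg x hx
    generalize energyAt g lam μ α - energyAt g lam μ (v x) = D at *
    unfold slowness
    have hr : Real.sqrt (D * (D + 2)) = -((1 + D) * q x) := by
      rw [← h1, ← mul_pow, ← neg_sq, Real.sqrt_sq]
      nlinarith
    rw [hr]
    have : 1 + D ≠ 0 := by positivity
    have := h2.ne
    field_simp
  rcases eq_or_lt_of_le hx.1 with rfl | hlt
  · rw [hva, Admissible.clock_top, sub_self]
  obtain ⟨c, hc', e⟩ := exists_hasDerivAt_eq_slope (fun y => clock g lam μ α (v y)) (fun _ => 1) hlt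
    ((h.continuous_clock hg hμ).comp_continuousOn (hc.mono (Icc_subset_Icc_right hx.2)))
    (fun y hy => hclock y ⟨hy.1, hy.2.trans_le hx.2⟩)
  have hne' : x - a ≠ 0 := (sub_pos.2 hlt).ne'
  rw [eq_div_iff hne', hva, Admissible.clock_top] at e
  linarith

/-- The clock times both descents from the maximum point x₀, the left one after reflection. Both
last `clock` 0, so L - x₀ = L + x₀ and x₀ = 0. -/
theorem IsPositiveSolution.mem_timeCurve_and_clock_eq (hg : IsHump g σ) {L μ lam : ℝ} {u : ℝ → ℝ}
    (h : IsPositiveSolution g L μ lam u) (hL : 0 < L) (hμ : 0 < μ) (hlam : 0 < lam) :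
    (lam, supNorm L u) ∈ timeCurve g σ L μ ∧
      ∀ x ∈ Icc (-L) L, clock g lam μ (supNorm L u) (u x) = |x| := by
  obtain ⟨x₀, hx₀, hmax⟩ := h.exists_isMaxOn hL
  have hadm := h.admissible hg hμ hlam hx₀ hmax
  have hright : ∀ x ∈ Icc x₀ L, clock g lam μ (u x₀) (u x) = x - x₀ := by
    have hin : ∀ x ∈ Ioo x₀ L, x ∈ Ioo (-L) L := fun x hx => ⟨hx₀.1.trans hx.1, hx.2⟩
    exact fun x hx => hadm.clock_eq_sub hg hμ.le hx₀.2
      (h.continuousOn.mono (Icc_subset_Icc_left hx₀.1.le)) rfl h.right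
      (fun x hx => ⟨h.pos x (hin x hx), h.lt_of_ne hg hμ.le hx₀ hmax hadm (hin x hx) hx.1.ne'⟩)
      (fun x hx => h.hasDerivAt (hin x hx))
      (fun x hx => (h.energy_le_and_sq_eq hg hx₀ hmax (hin x hx)).2) hx
  have hleft : ∀ x ∈ Icc (-x₀) L, clock g lam μ (u x₀) (u (-x)) = x - -x₀ := by
    have hin : ∀ x ∈ Ioo (-x₀) L, -x ∈ Ioo (-L) L := fun x hx =>
      ⟨neg_lt_neg hx.2, by linarith [hx.1, hx₀.2]⟩
    exact fun x hx => hadm.clock_eq_sub hg hμ.le (v := fun x => u (-x))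
      (q := fun x => -deriv u (-x)) (by linarith [hx₀.1])
      (h.continuousOn.comp continuousOn_neg fun x hx =>
        ⟨neg_le_neg hx.2, by linarith [hx.1, hx₀.2]⟩) (by simp) h.left
      (fun x hx => ⟨h.pos _ (hin x hx), h.lt_of_ne hg hμ.le hx₀ hmax hadm (hin x hx)
        (by linarith [hx.1])⟩)
      (fun x hx => ((h.hasDerivAt (hin x hx)).comp x (hasDerivAt_neg x)).congr_deriv (by ring))
      (fun x hx => by
        simpa only [neg_sq] using (h.energy_le_and_sq_eq hg hx₀ hmax (hin x hx)).2) hx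
  have h1 := hright L ⟨hx₀.2.le, le_rfl⟩
  have h2 := hleft L ⟨by linarith [hx₀.1], le_rfl⟩
  rw [h.right] at h1
  rw [h.left] at h2
  obtain rfl : x₀ = 0 := by linarith
  rw [h.supNorm_eq_of_isMax hx₀ hmax]
  refine ⟨⟨hadm, ?_⟩, fun x hx => ?_⟩
  · rw [← hadm.clock_zero, h1, sub_zero]
  · rcases le_total 0 x with hx0 | hx0
    · rw [hright x ⟨hx0, hx.2⟩, abs_of_nonneg hx0, sub_zero]
    · have := hleft (-x) ⟨by linarith, by linarith [hx.1]⟩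
      rw [neg_neg] at this
      rw [this, abs_of_nonpos hx0]; ring

theorem IsPositiveSolution.eqOn_of_supNorm_eq (hg : IsHump g σ) {L μ lam : ℝ} {u v : ℝ → ℝ}
    (hu : IsPositiveSolution g L μ lam u) (hv : IsPositiveSolution g L μ lam v) (hL : 0 < L)
    (hμ : 0 < μ) (hlam : 0 < lam) (h : supNorm L u = supNorm L v) : EqOn u v (Icc (-L) L) := by
  intro x hx
  obtain ⟨h1, h2⟩ := hu.mem_timeCurve_and_clock_eq hg hL hμ hlam
  have h3 := (hv.mem_timeCurve_and_clock_eq hg hL hμ hlam).2 x hx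
  rw [← h, ← h2 x hx] at h3
  exact ((h1.1.clock_strictAnti hg hμ.le).injective h3).symm

end MinkowskiHarvest

namespace MinkowskiHarvest

variable {g : ℝ → ℝ} {σ : ℝ}

/-! ### The bifurcation curve and the number of solutions -/

theorem bifurcationCurve_eq_timeCurve (hg : IsHump g σ) {L μ : ℝ} (hL : 0 < L) (hμ : 0 < μ) :
    bifurcationCurve g L μ = timeCurve g σ L μ := by
  ext ⟨lam, x⟩
  constructor
  · rintro ⟨hlam, u, hu, hx⟩
    simp only at hlam hu hx
    rw [← hx]
    exact (hu.mem_timeCurve_and_clock_eq hg hL hμ hlam).1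
  · intro h
    exact ⟨h.1.lam_pos hg hμ.le, exists_isPositiveSolution hg hμ.le h⟩

/-- The sup norm is a bijection from solutions to amplitudes on the curve: the clock recovers a
solution from its amplitude. -/
theorem encard_positiveSolutions (hg : IsHump g σ) {L μ lam : ℝ} (hL : 0 < L) (hμ : 0 < μ)
    (hlam : 0 < lam) :
    (positiveSolutions g L μ lam).encard = {x | (lam, x) ∈ timeCurve g σ L μ}.encard := by
  have hex : ∀ x, ∃ u, (lam, x) ∈ timeCurve g σ L μ →
      IsPositiveSolution g L μ lam u ∧ supNorm L u = x := by
    intro x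
    by_cases hx : (lam, x) ∈ timeCurve g σ L μ
    · obtain ⟨u, hu⟩ := exists_isPositiveSolution hg hμ.le hx
      exact ⟨u, fun _ => hu⟩
    · exact ⟨0, fun h => absurd h hx⟩
  choose U hU using hex
  have himage : positiveSolutions g L μ lam =
      (fun x (y : Icc (-L) L) => U x y) '' {x | (lam, x) ∈ timeCurve g σ L μ} := by
    ext φ
    constructor
    · rintro ⟨u, hu, rfl⟩
      have hmem := (hu.mem_timeCurve_and_clock_eq hg hL hμ hlam).1
      refine ⟨supNorm L u, hmem, funext fun y => ?_⟩
      exact (hU _ hmem).1.eqOn_of_supNorm_eq hg hu hL hμ hlam (hU _ hmem).2 y.2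
    · rintro ⟨x, hx, rfl⟩
      exact ⟨U x, (hU x hx).1, rfl⟩
  rw [himage, InjOn.encard_image]
  intro x hx y hy hxy
  rw [← (hU x hx).2, ← (hU y hy).2]
  unfold supNorm
  congr 1
  exact image_congr fun z hz => congrArg _ (congrFun hxy ⟨z, hz⟩)

namespace IsBranch

variable {L μ lamBar θ lamStar α : ℝ} {Λ : ℝ → ℝ}

theorem timeCurve_eq (hg : IsHump g σ) (h : IsBranch g σ L μ Λ lamBar θ lamStar α) :
    timeCurve g σ L μ = (fun x => (Λ x, x)) '' Ico θ (min σ L) := by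
  have hμ := (h.start.mu_pos hg).le
  ext ⟨lam, x⟩
  constructor
  · intro hc
    have hx : x ∈ Ico θ (min σ L) := ⟨h.start.le_of_mem hg hc, IsStart.lt_of_mem hg hμ hc⟩
    exact ⟨x, hx, by rw [timeCurve_unique hg hμ hc (h.mem x hx)]⟩
  · rintro ⟨y, hy, e⟩
    rw [← e]
    exact h.mem y hy

theorem isSubsetShaped (hg : IsHump g σ) (h : IsBranch g σ L μ Λ lamBar θ lamStar α) :
    IsSubsetShaped (timeCurve g σ L μ) (lamBar, θ) (lamStar, α) :=
  ⟨min σ L, Λ, h.lt_turn, h.turn_lt, h.cont, h.at_start, h.at_turn, h.anti, h.mono,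
    h.timeCurve_eq hg⟩

theorem mem_timeCurve_iff (hg : IsHump g σ) (h : IsBranch g σ L μ Λ lamBar θ lamStar α)
    {lam x : ℝ} : (lam, x) ∈ timeCurve g σ L μ ↔ x ∈ Ico θ (min σ L) ∧ Λ x = lam := by
  rw [h.timeCurve_eq hg]
  constructor
  · rintro ⟨y, hy, e⟩
    obtain ⟨h1, h2⟩ := Prod.mk.inj e
    rw [← h2]
    exact ⟨hy, h1⟩
  · rintro ⟨hx, rfl⟩
    exact ⟨x, hx, rfl⟩

theorem exists_right (h : IsBranch g σ L μ Λ lamBar θ lamStar α) {lam : ℝ} (hlam : lamStar < lam) :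
    ∃ x ∈ Ioo α (min σ L), Λ x = lam := by
  obtain ⟨a, ha, hb⟩ := h.blowup lam
  have hlt : max a α < min σ L := max_lt ha h.turn_lt
  obtain ⟨b, hb1, hb2⟩ := exists_between hlt
  have hαb : α < b := (le_max_right _ _).trans_lt hb1
  have hΛb := hb b ⟨(h.lt_turn.trans hαb).le, hb2⟩ ((le_max_left _ _).trans_lt hb1)
  have hsub : Icc α b ⊆ Ico θ (min σ L) := fun y hy =>
    ⟨h.lt_turn.le.trans hy.1, hy.2.trans_lt hb2⟩
  obtain ⟨x, hx, e⟩ := intermediate_value_Icc hαb.le (h.cont.mono hsub)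
    ⟨h.at_turn.trans_le hlam.le, hΛb.le⟩
  refine ⟨x, ⟨lt_of_le_of_ne hx.1 ?_, hx.2.trans_lt hb2⟩, e⟩
  rintro rfl
  exact hlam.ne (h.at_turn.symm.trans e)

theorem exists_left (h : IsBranch g σ L μ Λ lamBar θ lamStar α) {lam : ℝ} (hlam : lamStar < lam)
    (hle : lam ≤ lamBar) : ∃ x ∈ Ico θ α, Λ x = lam := by
  have hsub : Icc θ α ⊆ Ico θ (min σ L) := fun y hy => ⟨hy.1, hy.2.trans_lt h.turn_lt⟩
  obtain ⟨x, hx, e⟩ := intermediate_value_Icc' h.lt_turn.le (h.cont.mono hsub)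
    ⟨h.at_turn.trans_le hlam.le, h.at_start.symm ▸ hle⟩
  refine ⟨x, ⟨hx.1, lt_of_le_of_ne hx.2 ?_⟩, e⟩
  rintro rfl
  exact hlam.ne (h.at_turn.symm.trans e)

theorem encard_eq_zero (hg : IsHump g σ) (h : IsBranch g σ L μ Λ lamBar θ lamStar α) {lam : ℝ}
    (hlam : lam < lamStar) : {x | (lam, x) ∈ timeCurve g σ L μ}.encard = 0 := by
  rw [Set.encard_eq_zero, eq_empty_iff_forall_notMem]
  intro x hx
  obtain ⟨hx', rfl⟩ := (h.mem_timeCurve_iff hg).1 hx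
  by_cases hxα : x = α
  · rw [hxα, h.at_turn] at hlam
    exact lt_irrefl _ hlam
  · exact hlam.not_gt (h.turn_lt_of_ne x hx' hxα)

theorem encard_eq_one (hg : IsHump g σ) (h : IsBranch g σ L μ Λ lamBar θ lamStar α) {lam : ℝ}
    (hlam : lamBar < lam ∨ lam = lamStar) : {x | (lam, x) ∈ timeCurve g σ L μ}.encard = 1 := by
  rw [Set.encard_eq_one]
  rcases hlam with hlt | rfl
  · obtain ⟨x, hx, e⟩ := h.exists_right (h.lamStar_lt_lamBar.trans hlt)
    refine ⟨x, ?_⟩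
    ext y
    rw [mem_ofPred_eq, mem_singleton_iff, h.mem_timeCurve_iff hg]
    constructor
    · rintro ⟨hy, hye⟩
      rcases le_or_gt y α with hle | hgt
      · have := h.anti.antitoneOn ⟨le_rfl, h.lt_turn.le⟩ ⟨hy.1, hle⟩ hy.1
        rw [h.at_start, hye] at this
        exact absurd hlt this.not_gt
      · exact h.mono.injOn ⟨hgt.le, hy.2⟩ ⟨hx.1.le, hx.2⟩ (hye.trans e.symm)
    · rintro rfl
      exact ⟨⟨(h.lt_turn.trans hx.1).le, hx.2⟩, e⟩
  · refine ⟨α, ?_⟩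
    ext y
    rw [mem_ofPred_eq, mem_singleton_iff, h.mem_timeCurve_iff hg]
    constructor
    · rintro ⟨hy, hye⟩
      by_contra hne
      exact (h.turn_lt_of_ne y hy hne).ne' hye
    · rintro rfl
      exact ⟨h.turn_mem, h.at_turn⟩

theorem encard_eq_two (hg : IsHump g σ) (h : IsBranch g σ L μ Λ lamBar θ lamStar α) {lam : ℝ}
    (hlt : lamStar < lam) (hle : lam ≤ lamBar) :
    {x | (lam, x) ∈ timeCurve g σ L μ}.encard = 2 := by
  obtain ⟨x, hx, ex⟩ := h.exists_left hlt hle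
  obtain ⟨y, hy, ey⟩ := h.exists_right hlt
  rw [show {x | (lam, x) ∈ timeCurve g σ L μ} = {x, y} from ?_,
    encard_pair (hx.2.trans hy.1).ne]
  ext z
  rw [mem_ofPred_eq, mem_insert_iff, mem_singleton_iff, h.mem_timeCurve_iff hg]
  constructor
  · rintro ⟨hz, ez⟩
    rcases le_or_gt z α with hle | hgt
    · exact Or.inl (h.anti.injOn ⟨hz.1, hle⟩ ⟨hx.1, hx.2.le⟩ (ez.trans ex.symm))
    · exact Or.inr (h.mono.injOn ⟨hgt.le, hz.2⟩ ⟨hy.1.le, hy.2⟩ (ez.trans ey.symm))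
  · rintro (rfl | rfl)
    · exact ⟨⟨hx.1, hx.2.trans h.turn_lt⟩, ex⟩
    · exact ⟨⟨(h.lt_turn.trans hy.1).le, hy.2⟩, ey⟩

end IsBranch

/-- f equals -μ < 0 at 0 and σ and is positive at θ, which gives a zero on each side of θ; strict
concavity fixes all signs. -/
theorem IsStart.isTheta (hg : IsHump g σ) {L μ lam θ : ℝ} (h : IsStart g σ L μ lam θ) :
    IsTheta g σ μ lam θ := by
  have hμ := h.mu_pos hg
  have hθ := h.mem
  have hforce := h.admissible.force
  have hlam := h.lam_pos
  have hc : Continuous fun u => lam * g u := continuous_const.mul hg.continuous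
  have hconc : ∀ x ∈ Icc 0 σ, ∀ y ∈ Icc 0 σ, ∀ z, x < z → z < y →
      min (lam * g x) (lam * g y) < lam * g z := by
    intro x hx y hy z hxz hzy
    have := hg.concave.lt_on_openSegment hx hy (hxz.trans hzy).ne
      (by rw [openSegment_eq_Ioo (hxz.trans hzy)]; exact ⟨hxz, hzy⟩)
    rw [← mul_min_of_nonneg _ _ hlam.le]
    exact mul_lt_mul_of_pos_left this hlam
  obtain ⟨ς, hς, eς⟩ : μ ∈ (fun u => lam * g u) '' Ioo 0 θ :=
    intermediate_value_Ioo hθ.1.le hc.continuousOn ⟨by simpa [hg.map_zero] using hμ, hforce⟩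
  obtain ⟨β, hβ, eβ⟩ : μ ∈ (fun u => lam * g u) '' Ioo θ σ :=
    intermediate_value_Ioo' hθ.2.le hc.continuousOn ⟨by simpa [hg.map_sigma] using hμ, hforce⟩
  simp only at eς eβ
  have mθ : θ ∈ Icc 0 σ := Ioo_subset_Icc_self hθ
  refine ⟨ς, β, hς.1, hς.2.trans hβ.1, hβ.2, ?_, by linarith, by linarith, ?_, ⟨hς.2, hβ.1⟩, ?_⟩
  · rintro u (hu | hu)
    · by_contra! hneg
      have := hconc u ⟨hu.1.le, (hu.2.trans (hς.2.trans hθ.2)).le⟩ θ mθ ς hu.2 hς.2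
      rw [eς, min_lt_iff] at this
      rcases this with h1 | h1 <;> linarith
    · by_contra! hneg
      have := hconc θ mθ u ⟨(hθ.1.trans (hβ.1.trans hu.1)).le, hu.2.le⟩ β hβ.1 hu.1
      rw [eβ, min_lt_iff] at this
      rcases this with h1 | h1 <;> linarith
  · intro u hu
    have := hconc ς ⟨hς.1.le, (hς.2.trans hθ.2).le⟩ β ⟨(hθ.1.trans hβ.1).le, hβ.2.le⟩ u hu.1 hu.2
    rw [eς, eβ, min_self] at this
    linarith
  · have := h.energy_eq
    unfold potential at this
    linarith

/-! ### Extension of the growth function to the line -/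

/-- The extension of `g` from `[0, ∞)` by its value at `0`. -/
def clamp (g : ℝ → ℝ) (x : ℝ) : ℝ := g (max x 0)

theorem clamp_of_nonneg (g : ℝ → ℝ) {x : ℝ} (hx : 0 ≤ x) : clamp g x = g x := by
  rw [clamp, max_eq_left hx]

theorem isPositiveSolution_clamp_iff {L μ lam : ℝ} {u : ℝ → ℝ} :
    IsPositiveSolution (clamp g) L μ lam u ↔ IsPositiveSolution g L μ lam u := by
  constructor <;> intro h <;>
    refine ⟨h.continuousOn, h.contDiffOn, h.slope, fun x hx => ?_, h.left, h.right, h.pos⟩ <;>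
    have e := h.equation x hx <;>
    simpa only [clamp_of_nonneg g (h.pos x hx).le] using e

theorem bifurcationCurve_clamp (g : ℝ → ℝ) (L μ : ℝ) :
    bifurcationCurve (clamp g) L μ = bifurcationCurve g L μ := by
  simp only [bifurcationCurve, isPositiveSolution_clamp_iff]

theorem positiveSolutions_clamp (g : ℝ → ℝ) (L μ lam : ℝ) :
    positiveSolutions (clamp g) L μ lam = positiveSolutions g L μ lam := by
  simp only [positiveSolutions, isPositiveSolution_clamp_iff]

theorem IsTheta.of_clamp {μ lam θ : ℝ} (h : IsTheta (clamp g) σ μ lam θ) :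
    IsTheta g σ μ lam θ := by
  obtain ⟨ς, β, h1, h2, h3, h4, h5, h6, h7, h8, h9⟩ := h
  have e : ∀ u, 0 < u → clamp g u = g u := fun u hu => clamp_of_nonneg g hu.le
  have hβ := h1.trans h2
  refine ⟨ς, β, h1, h2, h3, fun u hu => ?_, e ς h1 ▸ h5, e β hβ ▸ h6, fun u hu => ?_, h8, ?_⟩
  · have hu0 : 0 < u := by
      rcases hu with hu | hu
      · exact hu.1
      · exact hβ.trans hu.1
    rw [← e u hu0]
    exact h4 u hu
  · rw [← e u (h1.trans hu.1)]
    exact h7 u hu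
  · have hint : ∫ t in (0 : ℝ)..θ, clamp g t = ∫ t in (0 : ℝ)..θ, g t := by
      refine intervalIntegral.integral_congr fun t ht => ?_
      rw [uIcc_of_le (h1.trans h8.1).le] at ht
      exact clamp_of_nonneg g ht.1
    rwa [hint] at h9

/-! ### The clamped growth function as a hump; the slope at zero and κ -/

namespace IsGrowth

theorem map_sigma (hg : IsGrowth g σ) : g σ = 0 := by
  have hc : ContinuousAt g σ :=
    (hg.continuousOn σ hg.sigma_pos.le).continuousAt (Ici_mem_nhds hg.sigma_pos)
  apply le_antisymm
  · refine le_of_tendsto (hc.tendsto.mono_left (nhdsWithin_le_nhds (s := Ioi σ))) ?_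
    filter_upwards [self_mem_nhdsWithin] with u hu
    have hu' : σ < u := hu
    have := hg.sign u (hg.sigma_pos.trans hu') hu'.ne'
    by_contra! hneg
    nlinarith
  · refine ge_of_tendsto (hc.tendsto.mono_left (nhdsWithin_le_nhds (s := Iio σ))) ?_
    filter_upwards [Ioo_mem_nhdsLT hg.sigma_pos] with u hu
    exact (pos_of_mul_pos_right (hg.sign u hu.1 hu.2.ne) (sub_nonneg.2 hu.2.le)).le

theorem isHump_clamp (hg : IsGrowth g σ) : IsHump (clamp g) σ where
  continuous := hg.continuousOn.comp_continuous (by fun_prop) fun x => le_max_right x 0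
  sigma_pos := hg.sigma_pos
  map_zero := by rw [clamp_of_nonneg g le_rfl, hg.map_zero]
  map_sigma := by rw [clamp_of_nonneg g hg.sigma_pos.le, hg.map_sigma]
  pos u hu := by
    rw [clamp_of_nonneg g hu.1.le]
    exact pos_of_mul_pos_right (hg.sign u hu.1 hu.2.ne) (sub_nonneg.2 hu.2.le)
  nonpos u hu := by
    have hu0 := hg.sigma_pos.trans hu
    rw [clamp_of_nonneg g hu0.le]
    have := hg.sign u hu0 hu.ne'
    by_contra! hneg
    nlinarith
  concave := by
    have : StrictConcaveOn ℝ (Icc 0 σ) g :=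
      strictConcaveOn_of_deriv2_neg (convex_Icc 0 σ) (hg.continuousOn.mono Icc_subset_Ici_self)
        fun x hx => hg.concave x (by rwa [interior_Icc] at hx)
    refine ⟨this.1, fun x hx y hy hxy a b ha hb hab => ?_⟩
    rw [clamp_of_nonneg g hx.1, clamp_of_nonneg g hy.1,
      clamp_of_nonneg g (this.1 hx hy ha.le hb.le hab).1]
    exact this.2 hx hy hxy ha hb hab

theorem hasDerivAt (hg : IsGrowth g σ) {x : ℝ} (hx : 0 < x) : HasDerivAt g (deriv g x) x :=
  ((hg.contDiffOn.contDiffAt (Ioi_mem_nhds hx)).differentiableAt (by norm_num)).hasDerivAt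

theorem hasDerivAt_clamp (hg : IsGrowth g σ) {x : ℝ} (hx : 0 < x) :
    HasDerivAt (clamp g) (deriv g x) x :=
  (hg.hasDerivAt hx).congr_of_eventuallyEq <| by
    filter_upwards [Ioi_mem_nhds hx] with y hy using clamp_of_nonneg g (mem_Ioi.1 hy).le

theorem deriv_antitoneOn (hg : IsGrowth g σ) : AntitoneOn (deriv g) (Ioo 0 σ) := by
  refine (strictAntiOn_of_deriv_neg (convex_Ioo 0 σ) (fun x hx => ?_) fun x hx => ?_).antitoneOn
  · exact (differentiableAt_of_deriv_ne_zero (hg.concave x hx).ne).continuousAt.continuousWithinAt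
  · rw [interior_Ioo] at hx
    exact hg.concave x hx

theorem tendsto_deriv_sSup (hg : IsGrowth g σ) :
    Tendsto (fun u : ℝ => ((deriv g u : ℝ) : EReal)) (𝓝[>] (0 : ℝ))
      (𝓝 (sSup ((fun u : ℝ => ((deriv g u : ℝ) : EReal)) '' Ioo 0 σ))) :=
  AntitoneOn.tendsto_nhdsWithin_Ioo_right (nonempty_Ioo.2 hg.sigma_pos)
    (fun _ hx _ hy hxy => EReal.coe_le_coe_iff.2 (hg.deriv_antitoneOn hx hy hxy))
    (OrderTop.bddAbove _)

theorem rightDerivZero_eq (hg : IsGrowth g σ) :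
    rightDerivZero g = sSup ((fun u : ℝ => ((deriv g u : ℝ) : EReal)) '' Ioo 0 σ) :=
  hg.tendsto_deriv_sSup.limUnder_eq

theorem tendsto_deriv (hg : IsGrowth g σ) :
    Tendsto (fun u : ℝ => ((deriv g u : ℝ) : EReal)) (𝓝[>] (0 : ℝ)) (𝓝 (rightDerivZero g)) := by
  rw [hg.rightDerivZero_eq]
  exact hg.tendsto_deriv_sSup

theorem deriv_le_rightDerivZero (hg : IsGrowth g σ) {u : ℝ} (hu : u ∈ Ioo 0 σ) :
    ((deriv g u : ℝ) : EReal) ≤ rightDerivZero g := by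
  rw [hg.rightDerivZero_eq]
  exact le_sSup ⟨u, hu, rfl⟩

theorem rightDerivZero_pos (hg : IsGrowth g σ) : 0 < rightDerivZero g := by
  have hσ := hg.sigma_pos
  obtain ⟨c, hc, e⟩ := exists_hasDerivAt_eq_slope g (deriv g) (half_pos hσ)
    (hg.continuousOn.mono Icc_subset_Ici_self) fun x hx => hg.hasDerivAt hx.1
  have hpos : 0 < g (σ / 2) :=
    pos_of_mul_pos_right (hg.sign _ (half_pos hσ) (by linarith)) (by linarith)
  have hd : 0 < deriv g c := by
    rw [e, hg.map_zero, sub_zero, sub_zero]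
    exact div_pos hpos (half_pos hσ)
  exact (EReal.coe_pos.2 hd).trans_le
    (hg.deriv_le_rightDerivZero ⟨hc.1, hc.2.trans (by linarith)⟩)

theorem exists_monotoneOn (hg : IsGrowth g σ) {γ : ℝ} (hγ : (γ : EReal) < rightDerivZero g) :
    ∃ a ∈ Ioo 0 σ, MonotoneOn (fun u => clamp g u - γ * u) (Icc 0 a) := by
  rw [hg.rightDerivZero_eq, lt_sSup_iff] at hγ
  obtain ⟨_, ⟨a, ha, rfl⟩, hlt⟩ := hγ
  have hlt' : γ < deriv g a := EReal.coe_lt_coe_iff.1 hlt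
  have hd : ∀ x ∈ Ioo 0 a, HasDerivAt (fun u => clamp g u - γ * u) (deriv g x - γ * 1) x :=
    fun x hx => (hg.hasDerivAt_clamp hx.1).sub ((hasDerivAt_id x).const_mul γ)
  have hc := hg.isHump_clamp.continuous
  refine ⟨a, ha, monotoneOn_of_deriv_nonneg (convex_Icc 0 a) (Continuous.continuousOn (by fun_prop))
    (fun x hx => ?_) fun x hx => ?_⟩
  · rw [interior_Icc] at hx
    exact (hd x hx).differentiableAt.differentiableWithinAt
  · rw [interior_Icc] at hx
    rw [(hd x hx).deriv]
    have := hg.deriv_antitoneOn ⟨hx.1, hx.2.trans ha.2⟩ ha hx.2.le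
    linarith

theorem antitoneOn_of_le (hg : IsGrowth g σ) {γ : ℝ} (hγ : rightDerivZero g ≤ γ) :
    AntitoneOn (fun u => clamp g u - γ * u) (Icc 0 σ) := by
  have hd : ∀ x ∈ Ioo 0 σ, HasDerivAt (fun u => clamp g u - γ * u) (deriv g x - γ * 1) x :=
    fun x hx => (hg.hasDerivAt_clamp hx.1).sub ((hasDerivAt_id x).const_mul γ)
  have hc := hg.isHump_clamp.continuous
  refine antitoneOn_of_deriv_nonpos (convex_Icc 0 σ) (Continuous.continuousOn (by fun_prop))
    (fun x hx => ?_) fun x hx => ?_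
  · rw [interior_Icc] at hx
    exact (hd x hx).differentiableAt.differentiableWithinAt
  · rw [interior_Icc] at hx
    rw [(hd x hx).deriv]
    have := EReal.coe_le_coe_iff.1 ((hg.deriv_le_rightDerivZero hx).trans hγ)
    linarith

/-- The number q is the slope whose κ would be exactly `lam`, so κ < lam means q < g'(0⁺), and γ is
chosen in between. An infinite slope needs no condition. -/
theorem exists_slope_lt (hg : IsGrowth g σ) {L lam : ℝ} (hL : 0 < L) (hlam : 0 < lam)
    (hk : kappa g L < lam) :
    ∃ γ : ℝ, 0 < γ ∧ (γ : EReal) < rightDerivZero g ∧ Real.pi ^ 2 < 4 * L ^ 2 * (lam * γ) := by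
  have hpi := Real.pi_pos
  set q := Real.pi ^ 2 / (4 * L ^ 2 * lam) with hq
  have hq0 : 0 < q := by positivity
  have key : ∀ γ, q < γ → Real.pi ^ 2 < 4 * L ^ 2 * (lam * γ) := by
    intro γ h
    rw [hq, div_lt_iff₀ (by positivity)] at h
    linarith
  have hlt : (q : EReal) < rightDerivZero g := by
    rcases eq_or_ne (rightDerivZero g) ⊤ with htop | htop
    · rw [htop]; exact EReal.coe_lt_top q
    · have hpos := hg.rightDerivZero_pos
      have e := EReal.coe_toReal htop (bot_lt_iff_ne_bot.1 (bot_le.trans_lt hpos))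
      rw [kappa, if_neg htop] at hk
      rw [← e] at hpos ⊢
      have hd : 0 < (rightDerivZero g).toReal := EReal.coe_pos.1 hpos
      generalize (rightDerivZero g).toReal = d at *
      rw [EReal.coe_lt_coe_iff, hq, div_lt_iff₀ (by positivity)]
      rw [div_lt_iff₀ (by positivity)] at hk
      linarith
  obtain ⟨γ, h1, h2⟩ := EReal.lt_iff_exists_real_btwn.1 hlt
  have h1 : q < γ := EReal.coe_lt_coe_iff.1 h1
  exact ⟨γ, hq0.trans h1, h2, key γ h1⟩

theorem kappa_nonneg (hg : IsGrowth g σ) (L : ℝ) : 0 ≤ kappa g L := by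
  unfold kappa
  split_ifs with htop
  · exact le_rfl
  · have := EReal.toReal_nonneg hg.rightDerivZero_pos.le
    positivity

/-- The case c = 1 serves `lamBar` and c = 2 serves `lamStar`. If g'(0⁺) is finite, it is itself an
allowed γ. -/
theorem kappa_le (hg : IsGrowth g σ) {L c lam : ℝ} (hL : 0 < L) (hc : 0 < c) (hlam : 0 < lam)
    (h : ∀ γ : ℝ, 0 < γ → AntitoneOn (fun u => clamp g u - γ * u) (Icc 0 σ) →
      Real.pi / (c * Real.sqrt (lam * γ)) < L) : 4 * kappa g L ≤ c ^ 2 * lam := by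
  rcases eq_or_ne (rightDerivZero g) ⊤ with htop | htop
  · rw [kappa, if_pos htop, mul_zero]; positivity
  have hpos := hg.rightDerivZero_pos
  have e := EReal.coe_toReal htop (bot_lt_iff_ne_bot.1 (bot_le.trans_lt hpos))
  have hd : 0 < (rightDerivZero g).toReal := by rw [← e] at hpos; exact EReal.coe_pos.1 hpos
  have h1 := h _ hd (hg.antitoneOn_of_le e.ge)
  rw [kappa, if_neg htop]
  generalize (rightDerivZero g).toReal = d at *
  have hpi := Real.pi_pos
  have hs : 0 < Real.sqrt (lam * d) := Real.sqrt_pos.2 (by positivity)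
  rw [div_lt_iff₀ (by positivity)] at h1
  have h2 := pow_lt_pow_left₀ h1 hpi.le two_ne_zero
  rw [mul_pow, mul_pow, Real.sq_sqrt (by positivity)] at h2
  rw [← mul_div_assoc, div_le_iff₀ (by positivity)]
  nlinarith

end IsGrowth

/-! ### Limits at zero and the final assembly -/

theorem tendsto_nhdsGT_zero_of_bounds {f : ℝ → ℝ} {c : ℝ} (hlow : ∀ μ, 0 < μ → c ≤ f μ)
    (hup : ∀ lam, c < lam → ∀ᶠ μ in 𝓝[>] 0, f μ ≤ lam) : Tendsto f (𝓝[>] 0) (𝓝 c) := by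
  refine tendsto_order.2 ⟨fun a ha => ?_, fun b hb => ?_⟩
  · filter_upwards [self_mem_nhdsWithin] with μ hμ using ha.trans_le (hlow μ hμ)
  · obtain ⟨d, h1, h2⟩ := exists_between hb
    filter_upwards [hup d h1] with μ hμ using hμ.trans_lt h2

theorem pi_div_mul_sqrt_lt {c L x : ℝ} (hc : 0 < c) (hL : 0 < L) (hx : 0 < x)
    (h : Real.pi ^ 2 < L ^ 2 * (c ^ 2 * x)) : Real.pi / (c * Real.sqrt x) < L := by
  have hs : 0 < Real.sqrt x := Real.sqrt_pos.2 hx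
  rw [div_lt_iff₀ (by positivity)]
  refine lt_of_pow_lt_pow_left₀ 2 (by positivity) ?_
  rw [mul_pow, mul_pow, Real.sq_sqrt hx.le]
  exact h

end MinkowskiHarvest

/-- Exact multiplicity of positive solutions: `lamBar μ` is the `lam`-coordinate of the starting
point, and `lamStar μ` that of the turning point, of the bifurcation curve `S_μ`. -/
theorem theorem2p3 (g : ℝ → ℝ) (σ L : ℝ) (hg : MinkowskiHarvest.IsGrowth g σ) (hL : 0 < L) :
    -- `g'(0⁺)` exists and lies in `(0,∞]`
    (Tendsto (fun u : ℝ => ((deriv g u : ℝ) : EReal)) (𝓝[>] (0 : ℝ))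
        (𝓝 (MinkowskiHarvest.rightDerivZero g)) ∧
      0 < MinkowskiHarvest.rightDerivZero g) ∧
    ∃ lamBar lamStar : ℝ → ℝ,
      (∀ μ : ℝ, 0 < μ → ∃ θ α : ℝ,
        MinkowskiHarvest.IsSubsetShaped (MinkowskiHarvest.bifurcationCurve g L μ)
          (lamBar μ, θ) (lamStar μ, α) ∧
        MinkowskiHarvest.IsTheta g σ μ (lamBar μ) θ) ∧
      -- monotonicity, continuity and limits
      (StrictMonoOn lamBar (Ioi 0) ∧ ContinuousOn lamBar (Ioi 0) ∧
        Tendsto lamBar (𝓝[>] 0) (𝓝 (4 * MinkowskiHarvest.kappa g L)) ∧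
        Tendsto lamBar atTop atTop) ∧
      (StrictMonoOn lamStar (Ioi 0) ∧ ContinuousOn lamStar (Ioi 0) ∧
        Tendsto lamStar (𝓝[>] 0) (𝓝 (MinkowskiHarvest.kappa g L)) ∧
        Tendsto lamStar atTop atTop) ∧
      -- exact multiplicity
      (∀ μ lam : ℝ, 0 < μ → 0 < lam →
        (lam < lamStar μ →
          (MinkowskiHarvest.positiveSolutions g L μ lam).encard = 0) ∧
        ((lamBar μ < lam ∨ lam = lamStar μ) →
          (MinkowskiHarvest.positiveSolutions g L μ lam).encard = 1) ∧
        (((lamStar μ < lam ∧ lam < lamBar μ) ∨ lam = lamBar μ) →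
          (MinkowskiHarvest.positiveSolutions g L μ lam).encard = 2)) := by
  refine ⟨⟨hg.tendsto_deriv, hg.rightDerivZero_pos⟩, ?_⟩
  have hh := hg.isHump_clamp
  have hex : ∀ μ : ℝ, ∃ (Λ : ℝ → ℝ) (lamBar θ lamStar α : ℝ), 0 < μ →
      MinkowskiHarvest.IsBranch (MinkowskiHarvest.clamp g) σ L μ Λ lamBar θ lamStar α := by
    intro μ
    by_cases hμ : 0 < μ
    · obtain ⟨Λ, lamBar, θ, lamStar, α, h⟩ := MinkowskiHarvest.exists_isBranch hh hL hμ
      exact ⟨Λ, lamBar, θ, lamStar, α, fun _ => h⟩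
    · exact ⟨0, 0, 0, 0, 0, fun h => absurd h hμ⟩
  choose Λ lamBar θ lamStar α hb using hex
  have hStarMono : StrictMonoOn lamStar (Ioi 0) := fun x hx y hy hxy =>
    (hb x hx).lt_of_mu_lt hh (hb y hy) hxy
  have hBarMono : StrictMonoOn lamBar (Ioi 0) := fun x hx y hy hxy =>
    ((hb x hx).start.lt_of_mu_lt hh (hb y hy).start hxy).1
  have hStarTop : Tendsto lamStar atTop atTop := by
    obtain ⟨M, hM, hbound⟩ := hh.exists_bound
    refine tendsto_atTop_mono' _ ?_ (tendsto_id.atTop_div_const hM)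
    filter_upwards [eventually_gt_atTop 0] with μ hμ
    exact (hb μ hμ).div_le_lamStar hh hM hbound
  have hpi := Real.pi_pos
  refine ⟨lamBar, lamStar, fun μ hμ => ⟨θ μ, α μ, ?_, ((hb μ hμ).start.isTheta hh).of_clamp⟩,
    ⟨hBarMono, MinkowskiHarvest.continuousOn_of_sublinear hBarMono fun x hx y hxy =>
      (hb x hx).start.mul_le_mul_of_lt hh (hb y (hx.trans hxy)).start hxy, ?_, ?_⟩,
    ⟨hStarMono, MinkowskiHarvest.continuousOn_of_sublinear hStarMono fun x hx y hxy =>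
      (hb x hx).mul_le_mul_of_lt hh (hb y (hx.trans hxy)) hxy, ?_, hStarTop⟩,
    fun μ lam hμ hlam => ?_⟩
  · rw [← MinkowskiHarvest.bifurcationCurve_clamp,
      MinkowskiHarvest.bifurcationCurve_eq_timeCurve hh hL hμ]
    exact (hb μ hμ).isSubsetShaped hh
  · have hlow : ∀ μ, 0 < μ → 4 * MinkowskiHarvest.kappa g L ≤ lamBar μ := fun μ hμ => by
      have := hg.kappa_le hL one_pos (hb μ hμ).start.lam_pos fun γ hγ hanti => by
        simpa only [one_mul] using (hb μ hμ).start.pi_div_lt hh hγ hanti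
      simpa only [one_pow, one_mul] using this
    refine MinkowskiHarvest.tendsto_nhdsGT_zero_of_bounds hlow fun lam hlam => ?_
    have hlam0 : 0 < lam := by
      refine lt_of_le_of_lt ?_ hlam
      have := hg.kappa_nonneg L
      positivity
    -- The hypothesis is 4κ < lam, so the slope is selected for lam / 4.
    obtain ⟨γ, hγ, hγD, hlt⟩ := hg.exists_slope_lt hL (lam := lam / 4) (by positivity)
      (by linarith)
    obtain ⟨a, ha, hmono⟩ := hg.exists_monotoneOn hγD
    have hT := MinkowskiHarvest.pi_div_mul_sqrt_lt one_pos hL (mul_pos hlam0 hγ) (by linarith)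
    rw [one_mul] at hT
    filter_upwards [MinkowskiHarvest.eventually_lamBar_le hh hlam0 hγ ha hmono hT,
      self_mem_nhdsWithin] with μ hμ hμ0
    exact hμ _ _ (hb μ hμ0).start
  · refine tendsto_atTop_mono' _ ?_ hStarTop
    filter_upwards [eventually_gt_atTop 0] with μ hμ using (hb μ hμ).lamStar_lt_lamBar.le
  · have hlow : ∀ μ, 0 < μ → MinkowskiHarvest.kappa g L ≤ lamStar μ := fun μ hμ => by
      have := hg.kappa_le hL two_pos ((hb μ hμ).lamStar_pos hh) fun γ hγ hanti =>
        MinkowskiHarvest.pi_div_lt_of_mem_timeCurve hh hμ.le hγ hanti (hb μ hμ).turn_mem_timeCurve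
      linarith
    refine MinkowskiHarvest.tendsto_nhdsGT_zero_of_bounds hlow fun lam hlam => ?_
    have hlam0 : 0 < lam := (hg.kappa_nonneg L).trans_lt hlam
    obtain ⟨γ, hγ, hγD, hlt⟩ := hg.exists_slope_lt hL hlam0 hlam
    obtain ⟨a, ha, hmono⟩ := hg.exists_monotoneOn hγD
    filter_upwards [MinkowskiHarvest.eventually_lamStar_le hh hlam0 hγ ha hmono
      (MinkowskiHarvest.pi_div_mul_sqrt_lt two_pos hL (mul_pos hlam0 hγ) (by linarith)),
      self_mem_nhdsWithin] with μ hμ hμ0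
    exact hμ _ _ _ _ _ (hb μ hμ0)
  · rw [← MinkowskiHarvest.positiveSolutions_clamp,
      MinkowskiHarvest.encard_positiveSolutions hh hL hμ hlam]
    have hbr := hb μ hμ
    refine ⟨hbr.encard_eq_zero hh, hbr.encard_eq_one hh, ?_⟩
    rintro (⟨h1, h2⟩ | rfl)
    · exact hbr.encard_eq_two hh h1 h2.le
    · exact hbr.encard_eq_two hh hbr.lamStar_lt_lamBar le_rfl
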